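/- **Super Bruhat regularity theorem.** Let $\mathbb K\in\{\mathbb R,\mathbb C\}$ and let $G$ be a Lie supergroup over $\mathbb K$, i.e. a group object in the category of real supermanifolds ($\mathbb K=\mathbb R$) or of *cs* manifolds ($\mathbb K=\mathbb C$), whose underlying Lie group $G_0$ is $\sigma$-compact. Let $\mathfrak g$ be its Lie superalgebra and $\mathcal O_G$ its structure sheaf. Let $\Gamma_c(\mathcal O_G)$ be the space of compactly supported global superfunctions, with the inductive limit of the topologies of the subspaces $\Gamma_C(\mathcal O_G)$ ($C\subseteq G_0$ compact) given by the seminorms $p_{u,v,K}(f)=\sup_{x\in K}|(L_uR_vf)(x)|$, where $K\subseteq G_0$ is compact, $u,v\in\mathfrak U(\mathfrak g)$, and $L$, $R$ are the left and right regular representations. Let $\mathcal D'(G)=\Gamma_c(\mathcal O_G)'$ be the space of superdistributions, i.e. of continuous linear functionals on $\Gamma_c(\mathcal O_G)$. Call $\mu\in\mathcal D'(G)$ left-invariant under $G$ if $\langle\mu,L_g\varphi\rangle=\langle\mu,\varphi\rangle$ for all $g\in G_0$ and $\langle\mu,L_x\varphi\rangle=0$ for all $x\in\mathfrak g$, for every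 $\varphi\in\Gamma_c(\mathcal O_G)$. Berezinian densities, i.e. global sections $\omega$ of $\mathrm{or}_{G_0}\otimes\mathrm{Ber}_G$, are regarded as superdistributions through the Berezin integral, $\langle\omega,\varphi\rangle=\int_G\omega\varphi$. Let $|Dg|$ be an invariant Berezinian density on $G$, i.e. a nowhere vanishing Berezinian density that is left-invariant under $G$. If $\mu\in\mathcal D'(G)$ is left-invariant under $G$, then $\mu=c\,|Dg|$ for some constant $c\in\mathbb K$. -/

import Mathlib

open TopologicalSpace Set MeasureTheory CategoryTheory CategoryTheory.Limits
open scoped ContDiff NNReal ENNReal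

noncomputable section

/-! ## Superspaces

`𝕜` is `ℝ` (real supermanifolds) or `ℂ` (*cs* manifolds). -/

/-- A `𝕜`-superspace: a topological space together with a sheaf of supercommutative
`𝕜`-superalgebras. (That the stalks are local is automatic for the supermanifolds below, since
they are locally isomorphic to affine superspaces.) -/
structure SuperSpace (𝕜 : Type) [RCLike 𝕜] where
  /-- the underlying space -/
  carrier : Type
  [topology : TopologicalSpace carrier]
  /-- sections over an open set -/
  sec : Opens carrier → Type
  [secRing : ∀ U, Ring (sec U)]
  [secAlgebra : ∀ U, Algebra 𝕜 (sec U)]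
  /-- the homogeneous sections of a given parity -/
  part : ∀ U, ZMod 2 → Submodule 𝕜 (sec U)
  part_isCompl : ∀ U, IsCompl (part U 0) (part U 1)
  one_mem_part : ∀ U, (1 : sec U) ∈ part U 0
  mul_mem_part : ∀ {U} {i j : ZMod 2} {a b : sec U},
    a ∈ part U i → b ∈ part U j → a * b ∈ part U (i + j)
  supercomm : ∀ {U} {i j : ZMod 2} {a b : sec U},
    a ∈ part U i → b ∈ part U j → a * b = (-1 : 𝕜) ^ (i * j).val • (b * a)
  /-- restriction of sections -/
  res : ∀ {U V : Opens carrier}, U ≤ V → sec V →ₐ[𝕜] sec U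
  res_part : ∀ {U V : Opens carrier} (h : U ≤ V) {i : ZMod 2} {f : sec V},
    f ∈ part V i → res h f ∈ part U i
  res_refl : ∀ {U : Opens carrier} (h : U ≤ U) (f : sec U), res h f = f
  res_res : ∀ {U V W : Opens carrier} (h : U ≤ V) (h' : V ≤ W) (f : sec W),
    res h (res h' f) = res (h.trans h') f
  sheaf_ext : ∀ {ι : Type} (U : ι → Opens carrier) (s t : sec (⨆ i, U i)),
    (∀ i, res (le_iSup U i) s = res (le_iSup U i) t) → s = t
  sheaf_glue : ∀ {ι : Type} (U : ι → Opens carrier) (s : ∀ i, sec (U i)),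
    (∀ i j, res (inf_le_left : U i ⊓ U j ≤ U i) (s i) =
      res (inf_le_right : U i ⊓ U j ≤ U j) (s j)) →
    ∃ t : sec (⨆ i, U i), ∀ i, res (le_iSup U i) t = s i

attribute [instance] SuperSpace.topology SuperSpace.secRing SuperSpace.secAlgebra

namespace SuperSpace

variable {𝕜 : Type} [RCLike 𝕜]

/-- A morphism of superspaces `X → Y`: a continuous map `φ₀` and an even unital morphism of sheaves
of superalgebras `φ₀⁻¹ 𝒪_Y → 𝒪_X`, given by compatible maps `𝒪_Y(V) → 𝒪_X(U)` for all open
`V ⊆ Y₀` and `U ⊆ φ₀⁻¹(V)`. -/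
structure Hom (X Y : SuperSpace 𝕜) where
  base : X.carrier → Y.carrier
  continuous_base : Continuous base
  pull : ∀ (U : Opens X.carrier) (V : Opens Y.carrier), (∀ x ∈ U, base x ∈ V) →
    Y.sec V →ₐ[𝕜] X.sec U
  pull_part : ∀ U V h (i : ZMod 2) (f : Y.sec V), f ∈ Y.part V i → pull U V h f ∈ X.part U i
  pull_res : ∀ U V h U' V' h' (hU : U' ≤ U) (hV : V' ≤ V) (f : Y.sec V),
    pull U' V' h' (Y.res hV f) = X.res hU (pull U V h f)

theorem Hom.ext' {X Y : SuperSpace 𝕜} {f g : Hom X Y} (hb : f.base = g.base)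
    (hp : ∀ U V hf hg s, f.pull U V hf s = g.pull U V hg s) : f = g := by
  cases f with
  | mk fb fc fp _ _ =>
    cases g with
    | mk gb gc gp _ _ =>
      obtain rfl : fb = gb := hb
      have : fp = gp := by
        funext U V h
        exact AlgHom.ext fun s => hp U V h h s
      subst this
      rfl

/-- The identity morphism. -/
def Hom.id (X : SuperSpace 𝕜) : Hom X X where
  base := fun x => x
  continuous_base := continuous_id
  pull _ _ h := X.res h
  pull_part _ _ h _ _ hf := X.res_part h hf
  pull_res _ _ _ _ _ _ _ _ _ := by simp only [X.res_res]

/-- Composition of morphisms, in diagrammatic order. -/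
def Hom.comp {X Y Z : SuperSpace 𝕜} (f : Hom X Y) (g : Hom Y Z) : Hom X Z where
  base := fun x => g.base (f.base x)
  continuous_base := g.continuous_base.comp f.continuous_base
  pull U W h :=
    (f.pull U ⟨g.base ⁻¹' W, W.isOpen.preimage g.continuous_base⟩ h).comp
      (g.pull ⟨g.base ⁻¹' W, W.isOpen.preimage g.continuous_base⟩ W fun _ hx => hx)
  pull_part U W h i s hs := f.pull_part _ _ _ _ _ (g.pull_part _ _ _ _ _ hs)
  pull_res U W h U' W' h' hU hW s := by
    simp only [AlgHom.comp_apply]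
    rw [g.pull_res ⟨g.base ⁻¹' W, W.isOpen.preimage g.continuous_base⟩ W (fun _ hx => hx)
        ⟨g.base ⁻¹' W', W'.isOpen.preimage g.continuous_base⟩ W' (fun _ hx => hx)
        (fun x (hx : g.base x ∈ W') => hW hx) hW,
      f.pull_res U ⟨g.base ⁻¹' W, W.isOpen.preimage g.continuous_base⟩ h U'
        ⟨g.base ⁻¹' W', W'.isOpen.preimage g.continuous_base⟩ h' hU
        (fun x (hx : g.base x ∈ W') => hW hx)]

theorem Hom.pull_eq {X Y : SuperSpace 𝕜} (f : Hom X Y) (U : Opens X.carrier)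
    (V V' : Opens Y.carrier) (h) (h') (hV : V' ≤ V) (s : Y.sec V) :
    f.pull U V' h' (Y.res hV s) = f.pull U V h s := by
  rw [f.pull_res U V h U V' h' le_rfl hV, X.res_refl]

/-- Pullback of global sections along a morphism. -/
def Hom.gpull {X Y : SuperSpace 𝕜} (f : Hom X Y) : Y.sec ⊤ →ₐ[𝕜] X.sec ⊤ :=
  f.pull ⊤ ⊤ fun _ _ => trivial

/-- `f` takes the value `c` at `x`: the germ of `f - c` at `x` is not invertible. -/
def IsValue (X : SuperSpace 𝕜) (f : X.sec ⊤) (x : X.carrier) (c : 𝕜) : Prop :=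
  ∀ U : Opens X.carrier, x ∈ U → ¬ IsUnit (X.res (le_top : U ≤ ⊤) (f - algebraMap 𝕜 _ c))

/-- The value `f(x) ∈ 𝕜` of a superfunction at a point (on a supermanifold there is exactly one
`c` with `IsValue f x c`). -/
def value (X : SuperSpace 𝕜) (f : X.sec ⊤) (x : X.carrier) : 𝕜 :=
  Classical.epsilon (X.IsValue f x)

/-- The support of a global section: the set of points where its germ is non-zero. -/
def supp (X : SuperSpace 𝕜) (f : X.sec ⊤) : Set X.carrier :=
  {x | ∀ U : Opens X.carrier, x ∈ U → X.res (le_top : U ≤ ⊤) f ≠ 0}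

theorem isClosed_supp (X : SuperSpace 𝕜) (f : X.sec ⊤) : IsClosed (X.supp f) := by
  rw [← isOpen_compl_iff, isOpen_iff_forall_mem_open]
  intro x hx
  simp only [supp, mem_compl_iff, mem_ofPred_eq, not_forall, not_not] at hx
  obtain ⟨U, hxU, hU⟩ := hx
  exact ⟨U, fun y hy hy' => hy' U hy hU, U.isOpen, hxU⟩

/-- `Γ_c(𝒪_X)`: the global sections with compact support. -/
def compactSections (X : SuperSpace 𝕜) : Submodule 𝕜 (X.sec ⊤) where
  carrier := {f | IsCompact (X.supp f)}
  zero_mem' := by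
    have : X.supp 0 = ∅ := by
      ext x
      simp only [supp, mem_ofPred_eq, map_zero, mem_empty_iff_false, iff_false]
      exact fun h => h ⊤ trivial rfl
    simp [this]
  add_mem' := by
    intro f g hf hg
    refine (IsCompact.union hf hg).of_isClosed_subset (X.isClosed_supp _) fun x hx => ?_
    by_contra hcon
    simp only [supp, mem_union, mem_ofPred_eq, not_or, not_forall, not_not] at hcon
    obtain ⟨⟨U, hU, hfU⟩, ⟨V, hV, hgV⟩⟩ := hcon
    refine hx (U ⊓ V) ⟨hU, hV⟩ ?_
    rw [map_add, ← X.res_res (inf_le_left : U ⊓ V ≤ U) le_top f,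
      ← X.res_res (inf_le_right : U ⊓ V ≤ V) le_top g, hfU, hgV]
    simp
  smul_mem' := by
    intro c f hf
    refine IsCompact.of_isClosed_subset hf (X.isClosed_supp _) fun x hx U hU h0 => ?_
    exact hx U hU (by rw [map_smul, h0, smul_zero])

/-- A homogeneous superderivation, of parity `i`, of the algebra of global sections. -/
structure IsSuperderivation (X : SuperSpace 𝕜) (i : ZMod 2) (D : Module.End 𝕜 (X.sec ⊤)) :
    Prop where
  map_part : ∀ (j : ZMod 2) (a : X.sec ⊤), a ∈ X.part ⊤ j → D a ∈ X.part ⊤ (i + j)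
  leibniz : ∀ (j : ZMod 2) (a b : X.sec ⊤), a ∈ X.part ⊤ j →
    D (a * b) = D a * b + (-1 : 𝕜) ^ (i * j).val • (a * D b)

end SuperSpace

/-! ## Affine superspaces -/

/-- The Grassmann algebra over `𝕜` on `q` generators `ξ₁, …, ξ_q`. -/
abbrev Grassmann (𝕜 : Type) [RCLike 𝕜] (q : ℕ) : Type := ExteriorAlgebra 𝕜 (Fin q → 𝕜)

namespace Grassmann

variable (𝕜 : Type) [RCLike 𝕜]

/-- The basis of the monomials `ξ_I`, `I ⊆ {1, …, q}`, the factors in increasing order. -/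
def monomialBasis (q : ℕ) : Module.Basis (Finset (Fin q)) 𝕜 (Grassmann 𝕜 q) :=
  (Pi.basisFun 𝕜 (Fin q)).ExteriorAlgebra

variable {𝕜}

/-- The coefficient of the monomial `ξ_I`. -/
def coeff {q : ℕ} (I : Finset (Fin q)) : Grassmann 𝕜 q →ₗ[𝕜] 𝕜 := (monomialBasis 𝕜 q).coord I

/-- The even (`i = 0`) and the odd (`i = 1`) part. -/
def part (q : ℕ) (i : ZMod 2) : Submodule 𝕜 (Grassmann 𝕜 q) :=
  CliffordAlgebra.evenOdd (0 : QuadraticForm 𝕜 (Fin q → 𝕜)) i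

theorem supercomm {q : ℕ} {i j : ZMod 2} {a b : Grassmann 𝕜 q} (ha : a ∈ part q i)
    (hb : b ∈ part q j) : a * b = (-1 : 𝕜) ^ (i * j).val • (b * a) := by
  have h := CliffordAlgebra.map_mul_map_of_isOrtho_of_mem_evenOdd
    (QuadraticMap.Isometry.id (0 : QuadraticForm 𝕜 (Fin q → 𝕜)))
    (QuadraticMap.Isometry.id (0 : QuadraticForm 𝕜 (Fin q → 𝕜)))
    (fun x y => by simp [QuadraticMap.IsOrtho]) a b ha hb
  simp only [CliffordAlgebra.map_id, AlgHom.id_apply] at h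
  refine h.trans ?_
  have e : ∀ i j : ZMod 2, ((((-1 : ℤˣ) ^ (j * i) : ℤˣ) : ℤ)) = (-1 : ℤ) ^ (i * j).val := by decide
  rw [Units.smul_def, e, ← Int.cast_smul_eq_zsmul 𝕜]
  simp

/-- Every linear endomorphism of the Grassmann algebra is given by a matrix in the monomials. -/
theorem coeff_map {q : ℕ} (T : Grassmann 𝕜 q →ₗ[𝕜] Grassmann 𝕜 q) (I : Finset (Fin q))
    (a : Grassmann 𝕜 q) :
    coeff I (T a) = ∑ J, coeff J a * coeff I (T (monomialBasis 𝕜 q J)) := by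
  conv_lhs => rw [← (monomialBasis 𝕜 q).sum_repr a, map_sum, map_sum]
  exact Finset.sum_congr rfl fun J _ => by rw [map_smul, map_smul]; rfl

theorem coeff_mul {q : ℕ} (I : Finset (Fin q)) (a b : Grassmann 𝕜 q) :
    coeff I (a * b) = ∑ J, ∑ L, coeff J a * coeff L b *
      coeff I (monomialBasis 𝕜 q J * monomialBasis 𝕜 q L) := by
  have h1 := coeff_map (LinearMap.mulRight 𝕜 b) I a
  simp only [LinearMap.mulRight_apply] at h1
  rw [h1]
  refine Finset.sum_congr rfl fun J _ => ?_
  have h2 := coeff_map (LinearMap.mulLeft 𝕜 (monomialBasis 𝕜 q J)) I b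
  simp only [LinearMap.mulLeft_apply] at h2
  rw [h2, Finset.mul_sum]
  exact Finset.sum_congr rfl fun L _ => by ring

end Grassmann

/-- Extension by zero of a function on an open subset of `ℝ^p`. -/
def extendZero {𝕜 : Type} [RCLike 𝕜] {p : ℕ} {V : Opens (EuclideanSpace ℝ (Fin p))} (g : V → 𝕜) :
    EuclideanSpace ℝ (Fin p) → 𝕜 :=
  Function.extend Subtype.val g 0

theorem extendZero_apply {𝕜 : Type} [RCLike 𝕜] {p : ℕ} {V : Opens (EuclideanSpace ℝ (Fin p))}
    (g : V → 𝕜) (y : V) : extendZero g (y : EuclideanSpace ℝ (Fin p)) = g y :=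
  Subtype.val_injective.extend_apply g 0 y

section Affine

variable (𝕜 : Type) [RCLike 𝕜] (p q : ℕ)

/-- Smoothness of a function with values in the Grassmann algebra: all its coefficients are
smooth. -/
def IsSmoothGrassmann {𝕜 : Type} [RCLike 𝕜] {p q : ℕ} {V : Opens (EuclideanSpace ℝ (Fin p))}
    (f : V → Grassmann 𝕜 q) : Prop :=
  ∀ I : Finset (Fin q), ContDiffOn ℝ ∞ (extendZero fun y => Grassmann.coeff I (f y)) V

variable {𝕜 p q} in
theorem IsSmoothGrassmann.map {V : Opens (EuclideanSpace ℝ (Fin p))} {f : V → Grassmann 𝕜 q}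
    (hf : IsSmoothGrassmann f) (T : Grassmann 𝕜 q →ₗ[𝕜] Grassmann 𝕜 q) :
    IsSmoothGrassmann fun y => T (f y) := by
  intro I
  have : ContDiffOn ℝ ∞ (fun y => ∑ J, extendZero (fun y => Grassmann.coeff J (f y)) y *
      Grassmann.coeff I (T (Grassmann.monomialBasis 𝕜 q J)))
      (V : Set (EuclideanSpace ℝ (Fin p))) :=
    ContDiffOn.sum fun J _ => (hf J).mul contDiffOn_const
  refine this.congr fun y hy => ?_
  have e : ∀ g : V → 𝕜, extendZero g y = g ⟨y, hy⟩ := fun g => extendZero_apply g ⟨y, hy⟩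
  simp only [e]
  exact Grassmann.coeff_map T I _

/-- Smooth functions on `V ⊆ ℝ^p` with values in the Grassmann algebra on `q` generators, i.e. the
algebra `C^∞(V, 𝕜) ⊗ Λ(ξ₁, …, ξ_q)`. -/
def superFunctions (V : Opens (EuclideanSpace ℝ (Fin p))) : Subalgebra 𝕜 (V → Grassmann 𝕜 q) where
  carrier := {f | IsSmoothGrassmann f}
  mul_mem' := by
    intro f g hf hg I
    have : ContDiffOn ℝ ∞ (fun y => ∑ J, ∑ L, extendZero (fun y => Grassmann.coeff J (f y)) y *
        extendZero (fun y => Grassmann.coeff L (g y)) y *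
        Grassmann.coeff I (Grassmann.monomialBasis 𝕜 q J * Grassmann.monomialBasis 𝕜 q L))
        (V : Set (EuclideanSpace ℝ (Fin p))) :=
      ContDiffOn.sum fun J _ => ContDiffOn.sum fun L _ =>
        ((hf J).mul (hg L)).mul contDiffOn_const
    refine this.congr fun y hy => ?_
    have e : ∀ g : V → 𝕜, extendZero g y = g ⟨y, hy⟩ := fun g => extendZero_apply g ⟨y, hy⟩
    simp only [e]
    exact Grassmann.coeff_mul I _ _
  add_mem' := by
    intro f g hf hg I
    refine ((hf I).add (hg I)).congr fun y hy => ?_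
    have e : ∀ g : V → 𝕜, extendZero g y = g ⟨y, hy⟩ := fun g => extendZero_apply g ⟨y, hy⟩
    simp [e]
  algebraMap_mem' := by
    intro c I
    refine (contDiffOn_const (c := Grassmann.coeff I (algebraMap 𝕜 (Grassmann 𝕜 q) c))).congr
      fun y hy => ?_
    exact extendZero_apply _ (⟨y, hy⟩ : V)

/-- The affine superspace `𝔸^{p|q}`: the space `ℝ^p` with the sheaf `C^∞ ⊗ Λ(ξ₁, …, ξ_q)`. -/
def affineSuperspace : SuperSpace 𝕜 where
  carrier := EuclideanSpace ℝ (Fin p)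
  sec V := superFunctions 𝕜 p q V
  part V i :=
    { carrier := {f | ∀ y, f.1 y ∈ Grassmann.part q i}
      zero_mem' := fun _ => Submodule.zero_mem _
      add_mem' := fun hf hg y => Submodule.add_mem _ (hf y) (hg y)
      smul_mem' := fun c _ hf y => Submodule.smul_mem _ c (hf y) }
  part_isCompl V := by
    have hc := CliffordAlgebra.evenOdd_isCompl (Q := (0 : QuadraticForm 𝕜 (Fin q → 𝕜)))
    constructor
    · rw [Submodule.disjoint_def]
      intro f h0 h1
      refine Subtype.ext (funext fun y => ?_)
      exact Submodule.disjoint_def.1 hc.disjoint _ (h0 y) (h1 y)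
    · rw [codisjoint_iff, Submodule.eq_top_iff']
      intro f
      let T₀ : Grassmann 𝕜 q →ₗ[𝕜] Grassmann 𝕜 q :=
        (Submodule.subtype _).comp (Submodule.projectionOnto _ _ hc)
      let T₁ : Grassmann 𝕜 q →ₗ[𝕜] Grassmann 𝕜 q :=
        (Submodule.subtype _).comp (Submodule.projectionOnto _ _ hc.symm)
      refine Submodule.mem_sup.2 ⟨⟨_, IsSmoothGrassmann.map f.2 T₀⟩, fun y => ?_,
        ⟨_, IsSmoothGrassmann.map f.2 T₁⟩, fun y => ?_, ?_⟩
      · exact (Submodule.projectionOnto _ _ hc (f.1 y)).2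
      · exact (Submodule.projectionOnto _ _ hc.symm (f.1 y)).2
      · refine Subtype.ext (funext fun y => ?_)
        exact Submodule.projection_add_projection_eq_self hc (f.1 y)
  one_mem_part V y := SetLike.GradedOne.one_mem (A := CliffordAlgebra.evenOdd _)
  mul_mem_part hf hg y :=
    SetLike.GradedMul.mul_mem (A := CliffordAlgebra.evenOdd _) (hf y) (hg y)
  supercomm hf hg := Subtype.ext (funext fun y => Grassmann.supercomm (hf y) (hg y))
  res {U V} h :=
    { toFun := fun f => ⟨fun y => f.1 ⟨y, h y.2⟩, fun I => by
        refine ((f.2 I).mono h).congr fun y hy => ?_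
        exact (extendZero_apply _ (⟨y, hy⟩ : U)).trans
          (extendZero_apply (fun y => Grassmann.coeff I (f.1 y)) (⟨y, h hy⟩ : V)).symm⟩
      map_one' := rfl
      map_mul' := fun _ _ => rfl
      map_zero' := rfl
      map_add' := fun _ _ => rfl
      commutes' := fun _ => rfl }
  res_part h _ _ hf y := hf _
  res_refl _ _ := rfl
  res_res _ _ _ := rfl
  sheaf_ext U s t h := by
    refine Subtype.ext (funext fun y => ?_)
    obtain ⟨i, hi⟩ := Opens.mem_iSup.1 y.2
    exact congrFun (congrArg Subtype.val (h i)) ⟨y.1, hi⟩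
  sheaf_glue {ι} U s h := by
    have hex : ∀ y : ((⨆ i, U i : Opens (EuclideanSpace ℝ (Fin p)))), ∃ i, y.1 ∈ U i :=
      fun y => Opens.mem_iSup.1 y.2
    choose k hk using hex
    have key : ∀ i (y : EuclideanSpace ℝ (Fin p)) (hy : y ∈ U i)
        (hy' : y ∈ (⨆ i, U i : Opens (EuclideanSpace ℝ (Fin p)))),
        (s (k ⟨y, hy'⟩)).1 ⟨y, hk ⟨y, hy'⟩⟩ = (s i).1 ⟨y, hy⟩ := fun i y hy hy' =>
      congrFun (congrArg Subtype.val (h (k ⟨y, hy'⟩) i)) ⟨y, hk ⟨y, hy'⟩, hy⟩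
    refine ⟨⟨fun y => (s (k y)).1 ⟨y, hk y⟩, fun I y hy => ?_⟩, fun i => ?_⟩
    · obtain ⟨i, hi⟩ := Opens.mem_iSup.1 hy
      refine ContDiffAt.contDiffWithinAt ?_
      refine (((s i).2 I).contDiffAt ((U i).isOpen.mem_nhds hi)).congr_of_eventuallyEq ?_
      filter_upwards [(U i).isOpen.mem_nhds hi] with z hz
      have hz' : z ∈ (⨆ i, U i : Opens (EuclideanSpace ℝ (Fin p))) := Opens.mem_iSup.2 ⟨i, hz⟩
      refine (extendZero_apply _ ⟨z, hz'⟩).trans (Eq.trans ?_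
        (extendZero_apply (fun y => Grassmann.coeff I ((s i).1 y)) ⟨z, hz⟩).symm)
      exact congrArg _ (key i z hz hz')
    · exact Subtype.ext (funext fun y => key i y.1 y.2 _)

end Affine

/-! ## Supermanifolds -/

/-- A chart of superdimension `p|q`: an isomorphism of an open subspace of `X` onto an open subspace
of `𝔸^{p|q}`, i.e. a homeomorphism `base` of open sets and a compatible isomorphism of the sheaves
of superalgebras. -/
structure SuperChart {𝕜 : Type} [RCLike 𝕜] (X : SuperSpace 𝕜) (p q : ℕ) where
  base : OpenPartialHomeomorph X.carrier (EuclideanSpace ℝ (Fin p))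
  iso : ∀ W : Opens X.carrier, (W : Set X.carrier) ⊆ base.source →
    X.sec W ≃ₐ[𝕜] (affineSuperspace 𝕜 p q).sec
      ⟨base.target ∩ base.symm ⁻¹' W, base.isOpen_inter_preimage_symm W.isOpen⟩
  iso_part : ∀ W hW (i : ZMod 2) (f : X.sec W), f ∈ X.part W i →
    iso W hW f ∈ (affineSuperspace 𝕜 p q).part _ i
  iso_res : ∀ W hW W' hW' (h : W' ≤ W) (f : X.sec W),
    iso W' hW' (X.res h f) =
      (affineSuperspace 𝕜 p q).res (inter_subset_inter_right _ (preimage_mono h)) (iso W hW f)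

namespace SuperChart

variable {𝕜 : Type} [RCLike 𝕜] {X : SuperSpace 𝕜} {p q : ℕ}

/-- The domain of a chart. -/
def dom (c : SuperChart X p q) : Opens X.carrier := ⟨c.base.source, c.base.open_source⟩

/-- The image in `ℝ^p` of (the part in the domain of the chart of) an open set. -/
def img (c : SuperChart X p q) (W : Opens X.carrier) : Opens (EuclideanSpace ℝ (Fin p)) :=
  ⟨c.base.target ∩ c.base.symm ⁻¹' W, c.base.isOpen_inter_preimage_symm W.isOpen⟩

theorem img_mono (c : SuperChart X p q) {W W' : Opens X.carrier} (h : W' ≤ W) :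
    c.img W' ≤ c.img W := fun _ hy => ⟨hy.1, h hy.2⟩

/-- The coordinate expression of a section over an open subset of the domain of the chart. -/
def expr (c : SuperChart X p q) (W : Opens X.carrier) (hW : W ≤ c.dom) (f : X.sec W) :
    superFunctions 𝕜 p q (c.img W) :=
  c.iso W hW f

/-- The section over `W` with a given coordinate expression. -/
def ofExpr (c : SuperChart X p q) (W : Opens X.carrier) (hW : W ≤ c.dom)
    (f : superFunctions 𝕜 p q (c.img W)) : X.sec W :=
  (c.iso W hW).symm f

end SuperChart

/-- A supermanifold: a superspace that is locally isomorphic to open subspaces of affine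
superspaces. -/
structure Supermanifold (𝕜 : Type) [RCLike 𝕜] extends SuperSpace 𝕜 where
  exists_chart : ∀ x : carrier, ∃ (p q : ℕ) (c : SuperChart toSuperSpace p q), x ∈ c.dom

/-- The category of supermanifolds, a full subcategory of the category of superspaces. -/
instance (𝕜 : Type) [RCLike 𝕜] : Category (Supermanifold 𝕜) where
  Hom X Y := SuperSpace.Hom X.toSuperSpace Y.toSuperSpace
  id X := SuperSpace.Hom.id X.toSuperSpace
  comp f g := SuperSpace.Hom.comp f g
  id_comp f := SuperSpace.Hom.ext' rfl fun U V hf hg s => by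
    simp only [SuperSpace.Hom.comp, SuperSpace.Hom.id, AlgHom.comp_apply]
    exact (f.pull_res _ V (fun _ hx => hx) U V hg hf le_rfl s).symm.trans
      (by rw [SuperSpace.res_refl])
  comp_id f := SuperSpace.Hom.ext' rfl fun U V hf hg s => f.pull_eq _ _ _ _ _ _ _
  assoc f g h := SuperSpace.Hom.ext' rfl fun U V hf hg s => rfl

/-! ## Berezinian densities -/

section Berezinian

variable {𝕜 : Type} [RCLike 𝕜] {p q : ℕ}

/-- The Leibniz determinant, for matrices with pairwise commuting entries in a possibly
noncommutative ring. -/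
def leibnizDet {R : Type} [Ring R] {n : ℕ} (M : Matrix (Fin n) (Fin n) R) : R :=
  ∑ σ : Equiv.Perm (Fin n),
    ((Equiv.Perm.sign σ : ℤˣ) : ℤ) • (List.ofFn fun i => M (σ i) i).prod

/-- The Berezinian `det (A - B D⁻¹ C) (det D)⁻¹` of the even supermatrix `(A B; C D)`. -/
def berezinian {R : Type} [Ring R] (A : Matrix (Fin p) (Fin p) R) (B : Matrix (Fin p) (Fin q) R)
    (C : Matrix (Fin q) (Fin p) R) (D : Matrix (Fin q) (Fin q) R) : R :=
  leibnizDet (A - B * Ring.inverse D * C) * Ring.inverse (leibnizDet D)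

/-- The even coordinate function `x_i` of `𝔸^{p|q}`. -/
def evenCoord (𝕜 : Type) [RCLike 𝕜] (p q : ℕ) (V : Opens (EuclideanSpace ℝ (Fin p)))
    (i : Fin p) : superFunctions 𝕜 p q V :=
  ⟨fun y => algebraMap 𝕜 _ ((y.1 i : ℝ) : 𝕜), fun I => by
    have h : ContDiffOn ℝ ∞ (fun y : EuclideanSpace ℝ (Fin p) =>
        (y i) • Grassmann.coeff (𝕜 := 𝕜) (q := q) I 1) V :=
      ((EuclideanSpace.proj i : EuclideanSpace ℝ (Fin p) →L[ℝ] ℝ).contDiff.contDiffOn).smul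
        contDiffOn_const
    refine h.congr fun y hy => ?_
    refine (extendZero_apply _ (⟨y, hy⟩ : V)).trans ?_
    change Grassmann.coeff I (algebraMap 𝕜 (Grassmann 𝕜 q) ((y i : ℝ) : 𝕜)) = _
    rw [Algebra.algebraMap_eq_smul_one, map_smul, smul_eq_mul, RCLike.real_smul_eq_coe_mul]⟩

/-- The odd coordinate function `ξ_j` of `𝔸^{p|q}`. -/
def oddCoord (𝕜 : Type) [RCLike 𝕜] (p q : ℕ) (V : Opens (EuclideanSpace ℝ (Fin p)))
    (j : Fin q) : superFunctions 𝕜 p q V :=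
  ⟨fun _ => ExteriorAlgebra.ι 𝕜 (Pi.single j 1), fun I =>
    (contDiffOn_const (c := Grassmann.coeff I (ExteriorAlgebra.ι 𝕜 (Pi.single j 1)))).congr
      fun y hy => extendZero_apply _ (⟨y, hy⟩ : V)⟩

/-- The value at `y` of `∂f/∂x_k`, taken coefficient by coefficient. -/
def evenDeriv {V : Opens (EuclideanSpace ℝ (Fin p))} (k : Fin p) (f : superFunctions 𝕜 p q V)
    (y : V) : Grassmann 𝕜 q :=
  ∑ I, (fderiv ℝ (extendZero fun z => Grassmann.coeff I (f.1 z)) y (EuclideanSpace.single k 1)) •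
    Grassmann.monomialBasis 𝕜 q I

/-- The value at `y` of the (left) derivative `∂f/∂ξ_l`. -/
def oddDeriv {V : Opens (EuclideanSpace ℝ (Fin p))} (l : Fin q) (f : superFunctions 𝕜 p q V)
    (y : V) : Grassmann 𝕜 q :=
  CliffordAlgebra.contractLeft (LinearMap.proj l : Module.Dual 𝕜 (Fin q → 𝕜)) (f.1 y)

variable {X : SuperSpace 𝕜}

namespace SuperChart

variable (c c' : SuperChart X p q)

/-- The coordinate change from `c'` to `c` on the common domain: it expresses in the coordinates
`(x, ξ)` of `c` a superfunction given in the coordinates `(y, η)` of `c'`. -/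
def transition (f : superFunctions 𝕜 p q (c'.img (c.dom ⊓ c'.dom))) :
    superFunctions 𝕜 p q (c.img (c.dom ⊓ c'.dom)) :=
  c.expr _ inf_le_left (c'.ofExpr _ inf_le_right f)

/-- The even coordinates `y_i` of `c'` in terms of the coordinates of `c`. -/
def newEven (i : Fin p) : superFunctions 𝕜 p q (c.img (c.dom ⊓ c'.dom)) :=
  c.transition c' (evenCoord 𝕜 p q _ i)

/-- The odd coordinates `η_j` of `c'` in terms of the coordinates of `c`. -/
def newOdd (j : Fin q) : superFunctions 𝕜 p q (c.img (c.dom ⊓ c'.dom)) :=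
  c.transition c' (oddCoord 𝕜 p q _ j)

/-- The Berezinian of the super Jacobian matrix
`(∂y/∂x, ∂η/∂x; ∂y/∂ξ, ∂η/∂ξ)` at the point `y`. -/
def jacobianBer (y : c.img (c.dom ⊓ c'.dom)) : Grassmann 𝕜 q :=
  berezinian (Matrix.of fun k i => evenDeriv k (c.newEven c' i) y)
    (Matrix.of fun k j => evenDeriv k (c.newOdd c' j) y)
    (Matrix.of fun l i => oddDeriv l (c.newEven c' i) y)
    (Matrix.of fun l j => oddDeriv l (c.newOdd c' j) y)

/-- The sign of the Jacobian determinant of the underlying change of even coordinates. -/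
def jacobianSign (y : c.img (c.dom ⊓ c'.dom)) : ℝ :=
  Real.sign (RCLike.re (Matrix.det (Matrix.of fun k i =>
    ExteriorAlgebra.algebraMapInv (evenDeriv k (c.newEven c' i) y) : Matrix (Fin p) (Fin p) 𝕜)))

end SuperChart

/-- A Berezinian density, i.e. a global section of `or ⊗ Ber`: in every chart with coordinates
`(x, ξ)` it is of the form `|D(x, ξ)| h` with a superfunction `h = coeff c`, subject to the
transformation law `|D(y, η)| = |D(x, ξ)| · sgn(det ∂y/∂x) · Ber(∂(y, η)/∂(x, ξ))`. -/
structure BerezinianDensity (X : SuperSpace 𝕜) where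
  coeff : ∀ {p q : ℕ} (c : SuperChart X p q), superFunctions 𝕜 p q (c.img c.dom)
  coeff_change : ∀ {p q : ℕ} (c c' : SuperChart X p q) (y : c.img (c.dom ⊓ c'.dom)),
    (coeff c).1 ⟨y, c.img_mono inf_le_left y.2⟩ =
      ((c.jacobianSign c' y : ℝ) : 𝕜) • (c.jacobianBer c' y *
        (c.transition c' ((affineSuperspace 𝕜 p q).res (c'.img_mono inf_le_right)
          (coeff c'))).1 y)

/-- A Berezinian density vanishes nowhere: the value (in `𝕜`) of its coefficient is non-zero
everywhere, in every chart. -/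
def BerezinianDensity.NowhereVanishing (w : BerezinianDensity X) : Prop :=
  ∀ {p q : ℕ} (c : SuperChart X p q) (y : c.img c.dom),
    ExteriorAlgebra.algebraMapInv ((w.coeff c).1 y) ≠ 0

/-- The linear functional `I` on `Γ_c(𝒪_X)` is the Berezin integral `φ ↦ ∫_X w φ`: if `φ` has its
support in the domain of a chart, with `w = |D(x, ξ)| h`, then `I φ = ∫ dx (h φ)_{1…q}`, where
`(h φ)_{1…q}` is the coefficient of `ξ₁ ⋯ ξ_q`. -/
def BerezinianDensity.IsBerezinIntegral (w : BerezinianDensity X)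
    (I : X.compactSections →ₗ[𝕜] 𝕜) : Prop :=
  ∀ {p q : ℕ} (c : SuperChart X p q) (φ : X.compactSections), X.supp φ.1 ⊆ c.dom →
    I φ = ∫ y, extendZero (fun y => Grassmann.coeff Finset.univ
      ((w.coeff c).1 y * (c.expr c.dom le_rfl (X.res le_top φ.1)).1 y)) y

end Berezinian

/-! ## Lie supergroups and superdistributions -/

/-- A Lie supergroup: a group object in the category of supermanifolds. The products and the
terminal object involved are given by their universal properties, and the group axioms are
expressed on `S`-valued points. -/
structure LieSupergroup (𝕜 : Type) [RCLike 𝕜] where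
  space : Supermanifold 𝕜
  /-- a one-point supermanifold -/
  pt : Supermanifold 𝕜
  isTerminal : IsTerminal pt
  /-- the product `G × G` -/
  prod : Supermanifold 𝕜
  fst : prod ⟶ space
  snd : prod ⟶ space
  isProduct : IsLimit (BinaryFan.mk fst snd)
  /-- the multiplication morphism -/
  mul : prod ⟶ space
  /-- the neutral element -/
  one : pt ⟶ space
  /-- the inversion morphism -/
  inv : space ⟶ space
  mul_assoc : ∀ {S : Supermanifold 𝕜} (a b c : S ⟶ space),
    isProduct.lift (BinaryFan.mk (isProduct.lift (BinaryFan.mk a b) ≫ mul) c) ≫ mul =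
      isProduct.lift (BinaryFan.mk a (isProduct.lift (BinaryFan.mk b c) ≫ mul)) ≫ mul
  one_mul : ∀ {S : Supermanifold 𝕜} (a : S ⟶ space),
    isProduct.lift (BinaryFan.mk (isTerminal.from S ≫ one) a) ≫ mul = a
  mul_one : ∀ {S : Supermanifold 𝕜} (a : S ⟶ space),
    isProduct.lift (BinaryFan.mk a (isTerminal.from S ≫ one)) ≫ mul = a
  inv_mul : ∀ {S : Supermanifold 𝕜} (a : S ⟶ space),
    isProduct.lift (BinaryFan.mk (a ≫ inv) a) ≫ mul = isTerminal.from S ≫ one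
  mul_inv : ∀ {S : Supermanifold 𝕜} (a : S ⟶ space),
    isProduct.lift (BinaryFan.mk a (a ≫ inv)) ≫ mul = isTerminal.from S ≫ one

namespace LieSupergroup

variable {𝕜 : Type} [RCLike 𝕜] (G : LieSupergroup 𝕜)

/-- The global superfunctions `Γ(𝒪_G)`. -/
abbrev Fun : Type := G.space.sec ⊤

/-- The left translation `G → G`, `h ↦ g h`, by a point `g ∈ G₀`, i.e. a morphism from the one-point
supermanifold to `G`. -/
def leftTranslation (g : G.pt ⟶ G.space) : G.space ⟶ G.space :=
  G.isProduct.lift (BinaryFan.mk (G.isTerminal.from G.space ≫ g) (𝟙 G.space)) ≫ G.mul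

/-- Right-invariant homogeneous vector fields on `G`: superderivations `D` of `𝒪_G` with
`m^♯ ∘ D = (D ⊗ 1) ∘ m^♯`, where `D ⊗ 1 = D'` is the extension of `D` to `G × G` that acts in
the first factor only. These are exactly the operators `L_x`, `x ∈ 𝔤` homogeneous, of the
(infinitesimal) left regular representation. -/
def IsRightInvariant (i : ZMod 2) (D : Module.End 𝕜 G.Fun) : Prop :=
  G.space.IsSuperderivation i D ∧
    ∃ D' : Module.End 𝕜 (G.prod.sec ⊤), G.prod.IsSuperderivation i D' ∧
      (∀ f, D' (SuperSpace.Hom.gpull G.fst f) = SuperSpace.Hom.gpull G.fst (D f)) ∧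
      (∀ f, D' (SuperSpace.Hom.gpull G.snd f) = 0) ∧
      (∀ f, D' (SuperSpace.Hom.gpull G.mul f) = SuperSpace.Hom.gpull G.mul (D f))

/-- Left-invariant homogeneous vector fields on `G`: `m^♯ ∘ D = (1 ⊗ D) ∘ m^♯`. These are exactly
the operators `R_x`, `x ∈ 𝔤` homogeneous, of the right regular representation. -/
def IsLeftInvariant (i : ZMod 2) (D : Module.End 𝕜 G.Fun) : Prop :=
  G.space.IsSuperderivation i D ∧
    ∃ D' : Module.End 𝕜 (G.prod.sec ⊤), G.prod.IsSuperderivation i D' ∧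
      (∀ f, D' (SuperSpace.Hom.gpull G.fst f) = 0) ∧
      (∀ f, D' (SuperSpace.Hom.gpull G.snd f) = SuperSpace.Hom.gpull G.snd (D f)) ∧
      (∀ f, D' (SuperSpace.Hom.gpull G.mul f) = SuperSpace.Hom.gpull G.mul (D f))

/-- The operators `L_u`, `u ∈ 𝔘(𝔤)`: the algebra generated by the `L_x`, `x ∈ 𝔤`. -/
def leftRegular : Subalgebra 𝕜 (Module.End 𝕜 G.Fun) :=
  Algebra.adjoin 𝕜 {D | ∃ i, G.IsRightInvariant i D}

/-- The operators `R_v`, `v ∈ 𝔘(𝔤)`: the algebra generated by the `R_x`, `x ∈ 𝔤`. -/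
def rightRegular : Subalgebra 𝕜 (Module.End 𝕜 G.Fun) :=
  Algebra.adjoin 𝕜 {D | ∃ i, G.IsLeftInvariant i D}

/-- The seminorm `p_{u,v,K}(f) = sup_{x ∈ K} |(L_u R_v f)(x)|`, with values in `[0, ∞]`, for
`A = L_u` and `B = R_v`. -/
def seminorm (A B : Module.End 𝕜 G.Fun) (K : Set G.space.carrier) (f : G.Fun) : ℝ≥0∞ :=
  ⨆ x ∈ K, ‖G.space.value (A (B f)) x‖ₑ

/-- A superdistribution on `G`, i.e. an element of `D'(G) = Γ_c(𝒪_G)'`: a linear functional on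
`Γ_c(𝒪_G)` that is continuous for the inductive limit topology. Continuity means: for every compact
`C`, its restriction to `Γ_C(𝒪_G)` is bounded by a multiple of a finite sum of the seminorms
`p_{u,v,K}`. -/
structure Superdistribution where
  toLinearMap : G.space.compactSections →ₗ[𝕜] 𝕜
  continuous : ∀ C : Set G.space.carrier, IsCompact C →
    ∃ (n : ℕ) (A B : Fin n → Module.End 𝕜 G.Fun) (K : Fin n → Set G.space.carrier) (M : ℝ≥0),
      (∀ k, A k ∈ G.leftRegular ∧ B k ∈ G.rightRegular ∧ IsCompact (K k)) ∧
      ∀ φ : G.space.compactSections, G.space.supp φ.1 ⊆ C →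
        ‖toLinearMap φ‖ₑ ≤ M * ∑ k, G.seminorm (A k) (B k) (K k) φ.1

variable {G}

/-- Left-invariance under `G`: `L_g μ = μ` for all `g ∈ G₀` and `L_x μ = 0` for all `x ∈ 𝔤`.
(The functions `ψ` below always have compact support.) -/
structure Superdistribution.IsInvariant (μ : G.Superdistribution) : Prop where
  translate : ∀ (g : G.pt ⟶ G.space) (φ ψ : G.space.compactSections),
    ψ.1 = SuperSpace.Hom.gpull (G.leftTranslation g) φ.1 → μ.toLinearMap ψ = μ.toLinearMap φ
  infinitesimal : ∀ (i : ZMod 2) (D : Module.End 𝕜 G.Fun), G.IsRightInvariant i D →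
    ∀ φ ψ : G.space.compactSections, ψ.1 = D φ.1 → μ.toLinearMap ψ = 0

/-- `Dg` is (the superdistribution `φ ↦ ∫_G |Dg| φ` given by) an invariant Berezinian density
`|Dg|`: a nowhere vanishing `G`-invariant Berezinian density. -/
def Superdistribution.IsInvariantBerezinian (Dg : G.Superdistribution) : Prop :=
  Dg.IsInvariant ∧ ∃ w : BerezinianDensity G.space.toSuperSpace,
    w.NowhereVanishing ∧ w.IsBerezinIntegral Dg.toLinearMap

end LieSupergroup

end

noncomputable section

/-! ## The parity involution -/

/-! Infinitesimal invariance is a first-order system of equations which, near the neutral element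
`e`, determines a functional up to a factor; translations then carry this over to all of `G₀`.

Local step. Let `D_j` be right-invariant vector fields whose values at `e` are the coordinate
derivatives `∂_j` of a chart. By continuity they are still a frame on a small cube around `e`, i.e.
`∂_k = ∑ a_kj D_j` there (`LieSupergroup.exists_frame`). Let `h` be the coefficient of `|Dg|` and `g
= h⁻¹`. If a functional `L` annihilates all `D_j f`, the Leibniz rule gives `L(g ∂_k f) = -L(b_k f)`
with superfunctions `b_k` that depend on the frame and on `h`, but not on `L`. For `L = |Dg|` the
left side is the Berezin integral of `∂_k f`, hence zero, and non-degeneracy of the Berezin integral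
forces `b_k = 0`. So `μ` annihilates every `g ∂_k f` as well. If `|Dg|` annihilates `f`, then `h f`
has Berezin integral zero, so it is a sum of derivatives of compactly supported superfunctions
(`superFunctions.mem_span_coordPartial`, a Poincaré lemma), and `μ` annihilates `f`. An inclusion of
kernels means proportionality (`superFunctions.exists_eq_mul_of_frame`).

Existence of the fields. The product `G × G` is given only by its universal property, so everything
is done with `S`-valued points. A tangent vector at `e` is a curve with an infinitesimal parameter:
one odd parameter `θ` for an odd vector, the product of two odd parameters for an even one.
Multiplying by the curve from the left is an action on `G`, whose leading coefficient is the vector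
field; associativity makes it right-invariant (`LieSupergroup.exists_rightInvariant`). The chain
rule (`superFunctions.derivation_eq_sum`, via Hadamard's lemma) expresses the fields in coordinates.

Global step. `μ - a |Dg|` is translation-invariant and vanishes near `e`; translates of one bump
function decompose every test function into pieces that can be moved to `e`
(`LieSupergroup.eq_zero_of_translate`). Extending sections by zero from a chart needs a Hausdorff
space; this is deduced from the group structure (`LieSupergroup.t2Space`). -/

theorem zmod_two_cases (i : ZMod 2) : i = 0 ∨ i = 1 := by
  revert i; decide

namespace SuperSpace

section Parity

variable {𝕜 : Type} [RCLike 𝕜] (X : SuperSpace 𝕜)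

theorem exists_even_add_odd {U : Opens X.carrier} (f : X.sec U) :
    ∃ a ∈ X.part U 0, ∃ b ∈ X.part U 1, f = a + b := by
  have h : f ∈ X.part U 0 ⊔ X.part U 1 := by
    rw [(X.part_isCompl U).sup_eq_top]; trivial
  obtain ⟨a, ha, b, hb, e⟩ := Submodule.mem_sup.1 h
  exact ⟨a, ha, b, hb, e.symm⟩

/-- The parity involution as a linear map: the identity on the even and minus the identity on the
odd sections. -/
def parityLinear (U : Opens X.carrier) : X.sec U →ₗ[𝕜] X.sec U :=
  (X.part U 0).projection (X.part U 1) (X.part_isCompl U) -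
    (X.part U 1).projection (X.part U 0) (X.part_isCompl U).symm

theorem parityLinear_even {U : Opens X.carrier} {f : X.sec U} (hf : f ∈ X.part U 0) :
    X.parityLinear U f = f := by
  rw [parityLinear, LinearMap.sub_apply,
    (Submodule.projection_apply_eq_zero_iff (X.part_isCompl U).symm).2 hf, sub_zero]
  exact Submodule.projection_apply_left (X.part_isCompl U) ⟨f, hf⟩

theorem parityLinear_odd {U : Opens X.carrier} {f : X.sec U} (hf : f ∈ X.part U 1) :
    X.parityLinear U f = -f := by
  rw [parityLinear, LinearMap.sub_apply,
    (Submodule.projection_apply_eq_zero_iff (X.part_isCompl U)).2 hf, zero_sub]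
  exact congrArg _ (Submodule.projection_apply_left (X.part_isCompl U).symm ⟨f, hf⟩)

/-- The parity involution. -/
def parity (U : Opens X.carrier) : X.sec U →ₐ[𝕜] X.sec U :=
  AlgHom.ofLinearMap (X.parityLinear U) (X.parityLinear_even (X.one_mem_part U)) fun f g => by
    obtain ⟨a, ha, b, hb, rfl⟩ := X.exists_even_add_odd f
    obtain ⟨c, hc, d, hd, rfl⟩ := X.exists_even_add_odd g
    have h1 := X.parityLinear_even (X.mul_mem_part ha hc)
    have h2 := X.parityLinear_odd (X.mul_mem_part ha hd)
    have h3 := X.parityLinear_odd (X.mul_mem_part hb hc)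
    have h4 := X.parityLinear_even (X.mul_mem_part hb hd)
    simp only [add_mul, mul_add, map_add, h1, h2, h3, h4, X.parityLinear_even ha,
      X.parityLinear_even hc, X.parityLinear_odd hb, X.parityLinear_odd hd]
    noncomm_ring

theorem parity_even {U : Opens X.carrier} {f : X.sec U} (hf : f ∈ X.part U 0) :
    X.parity U f = f := X.parityLinear_even hf

theorem parity_odd {U : Opens X.carrier} {f : X.sec U} (hf : f ∈ X.part U 1) :
    X.parity U f = -f := X.parityLinear_odd hf

theorem parity_of_mem {U : Opens X.carrier} {i : ZMod 2} {f : X.sec U} (hf : f ∈ X.part U i) :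
    X.parity U f = (-1 : 𝕜) ^ i.val • f := by
  rcases zmod_two_cases i with rfl | rfl
  · exact (X.parity_even hf).trans (by simp)
  · exact (X.parity_odd hf).trans (by simp [ZMod.val_one])

theorem parity_parity {U : Opens X.carrier} (f : X.sec U) : X.parity U (X.parity U f) = f := by
  obtain ⟨a, ha, b, hb, rfl⟩ := X.exists_even_add_odd f
  simp [X.parity_even ha, X.parity_odd hb]

theorem parity_mem {U : Opens X.carrier} {i : ZMod 2} {f : X.sec U} (hf : f ∈ X.part U i) :
    X.parity U f ∈ X.part U i := by
  rw [X.parity_of_mem hf]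
  exact Submodule.smul_mem _ _ hf

theorem mem_even_of_parity {U : Opens X.carrier} {f : X.sec U} (hf : X.parity U f = f) :
    f ∈ X.part U 0 := by
  obtain ⟨a, ha, b, hb, rfl⟩ := X.exists_even_add_odd f
  rw [map_add, X.parity_even ha, X.parity_odd hb, add_right_inj] at hf
  have h2 : (2 : 𝕜) • b = 0 := by rw [two_smul]; nth_rewrite 1 [← hf]; exact neg_add_cancel b
  rw [(smul_eq_zero.1 h2).resolve_left two_ne_zero, add_zero]
  exact ha

/-- A ring homomorphism that preserves parity commutes with the parity involution. -/
theorem map_parity_of_part {Y : SuperSpace 𝕜} {U : Opens X.carrier} {V : Opens Y.carrier}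
    (F : X.sec U →ₗ[𝕜] Y.sec V) (hF : ∀ i, ∀ f ∈ X.part U i, F f ∈ Y.part V i) (f : X.sec U) :
    F (X.parity U f) = Y.parity V (F f) := by
  obtain ⟨a, ha, b, hb, rfl⟩ := X.exists_even_add_odd f
  simp [X.parity_even ha, X.parity_odd hb, Y.parity_even (hF 0 a ha), Y.parity_odd (hF 1 b hb)]

theorem res_parity {U V : Opens X.carrier} (h : U ≤ V) (f : X.sec V) :
    X.res h (X.parity V f) = X.parity U (X.res h f) :=
  X.map_parity_of_part (X.res h).toLinearMap (fun _ _ hf => X.res_part h hf) f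

theorem Hom.pull_parity {X Y : SuperSpace 𝕜} (φ : Hom X Y) (U V h) (f : Y.sec V) :
    φ.pull U V h (Y.parity V f) = X.parity U (φ.pull U V h f) :=
  Y.map_parity_of_part (φ.pull U V h).toLinearMap (fun i f hf => φ.pull_part U V h i f hf) f

end Parity

end SuperSpace

/-! ## Adjoining an odd variable -/

/-- For an algebra `R` with an endomorphism `σ`, the algebra `R ⊕ θR` with `θ² = 0` and
`aθ = θσ(a)`. -/
@[ext]
structure OddExt {𝕜 R : Type} [CommRing 𝕜] [Ring R] [Algebra 𝕜 R] (σ : R →ₐ[𝕜] R) where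
  fst : R
  snd : R

namespace OddExt

variable {𝕜 R S : Type} [CommRing 𝕜] [Ring R] [Algebra 𝕜 R] [Ring S] [Algebra 𝕜 S]
  {σ : R →ₐ[𝕜] R} {τ : S →ₐ[𝕜] S}

instance : Zero (OddExt σ) := ⟨⟨0, 0⟩⟩
instance : One (OddExt σ) := ⟨⟨1, 0⟩⟩
instance : Add (OddExt σ) := ⟨fun x y => ⟨x.fst + y.fst, x.snd + y.snd⟩⟩
instance : Neg (OddExt σ) := ⟨fun x => ⟨-x.fst, -x.snd⟩⟩
-- In `(a + θb)(c + θd)` the second `θ` is pulled to the left past `a`, which twists `a` by `σ`; the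
-- term with `θ²` drops out.
instance : Mul (OddExt σ) := ⟨fun x y => ⟨x.fst * y.fst, σ x.fst * y.snd + x.snd * y.fst⟩⟩
instance : SMul 𝕜 (OddExt σ) := ⟨fun c x => ⟨c • x.fst, c • x.snd⟩⟩

@[simp] theorem fst_zero : (0 : OddExt σ).fst = 0 := rfl
@[simp] theorem snd_zero : (0 : OddExt σ).snd = 0 := rfl
@[simp] theorem fst_one : (1 : OddExt σ).fst = 1 := rfl
@[simp] theorem snd_one : (1 : OddExt σ).snd = 0 := rfl
@[simp] theorem fst_add (x y : OddExt σ) : (x + y).fst = x.fst + y.fst := rfl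
@[simp] theorem snd_add (x y : OddExt σ) : (x + y).snd = x.snd + y.snd := rfl
@[simp] theorem fst_neg (x : OddExt σ) : (-x).fst = -x.fst := rfl
@[simp] theorem snd_neg (x : OddExt σ) : (-x).snd = -x.snd := rfl
@[simp] theorem fst_mul (x y : OddExt σ) : (x * y).fst = x.fst * y.fst := rfl
@[simp] theorem snd_mul (x y : OddExt σ) : (x * y).snd = σ x.fst * y.snd + x.snd * y.fst := rfl
@[simp] theorem fst_smul (c : 𝕜) (x : OddExt σ) : (c • x).fst = c • x.fst := rfl
@[simp] theorem snd_smul (c : 𝕜) (x : OddExt σ) : (c • x).snd = c • x.snd := rfl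

instance : AddCommGroup (OddExt σ) where
  add_assoc _ _ _ := OddExt.ext (add_assoc _ _ _) (add_assoc _ _ _)
  zero_add _ := OddExt.ext (zero_add _) (zero_add _)
  add_zero _ := OddExt.ext (add_zero _) (add_zero _)
  add_comm _ _ := OddExt.ext (add_comm _ _) (add_comm _ _)
  neg_add_cancel _ := OddExt.ext (neg_add_cancel _) (neg_add_cancel _)
  nsmul := nsmulRec
  zsmul := zsmulRec

instance : Ring (OddExt σ) where
  __ := (inferInstance : AddCommGroup (OddExt σ))
  mul_assoc x y z := by
    ext
    · simp [mul_assoc]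
    · simp only [fst_mul, snd_mul, map_mul]; noncomm_ring
  one_mul x := by ext <;> simp
  mul_one x := by ext <;> simp
  left_distrib x y z := by
    ext <;> simp only [fst_mul, snd_mul, fst_add, snd_add] <;> noncomm_ring
  right_distrib x y z := by
    ext <;> simp only [fst_mul, snd_mul, fst_add, snd_add, map_add] <;> noncomm_ring
  zero_mul x := by ext <;> simp
  mul_zero x := by ext <;> simp

instance : Module 𝕜 (OddExt σ) where
  one_smul _ := OddExt.ext (one_smul _ _) (one_smul _ _)
  mul_smul _ _ _ := OddExt.ext (mul_smul _ _ _) (mul_smul _ _ _)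
  smul_zero _ := OddExt.ext (smul_zero _) (smul_zero _)
  smul_add _ _ _ := OddExt.ext (smul_add _ _ _) (smul_add _ _ _)
  add_smul _ _ _ := OddExt.ext (add_smul _ _ _) (add_smul _ _ _)
  zero_smul _ := OddExt.ext (zero_smul _ _) (zero_smul _ _)

instance : Algebra 𝕜 (OddExt σ) :=
  Algebra.ofModule (fun c x y => by ext <;> simp) (fun c x y => by ext <;> simp)

@[simp] theorem fst_algebraMap (c : 𝕜) :
    (algebraMap 𝕜 (OddExt σ) c).fst = algebraMap 𝕜 R c := by
  simp [Algebra.algebraMap_eq_smul_one]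

@[simp] theorem snd_algebraMap (c : 𝕜) : (algebraMap 𝕜 (OddExt σ) c).snd = 0 := by
  simp [Algebra.algebraMap_eq_smul_one]

/-- The inclusion `R → R ⊕ θR`. -/
def inl (σ : R →ₐ[𝕜] R) : R →ₐ[𝕜] OddExt σ where
  toFun a := ⟨a, 0⟩
  map_one' := rfl
  map_mul' _ _ := by ext <;> simp
  map_zero' := rfl
  map_add' _ _ := by ext <;> simp
  commutes' _ := by ext <;> simp

@[simp] theorem fst_inl (a : R) : (inl σ a).fst = a := rfl
@[simp] theorem snd_inl (a : R) : (inl σ a).snd = 0 := rfl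

/-- The projection `R ⊕ θR → R`. -/
def fstHom (σ : R →ₐ[𝕜] R) : OddExt σ →ₐ[𝕜] R where
  toFun := fst
  map_one' := rfl
  map_mul' _ _ := rfl
  map_zero' := rfl
  map_add' _ _ := rfl
  commutes' _ := by simp

@[simp] theorem fstHom_apply (x : OddExt σ) : fstHom σ x = x.fst := rfl

/-- Functoriality of the adjunction of an odd variable. -/
def map (φ : R →ₐ[𝕜] S) (h : ∀ a, φ (σ a) = τ (φ a)) : OddExt σ →ₐ[𝕜] OddExt τ where
  toFun x := ⟨φ x.fst, φ x.snd⟩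
  map_one' := by ext <;> simp
  map_mul' _ _ := by ext <;> simp [h]
  map_zero' := by ext <;> simp
  map_add' _ _ := by ext <;> simp
  commutes' _ := by ext <;> simp

@[simp] theorem fst_map (φ : R →ₐ[𝕜] S) (h : ∀ a, φ (σ a) = τ (φ a)) (x : OddExt σ) :
    (map φ h x).fst = φ x.fst := rfl

@[simp] theorem snd_map (φ : R →ₐ[𝕜] S) (h : ∀ a, φ (σ a) = τ (φ a)) (x : OddExt σ) :
    (map φ h x).snd = φ x.snd := rfl

end OddExt

namespace SuperSpace

variable {𝕜 : Type} [RCLike 𝕜]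

/-- The product `X × 𝔸^{0|1}`. -/
def thicken (X : SuperSpace 𝕜) : SuperSpace 𝕜 where
  carrier := X.carrier
  sec U := OddExt (X.parity U)
  part U i :=
    -- The parameter `θ` is odd, so its coefficient has the opposite parity.
    { carrier := {z | z.fst ∈ X.part U i ∧ z.snd ∈ X.part U (i + 1)}
      zero_mem' := ⟨Submodule.zero_mem _, Submodule.zero_mem _⟩
      add_mem' := fun h h' => ⟨Submodule.add_mem _ h.1 h'.1, Submodule.add_mem _ h.2 h'.2⟩
      smul_mem' := fun c _ h => ⟨Submodule.smul_mem _ c h.1, Submodule.smul_mem _ c h.2⟩ }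
  part_isCompl U := by
    have hc := X.part_isCompl U
    constructor
    · rw [Submodule.disjoint_def]
      rintro z ⟨h1, h2⟩ ⟨h3, h4⟩
      exact OddExt.ext (Submodule.disjoint_def.1 hc.disjoint _ h1 h3)
        (Submodule.disjoint_def.1 hc.disjoint _ h4 h2)
    · rw [codisjoint_iff, Submodule.eq_top_iff']
      intro z
      obtain ⟨a, ha, b, hb, e⟩ := X.exists_even_add_odd z.fst
      obtain ⟨c, hc, d, hd, e'⟩ := X.exists_even_add_odd z.snd
      exact Submodule.mem_sup.2 ⟨⟨a, d⟩, ⟨ha, hd⟩, ⟨b, c⟩, ⟨hb, hc⟩,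
        OddExt.ext e.symm ((add_comm d c).trans e'.symm)⟩
  one_mem_part U := ⟨X.one_mem_part U, Submodule.zero_mem _⟩
  mul_mem_part {U i j a b} ha hb := by
    refine ⟨X.mul_mem_part ha.1 hb.1, Submodule.add_mem _ ?_ ?_⟩
    · rw [add_assoc]; exact X.mul_mem_part (X.parity_mem ha.1) hb.2
    · rw [add_right_comm]; exact X.mul_mem_part ha.2 hb.1
  supercomm {U i j a b} ha hb := by
    have h1 := X.supercomm ha.1 hb.1
    have h2 := X.supercomm ha.1 hb.2
    have h3 := X.supercomm ha.2 hb.1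
    refine OddExt.ext h1 ?_
    simp only [OddExt.snd_mul, OddExt.snd_smul, X.parity_of_mem ha.1, X.parity_of_mem hb.1,
      smul_mul_assoc, h2, h3]
    rcases zmod_two_cases i with rfl | rfl <;> rcases zmod_two_cases j with rfl | rfl <;>
      simp [ZMod.val_one, show ((1 : ZMod 2) + 1) = 0 from rfl, add_comm]
  res h := OddExt.map (X.res h) (X.res_parity h)
  res_part h _ _ hf := ⟨X.res_part h hf.1, X.res_part h hf.2⟩
  res_refl h _ := OddExt.ext (X.res_refl h _) (X.res_refl h _)
  res_res h h' _ := OddExt.ext (X.res_res h h' _) (X.res_res h h' _)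
  sheaf_ext U s t h := OddExt.ext
    (X.sheaf_ext U _ _ fun i => congrArg OddExt.fst (h i))
    (X.sheaf_ext U _ _ fun i => congrArg OddExt.snd (h i))
  sheaf_glue U s h := by
    obtain ⟨t, ht⟩ := X.sheaf_glue U (fun i => (s i).fst) fun i j => congrArg OddExt.fst (h i j)
    obtain ⟨t', ht'⟩ := X.sheaf_glue U (fun i => (s i).snd) fun i j => congrArg OddExt.snd (h i j)
    exact ⟨⟨t, t'⟩, fun i => OddExt.ext (ht i) (ht' i)⟩

/-- Functoriality of `X ↦ X × 𝔸^{0|1}`. -/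
def thickenMap {X Y : SuperSpace 𝕜} (φ : Hom X Y) : Hom X.thicken Y.thicken where
  base := φ.base
  continuous_base := φ.continuous_base
  pull := fun (U : Opens X.carrier) (V : Opens Y.carrier) h =>
    OddExt.map (φ.pull U V h) (φ.pull_parity U V h)
  pull_part U V h i _ hf :=
    ⟨φ.pull_part U V h i _ hf.1, φ.pull_part U V h _ _ hf.2⟩
  pull_res U V h U' V' h' hU hV f :=
    OddExt.ext (φ.pull_res U V h U' V' h' hU hV _) (φ.pull_res U V h U' V' h' hU hV _)

/-- The projection `X × 𝔸^{0|1} → X`. -/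
def thickenProj (X : SuperSpace 𝕜) : Hom X.thicken X where
  base := fun x => x
  continuous_base := continuous_id
  pull := fun (U : Opens X.carrier) (V : Opens X.carrier) h =>
    (OddExt.inl (X.parity U)).comp (X.res h)
  pull_part := fun (U : Opens X.carrier) V h i f hf =>
    ⟨X.res_part h hf, Submodule.zero_mem (X.part U _)⟩
  pull_res := fun (U : Opens X.carrier) V h (U' : Opens X.carrier) V' h'
      (hU : U' ≤ U) (hV : V' ≤ V) f => OddExt.ext
    (((X.res_res _ _ _).trans (X.res_res _ _ _).symm)) (map_zero (X.res hU)).symm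

/-- The zero section `X → X × 𝔸^{0|1}`. -/
def thickenZero (X : SuperSpace 𝕜) : Hom X X.thicken where
  base := fun x => x
  continuous_base := continuous_id
  pull := fun (U : Opens X.carrier) (V : Opens X.carrier) h =>
    show OddExt (X.parity V) →ₐ[𝕜] X.sec U from (X.res h).comp (OddExt.fstHom (X.parity V))
  pull_part U V h i f hf := X.res_part h hf.1
  pull_res U V h U' V' h' hU hV f := (X.res_res _ _ _).trans (X.res_res _ _ _).symm

end SuperSpace

/-! ## Grassmann algebras -/

namespace Grassmann

variable {𝕜 : Type} [RCLike 𝕜] {q : ℕ}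

/-- The parity involution of the Grassmann algebra. -/
def involution (𝕜 : Type) [RCLike 𝕜] (q : ℕ) : Grassmann 𝕜 q →ₐ[𝕜] Grassmann 𝕜 q :=
  CliffordAlgebra.involute

@[simp] theorem involution_ι (m : Fin q → 𝕜) :
    involution 𝕜 q (ExteriorAlgebra.ι 𝕜 m) = -ExteriorAlgebra.ι 𝕜 m :=
  CliffordAlgebra.involute_ι m

theorem involution_involution (x : Grassmann 𝕜 q) : involution 𝕜 q (involution 𝕜 q x) = x :=
  CliffordAlgebra.involute_involute x

/-- Anticommutation of generators, extended multiplicatively. This is the commutation rule of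
`OddExt`, so that splitting off one generator of a Grassmann algebra is an instance of that
construction. -/
theorem mul_ι (x : Grassmann 𝕜 q) (m : Fin q → 𝕜) :
    x * ExteriorAlgebra.ι 𝕜 m = ExteriorAlgebra.ι 𝕜 m * involution 𝕜 q x := by
  induction x using ExteriorAlgebra.induction with
  | algebraMap r => rw [AlgHom.commutes, Algebra.commutes]
  | ι v =>
    rw [involution_ι, mul_neg, eq_neg_iff_add_eq_zero]
    exact ExteriorAlgebra.ι_add_mul_swap v m
  | mul a b ha hb => rw [mul_assoc, hb, ← mul_assoc, ha, map_mul, mul_assoc]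
  | add a b ha hb => rw [add_mul, ha, hb, map_add, mul_add]

theorem ι_mem_part (m : Fin q → 𝕜) : ExteriorAlgebra.ι 𝕜 m ∈ part q 1 :=
  CliffordAlgebra.ι_mem_evenOdd_one _ m

theorem mul_mem_part {i j : ZMod 2} {a b : Grassmann 𝕜 q} (ha : a ∈ part q i)
    (hb : b ∈ part q j) : a * b ∈ part q (i + j) :=
  SetLike.GradedMul.mul_mem (A := CliffordAlgebra.evenOdd _) ha hb

theorem involution_even {a : Grassmann 𝕜 q} (ha : a ∈ part q 0) : involution 𝕜 q a = a :=
  CliffordAlgebra.involute_eq_of_mem_even ha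

theorem involution_odd {a : Grassmann 𝕜 q} (ha : a ∈ part q 1) : involution 𝕜 q a = -a :=
  CliffordAlgebra.involute_eq_of_mem_odd ha

theorem exists_even_add_odd (f : Grassmann 𝕜 q) :
    ∃ a ∈ part (𝕜 := 𝕜) q 0, ∃ b ∈ part (𝕜 := 𝕜) q 1, f = a + b := by
  have h : f ∈ part (𝕜 := 𝕜) q 0 ⊔ part q 1 := by
    exact ((CliffordAlgebra.evenOdd_isCompl _).sup_eq_top).ge trivial
  obtain ⟨a, ha, b, hb, e⟩ := Submodule.mem_sup.1 h
  exact ⟨a, ha, b, hb, e.symm⟩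

theorem mem_even_iff {a : Grassmann 𝕜 q} : a ∈ part q 0 ↔ involution 𝕜 q a = a := by
  refine ⟨involution_even, fun h => ?_⟩
  obtain ⟨x, hx, y, hy, rfl⟩ := exists_even_add_odd a
  rw [map_add, involution_even hx, involution_odd hy, add_right_inj] at h
  have h2 : (2 : 𝕜) • y = 0 := by rw [two_smul]; nth_rewrite 1 [← h]; exact neg_add_cancel y
  rw [(smul_eq_zero.1 h2).resolve_left two_ne_zero, add_zero]
  exact hx

theorem mem_odd_iff {a : Grassmann 𝕜 q} : a ∈ part q 1 ↔ involution 𝕜 q a = -a := by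
  refine ⟨involution_odd, fun h => ?_⟩
  obtain ⟨x, hx, y, hy, rfl⟩ := exists_even_add_odd a
  rw [map_add, involution_even hx, involution_odd hy, neg_add, add_left_inj] at h
  have h2 : (2 : 𝕜) • x = 0 := by rw [two_smul]; nth_rewrite 1 [h]; exact neg_add_cancel x
  rw [(smul_eq_zero.1 h2).resolve_left two_ne_zero, zero_add]
  exact hy

/-- The inclusion of the Grassmann algebra on the last `q` of `q + 1` generators. -/
def incl (𝕜 : Type) [RCLike 𝕜] (q : ℕ) : Grassmann 𝕜 q →ₐ[𝕜] Grassmann 𝕜 (q + 1) :=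
  ExteriorAlgebra.map
    { toFun := fun v => (Fin.cons 0 v : Fin (q + 1) → 𝕜)
      map_add' := fun v w => by ext i; refine Fin.cases ?_ (fun j => ?_) i <;> simp
      map_smul' := fun c v => by ext i; refine Fin.cases ?_ (fun j => ?_) i <;> simp }

@[simp] theorem incl_ι (v : Fin q → 𝕜) :
    incl 𝕜 q (ExteriorAlgebra.ι 𝕜 v) = ExteriorAlgebra.ι 𝕜 (Fin.cons 0 v : Fin (q + 1) → 𝕜) :=
  ExteriorAlgebra.map_apply_ι _ v

theorem incl_involution (x : Grassmann 𝕜 q) :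
    incl 𝕜 q (involution 𝕜 q x) = involution 𝕜 (q + 1) (incl 𝕜 q x) := by
  have h : (incl 𝕜 q).comp (involution 𝕜 q) = (involution 𝕜 (q + 1)).comp (incl 𝕜 q) := by
    ext v; simp
  exact DFunLike.congr_fun h x

theorem incl_mem_part {i : ZMod 2} {x : Grassmann 𝕜 q} (hx : x ∈ part q i) :
    incl 𝕜 q x ∈ part (q + 1) i := by
  rcases zmod_two_cases i with rfl | rfl
  · rw [mem_even_iff, ← incl_involution, involution_even hx]
  · rw [mem_odd_iff, ← incl_involution, involution_odd hx, map_neg]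

/-- The first of `q + 1` odd generators. -/
def newVar (𝕜 : Type) [RCLike 𝕜] (q : ℕ) : Grassmann 𝕜 (q + 1) :=
  ExteriorAlgebra.ι 𝕜 (Pi.single 0 1)

/-- `Λ(ξ₁, …, ξ_q) ⊕ θ Λ(ξ₁, …, ξ_q) → Λ(θ, ξ₁, …, ξ_q)`. -/
def ofOddExtHom (𝕜 : Type) [RCLike 𝕜] (q : ℕ) :
    OddExt (involution 𝕜 q) →ₐ[𝕜] Grassmann 𝕜 (q + 1) where
  toFun z := incl 𝕜 q z.fst + newVar 𝕜 q * incl 𝕜 q z.snd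
  map_one' := by simp
  map_zero' := by simp
  map_add' x y := by simp only [OddExt.fst_add, OddExt.snd_add, map_add]; noncomm_ring
  commutes' c := by simp
  map_mul' x y := by
    have h0 : newVar 𝕜 q * newVar 𝕜 q = 0 := ExteriorAlgebra.ι_sq_zero _
    have h1 : ∀ a, incl 𝕜 q a * newVar 𝕜 q = newVar 𝕜 q * incl 𝕜 q (involution 𝕜 q a) :=
      fun a => by rw [incl_involution]; exact mul_ι _ _
    have h2 : newVar 𝕜 q * incl 𝕜 q x.snd * (newVar 𝕜 q * incl 𝕜 q y.snd) = 0 := by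
      rw [mul_assoc, ← mul_assoc (incl 𝕜 q x.snd), h1, mul_assoc (newVar 𝕜 q), ← mul_assoc, h0,
        zero_mul]
    simp only [OddExt.fst_mul, OddExt.snd_mul, map_mul, map_add]
    rw [add_mul, mul_add (incl 𝕜 q x.fst), mul_add (newVar 𝕜 q * incl 𝕜 q x.snd), h2,
      ← mul_assoc (incl 𝕜 q x.fst), h1]
    noncomm_ring

/-- `Λ(θ, ξ₁, …, ξ_q) → Λ(ξ₁, …, ξ_q) ⊕ θ Λ(ξ₁, …, ξ_q)`. -/
def toOddExtHom (𝕜 : Type) [RCLike 𝕜] (q : ℕ) :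
    Grassmann 𝕜 (q + 1) →ₐ[𝕜] OddExt (involution 𝕜 q) :=
  ExteriorAlgebra.lift 𝕜
    ⟨{ toFun := fun v => ⟨ExteriorAlgebra.ι 𝕜 (Fin.tail v), algebraMap 𝕜 _ (v 0)⟩
       map_add' := fun v w => OddExt.ext (map_add (ExteriorAlgebra.ι 𝕜) _ _) (map_add _ _ _)
       map_smul' := fun c v => OddExt.ext (map_smul (ExteriorAlgebra.ι 𝕜) _ _)
        (by simp [Algebra.smul_def]) },
      -- The image of a vector squares to zero: in the coefficient of `θ` the two cross terms cancel
      -- because the involution changes the sign of `ι`.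
      fun v => OddExt.ext (ExteriorAlgebra.ι_sq_zero _) (by
        simp only [LinearMap.coe_mk, AddHom.coe_mk, OddExt.snd_mul, involution_ι, OddExt.snd_zero]
        rw [← Algebra.commutes (v 0), mul_neg, neg_add_cancel])⟩

/-- `Λ(ξ₁, …, ξ_q) ⊕ θ Λ(ξ₁, …, ξ_q) ≅ Λ(θ, ξ₁, …, ξ_q)`. -/
def ofOddExt (𝕜 : Type) [RCLike 𝕜] (q : ℕ) :
    OddExt (involution 𝕜 q) ≃ₐ[𝕜] Grassmann 𝕜 (q + 1) := by
  refine AlgEquiv.ofAlgHom (ofOddExtHom 𝕜 q) (toOddExtHom 𝕜 q) ?_ ?_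
  · refine ExteriorAlgebra.hom_ext (LinearMap.ext fun v => ?_)
    simp only [AlgHom.toLinearMap_apply, LinearMap.comp_apply, AlgHom.comp_apply, toOddExtHom,
      ExteriorAlgebra.lift_ι_apply, AlgHom.coe_id, id_eq]
    change incl 𝕜 q (ExteriorAlgebra.ι 𝕜 (Fin.tail v : Fin q → 𝕜)) +
      newVar 𝕜 q * incl 𝕜 q (algebraMap 𝕜 _ (v 0)) = _
    rw [incl_ι, AlgHom.commutes, ← Algebra.commutes, ← Algebra.smul_def, newVar, ← map_smul,
      ← map_add]
    congr 1
    ext i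
    refine Fin.cases ?_ (fun j => ?_) i <;> simp [Fin.tail]
  -- This composite is the identity because it is so on `Λ(ξ)` and on `θ`.
  · have h : ∀ a, toOddExtHom 𝕜 q (incl 𝕜 q a) = OddExt.inl _ a := by
      intro a
      have h : (toOddExtHom 𝕜 q).comp (incl 𝕜 q) = OddExt.inl _ := by
        ext v
        · simp [toOddExtHom]
        · simp [toOddExtHom]
      exact DFunLike.congr_fun h a
    have h' : toOddExtHom 𝕜 q (newVar 𝕜 q) = ⟨0, 1⟩ := by
      rw [newVar, toOddExtHom, ExteriorAlgebra.lift_ι_apply]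
      refine OddExt.ext ?_ (by simp)
      change ExteriorAlgebra.ι 𝕜 (Fin.tail (Pi.single 0 1 : Fin (q + 1) → 𝕜) : Fin q → 𝕜) = 0
      rw [ExteriorAlgebra.ι_eq_zero_iff]
      ext i
      simp [Fin.tail]
    refine AlgHom.ext fun z => ?_
    change toOddExtHom 𝕜 q (incl 𝕜 q z.fst + newVar 𝕜 q * incl 𝕜 q z.snd) = z
    rw [map_add, map_mul, h, h, h']
    ext <;> simp

theorem ofOddExt_apply (z : OddExt (involution 𝕜 q)) :
    ofOddExt 𝕜 q z = incl 𝕜 q z.fst + newVar 𝕜 q * incl 𝕜 q z.snd := rfl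

theorem ofOddExt_mem_part {i : ZMod 2} {z : OddExt (involution 𝕜 q)} (h : z.fst ∈ part q i)
    (h' : z.snd ∈ part q (i + 1)) : ofOddExt 𝕜 q z ∈ part (q + 1) i := by
  rw [ofOddExt_apply]
  refine Submodule.add_mem _ (incl_mem_part h) ?_
  have := mul_mem_part (ι_mem_part (𝕜 := 𝕜) (Pi.single (0 : Fin (q + 1)) 1)) (incl_mem_part h')
  rwa [(by decide : ∀ i : ZMod 2, 1 + (i + 1) = i) i] at this

end Grassmann

/-! ## Smoothness of Grassmann-valued functions -/

section Smooth

variable {𝕜 : Type} [RCLike 𝕜] {p q q' : ℕ} {V : Opens (EuclideanSpace ℝ (Fin p))}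

theorem IsSmoothGrassmann.functional {f : V → Grassmann 𝕜 q} (hf : IsSmoothGrassmann f)
    (T : Grassmann 𝕜 q →ₗ[𝕜] 𝕜) : ContDiffOn ℝ ∞ (extendZero fun y => T (f y)) V := by
  have : ContDiffOn ℝ ∞ (fun y => ∑ J, extendZero (fun y => Grassmann.coeff J (f y)) y *
      T (Grassmann.monomialBasis 𝕜 q J)) (V : Set (EuclideanSpace ℝ (Fin p))) :=
    ContDiffOn.sum fun J _ => (hf J).mul contDiffOn_const
  refine this.congr fun y hy => ?_
  have e : ∀ g : V → 𝕜, extendZero g y = g ⟨y, hy⟩ := fun g => extendZero_apply g ⟨y, hy⟩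
  simp only [e]
  conv_lhs => rw [← (Grassmann.monomialBasis 𝕜 q).sum_repr (f ⟨y, hy⟩), map_sum]
  exact Finset.sum_congr rfl fun J _ => by rw [map_smul]; rfl

theorem IsSmoothGrassmann.map' {f : V → Grassmann 𝕜 q} (hf : IsSmoothGrassmann f)
    (T : Grassmann 𝕜 q →ₗ[𝕜] Grassmann 𝕜 q') : IsSmoothGrassmann fun y => T (f y) :=
  fun I => hf.functional (Grassmann.coeff I ∘ₗ T)

theorem IsSmoothGrassmann.add {f g : V → Grassmann 𝕜 q} (hf : IsSmoothGrassmann f)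
    (hg : IsSmoothGrassmann g) : IsSmoothGrassmann fun y => f y + g y :=
  (superFunctions 𝕜 p q V).add_mem hf hg

/-- The parity involution of the superfunctions on `V`. -/
def superInvolution (𝕜 : Type) [RCLike 𝕜] {p : ℕ} (q : ℕ) (V : Opens (EuclideanSpace ℝ (Fin p))) :
    superFunctions 𝕜 p q V →ₐ[𝕜] superFunctions 𝕜 p q V where
  toFun f := ⟨fun y => Grassmann.involution 𝕜 q (f.1 y),
    f.2.map' (Grassmann.involution 𝕜 q).toLinearMap⟩
  map_one' := Subtype.ext (funext fun _ => map_one (Grassmann.involution 𝕜 q))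
  map_zero' := Subtype.ext (funext fun _ => map_zero (Grassmann.involution 𝕜 q))
  map_add' f g := Subtype.ext (funext fun y => map_add (Grassmann.involution 𝕜 q) (f.1 y) (g.1 y))
  map_mul' f g := Subtype.ext (funext fun y => map_mul (Grassmann.involution 𝕜 q) (f.1 y) (g.1 y))
  commutes' r := Subtype.ext (funext fun _ => AlgHom.commutes (Grassmann.involution 𝕜 q) r)

theorem superInvolution_apply (f : superFunctions 𝕜 p q V) (y : V) :
    (superInvolution 𝕜 q V f).1 y = Grassmann.involution 𝕜 q (f.1 y) := rfl

/-- `𝒪(V) ⊕ θ 𝒪(V) → 𝒪(V × 𝔸^{0|1})` for open `V ⊆ 𝔸^{p|q}`, as a function. -/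
def affineOfOddExtFun (z : OddExt (superInvolution 𝕜 q V)) : superFunctions 𝕜 p (q + 1) V :=
  ⟨fun y => Grassmann.ofOddExt 𝕜 q ⟨z.fst.1 y, z.snd.1 y⟩,
    IsSmoothGrassmann.add (z.fst.2.map' (Grassmann.incl 𝕜 q).toLinearMap)
      (z.snd.2.map' (LinearMap.mulLeft 𝕜 (Grassmann.newVar 𝕜 q) ∘ₗ
        (Grassmann.incl 𝕜 q).toLinearMap))⟩

/-- `𝒪(V) ⊕ θ 𝒪(V) → 𝒪(V × 𝔸^{0|1})` for open `V ⊆ 𝔸^{p|q}`. -/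
def affineOfOddExt (𝕜 : Type) [RCLike 𝕜] {p : ℕ} (q : ℕ) (V : Opens (EuclideanSpace ℝ (Fin p))) :
    OddExt (superInvolution 𝕜 q V) →ₐ[𝕜] superFunctions 𝕜 p (q + 1) V where
  toFun := affineOfOddExtFun
  map_one' := Subtype.ext (funext fun y => map_one (Grassmann.ofOddExt 𝕜 q))
  map_zero' := Subtype.ext (funext fun y => map_zero (Grassmann.ofOddExt 𝕜 q))
  map_add' z w := Subtype.ext (funext fun y => by
    have h := map_add (Grassmann.ofOddExt 𝕜 q) ⟨z.fst.1 y, z.snd.1 y⟩ ⟨w.fst.1 y, w.snd.1 y⟩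
    exact h)
  map_mul' z w := Subtype.ext (funext fun y => by
    have h := map_mul (Grassmann.ofOddExt 𝕜 q) ⟨z.fst.1 y, z.snd.1 y⟩ ⟨w.fst.1 y, w.snd.1 y⟩
    exact h)
  commutes' r := Subtype.ext (funext fun y => by
    have h := AlgEquiv.commutes (Grassmann.ofOddExt 𝕜 q) r
    refine Eq.trans (congrArg (Grassmann.ofOddExt 𝕜 q) (OddExt.ext ?_ ?_)) h
    · rw [OddExt.fst_algebraMap, OddExt.fst_algebraMap]; rfl
    · rw [OddExt.snd_algebraMap, OddExt.snd_algebraMap]; rfl)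

/-- At each point this is the isomorphism `Grassmann.ofOddExt`; preimages are smooth because both of
their components are fixed linear functions of the value. -/
theorem affineOfOddExt_bijective : Function.Bijective (affineOfOddExt 𝕜 q V) := by
  constructor
  · intro z w h
    have h' : ∀ y : V, (⟨z.fst.1 y, z.snd.1 y⟩ : OddExt (Grassmann.involution 𝕜 q)) =
        ⟨w.fst.1 y, w.snd.1 y⟩ := fun y => (Grassmann.ofOddExt 𝕜 q).injective
      (congrFun (congrArg Subtype.val h) y)
    exact OddExt.ext (Subtype.ext (funext fun y => congrArg OddExt.fst (h' y)))
      (Subtype.ext (funext fun y => congrArg OddExt.snd (h' y)))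
  · intro g
    let T : OddExt (Grassmann.involution 𝕜 q) →ₗ[𝕜] Grassmann 𝕜 q :=
      { toFun := OddExt.fst, map_add' := fun _ _ => rfl, map_smul' := fun _ _ => rfl }
    let T' : OddExt (Grassmann.involution 𝕜 q) →ₗ[𝕜] Grassmann 𝕜 q :=
      { toFun := OddExt.snd, map_add' := fun _ _ => rfl, map_smul' := fun _ _ => rfl }
    refine ⟨⟨⟨_, g.2.map' (T ∘ₗ (Grassmann.ofOddExt 𝕜 q).symm.toLinearMap)⟩,
      ⟨_, g.2.map' (T' ∘ₗ (Grassmann.ofOddExt 𝕜 q).symm.toLinearMap)⟩⟩,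
      Subtype.ext (funext fun y => ?_)⟩
    exact AlgEquiv.apply_symm_apply (Grassmann.ofOddExt 𝕜 q) (g.1 y)

end Smooth

/-! ## The product of a supermanifold with `𝔸^{0|1}` -/

namespace SuperChart

variable {𝕜 : Type} [RCLike 𝕜] {X : SuperSpace 𝕜} {p q : ℕ}

/-- The isomorphism of the sections over `W` with their coordinate expressions. -/
def coord (c : SuperChart X p q) (W : Opens X.carrier) (hW : W ≤ c.dom) :
    X.sec W ≃ₐ[𝕜] superFunctions 𝕜 p q (c.img W) :=
  c.iso W hW

theorem coord_part (c : SuperChart X p q) (W : Opens X.carrier) (hW : W ≤ c.dom) (i : ZMod 2)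
    (f : X.sec W) (hf : f ∈ X.part W i) (y) : (c.coord W hW f).1 y ∈ Grassmann.part q i :=
  c.iso_part W hW i f hf y

theorem coord_res (c : SuperChart X p q) {W W' : Opens X.carrier} (hW : W ≤ c.dom) (h : W' ≤ W)
    (f : X.sec W) (y : c.img W') :
    (c.coord W' (h.trans hW) (X.res h f)).1 y = (c.coord W hW f).1 ⟨y, c.img_mono h y.2⟩ :=
  congrArg (fun g : superFunctions 𝕜 p q (c.img W') => g.1 y) (c.iso_res W hW W' (h.trans hW) h f)

theorem coord_parity (c : SuperChart X p q) (W : Opens X.carrier) (hW : W ≤ c.dom) (f : X.sec W) :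
    c.coord W hW (X.parity W f) = superInvolution 𝕜 q _ (c.coord W hW f) := by
  obtain ⟨a, ha, b, hb, rfl⟩ := X.exists_even_add_odd f
  refine Subtype.ext (funext fun y => ?_)
  rw [map_add, X.parity_even ha, X.parity_odd hb, superInvolution_apply, map_add, map_add, map_neg]
  change (c.coord W hW a).1 y + -(c.coord W hW b).1 y =
    Grassmann.involution 𝕜 q ((c.coord W hW a).1 y + (c.coord W hW b).1 y)
  rw [map_add, Grassmann.involution_even (c.coord_part W hW 0 a ha y),
    Grassmann.involution_odd (c.coord_part W hW 1 b hb y)]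

/-- The coordinate expressions in the product of a chart with `𝔸^{0|1}`. -/
def thickenCoord (c : SuperChart X p q) (W : Opens X.carrier) (hW : W ≤ c.dom) :
    OddExt (X.parity W) ≃ₐ[𝕜] superFunctions 𝕜 p (q + 1) (c.img W) :=
  AlgEquiv.ofBijective ((affineOfOddExt 𝕜 q (c.img W)).comp
    (OddExt.map (c.coord W hW : X.sec W →ₐ[𝕜] _) (c.coord_parity W hW)))
    (affineOfOddExt_bijective.comp (by
      constructor
      · intro z w e
        exact OddExt.ext ((c.coord W hW).injective (congrArg OddExt.fst e))
          ((c.coord W hW).injective (congrArg OddExt.snd e))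
      · intro z
        exact ⟨⟨(c.coord W hW).symm z.fst, (c.coord W hW).symm z.snd⟩, OddExt.ext
          ((c.coord W hW).apply_symm_apply _) ((c.coord W hW).apply_symm_apply _)⟩))

/-- The product of a chart with `𝔸^{0|1}`. -/
def thicken (c : SuperChart X p q) : SuperChart X.thicken p (q + 1) where
  base := c.base
  iso := fun (W : Opens X.carrier) hW => c.thickenCoord W hW
  iso_part := fun (W : Opens X.carrier) hW i f hf y =>
    Grassmann.ofOddExt_mem_part (c.coord_part W hW i _ hf.1 y) (c.coord_part W hW _ _ hf.2 y)
  iso_res := fun (W : Opens X.carrier) hW (W' : Opens X.carrier) hW' h f => by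
    refine Subtype.ext (funext fun y => ?_)
    refine congrArg (Grassmann.ofOddExt 𝕜 q) (OddExt.ext ?_ ?_)
    · exact c.coord_res hW h f.fst y
    · exact c.coord_res hW h f.snd y

end SuperChart

theorem SuperSpace.Hom.pull_res_left {𝕜 : Type} [RCLike 𝕜] {X Y : SuperSpace 𝕜} (f : Hom X Y)
    (U V h) (U') (h') (hU : U' ≤ U) (s : Y.sec V) : f.pull U' V h' s = X.res hU (f.pull U V h s) := by
  rw [← f.pull_res U V h U' V h' hU le_rfl, Y.res_refl]

/-- The definition of `Hom.comp` passes through the full preimage of `W`; restriction shows that any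
admissible intermediate open set gives the same result. -/
theorem SuperSpace.Hom.pull_comp {𝕜 : Type} [RCLike 𝕜] {X Y Z : SuperSpace 𝕜} (f : Hom X Y)
    (g : Hom Y Z) (U V W h h' h'') (s : Z.sec W) :
    (f.comp g).pull U W h s = f.pull U V h' (g.pull V W h'' s) := by
  rw [g.pull_res_left ⟨g.base ⁻¹' W, W.isOpen.preimage g.continuous_base⟩ W (fun _ hx => hx) V h''
    h'' s, f.pull_eq U _ V h h']
  rfl

/-- The functor `M ↦ M × 𝔸^{0|1}` on supermanifolds. -/
def thickenFunctor (𝕜 : Type) [RCLike 𝕜] : Supermanifold 𝕜 ⥤ Supermanifold 𝕜 where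
  obj M :=
    { toSuperSpace := M.thicken
      exists_chart := fun x => by
        obtain ⟨p, q, c, hc⟩ := M.exists_chart x
        exact ⟨p, q + 1, c.thicken, hc⟩ }
  map φ := SuperSpace.thickenMap φ
  map_id M := SuperSpace.Hom.ext' rfl fun _ _ _ _ _ => rfl
  map_comp φ ψ := SuperSpace.Hom.ext' rfl fun _ _ _ _ _ => rfl

/-- The projection `M × 𝔸^{0|1} → M`. -/
def thickenProjection (𝕜 : Type) [RCLike 𝕜] : thickenFunctor 𝕜 ⟶ 𝟭 (Supermanifold 𝕜) where
  app M := M.thickenProj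
  naturality M N φ := SuperSpace.Hom.ext' rfl fun U V h h' s => by
    refine OddExt.ext ?_ ?_
    · exact (SuperSpace.Hom.pull_eq φ _ _ _ _ _ _ _).trans
        (SuperSpace.Hom.pull_res_left φ _ _ (fun _ hx => hx) _ h
          (fun x hx => h' x hx) s)
    · exact map_zero (SuperSpace.Hom.pull φ (id U : Opens M.carrier) (id V : Opens N.carrier) h)

/-- The zero section `M → M × 𝔸^{0|1}`. -/
def thickenZeroSection (𝕜 : Type) [RCLike 𝕜] : 𝟭 (Supermanifold 𝕜) ⟶ thickenFunctor 𝕜 where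
  app M := M.thickenZero
  naturality M N φ := SuperSpace.Hom.ext' rfl fun U V h h' s => by
    exact (SuperSpace.Hom.pull_eq φ _ _ _ _ _ _ _).trans
        (SuperSpace.Hom.pull_res_left φ _ _ (fun _ hx => hx) _ h
          (fun x hx => h' x hx) _)

theorem thickenZeroSection_projection {𝕜 : Type} [RCLike 𝕜] (M : Supermanifold 𝕜) :
    (thickenZeroSection 𝕜).app M ≫ (thickenProjection 𝕜).app M = 𝟙 M :=
  SuperSpace.Hom.ext' rfl fun U V h h' s => M.res_res _ _ _

/-! ## Invertible superfunctions and matrices -/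

namespace Grassmann

variable {𝕜 : Type} [RCLike 𝕜] {q : ℕ}

/-- The body `Λ(ξ₁, …, ξ_q) → 𝕜`, `ξ_j ↦ 0`. -/
def body (𝕜 : Type) [RCLike 𝕜] (q : ℕ) : Grassmann 𝕜 q →ₐ[𝕜] 𝕜 := ExteriorAlgebra.algebraMapInv

@[simp] theorem body_ι (v : Fin q → 𝕜) : body 𝕜 q (ExteriorAlgebra.ι 𝕜 v) = 0 := by
  rw [body, ExteriorAlgebra.algebraMapInv, ExteriorAlgebra.lift_ι_apply]; rfl

theorem body_algebraMap (c : 𝕜) : body 𝕜 q (algebraMap 𝕜 _ c) = c := AlgHom.commutes _ c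

theorem body_odd {a : Grassmann 𝕜 q} (ha : a ∈ part q 1) : body 𝕜 q a = 0 := by
  have h : (body 𝕜 q).comp (involution 𝕜 q) = body 𝕜 q :=
    ExteriorAlgebra.hom_ext (LinearMap.ext fun v => by simp)
  have h' := DFunLike.congr_fun h a
  rw [AlgHom.comp_apply, involution_odd ha, map_neg] at h'
  exact self_eq_neg.1 h'.symm

/-- The elements of filtration degree at least `k`. -/
def filtration (𝕜 : Type) [RCLike 𝕜] (q k : ℕ) : Submodule 𝕜 (Grassmann 𝕜 q) :=
  LinearMap.range (ExteriorAlgebra.ι 𝕜 (M := Fin q → 𝕜)) ^ k * ⊤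

/-- Generators can be moved to the left by `mul_ι`, so the right ideals `filtration` absorb
multiplication from the left too. This makes the filtration multiplicative. -/
theorem top_mul_range_pow (k : ℕ) :
    (⊤ : Submodule 𝕜 (Grassmann 𝕜 q)) * LinearMap.range (ExteriorAlgebra.ι 𝕜 (M := Fin q → 𝕜)) ^ k ≤
      filtration 𝕜 q k := by
  induction k with
  | zero => simp [filtration]
  | succ k ih =>
    rw [filtration, pow_succ, ← mul_assoc]
    refine (mul_le_mul_left ih _).trans ?_
    rw [filtration, mul_assoc, mul_assoc]
    refine mul_le_mul_right ?_ _
    rw [Submodule.mul_le]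
    rintro x - _ ⟨v, rfl⟩
    rw [mul_ι]
    exact Submodule.mul_mem_mul ⟨v, rfl⟩ trivial

theorem filtration_mul {j k : ℕ} {a b : Grassmann 𝕜 q} (ha : a ∈ filtration 𝕜 q j)
    (hb : b ∈ filtration 𝕜 q k) : a * b ∈ filtration 𝕜 q (j + k) := by
  have h : filtration 𝕜 q j * filtration 𝕜 q k ≤ filtration 𝕜 q (j + k) := by
    rw [filtration, filtration, filtration, mul_assoc, pow_add, mul_assoc]
    refine mul_le_mul_right ?_ _
    rw [← mul_assoc]
    refine (mul_le_mul_left (top_mul_range_pow k) _).trans ?_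
    rw [filtration, mul_assoc]
    exact mul_le_mul_right le_top _
  exact h (Submodule.mul_mem_mul ha hb)

/-- There are no nonzero exterior powers beyond degree `q`. With `filtration_mul` this is the
nilpotency of the ideal generated by the odd variables. -/
theorem filtration_eq_bot : filtration 𝕜 q (q + 1) = ⊥ := by
  have h : Module.finrank 𝕜 (⋀[𝕜]^(q + 1) (Fin q → 𝕜)) = 0 := by
    rw [exteriorPower.finrank_eq]; simp
  have h' : (LinearMap.range (ExteriorAlgebra.ι 𝕜 (M := Fin q → 𝕜))) ^ (q + 1) = ⊥ :=
    Submodule.finrank_eq_zero.1 h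
  rw [filtration, h', Submodule.bot_mul]

/-- By induction on `a`, removing the body from `a` leaves a multiple of generators. -/
theorem mem_filtration_one {a : Grassmann 𝕜 q} (ha : body 𝕜 q a = 0) : a ∈ filtration 𝕜 q 1 := by
  have h : ∀ a : Grassmann 𝕜 q, a - algebraMap 𝕜 _ (body 𝕜 q a) ∈ filtration 𝕜 q 1 := by
    intro a
    induction a using ExteriorAlgebra.induction with
    | algebraMap r => rw [body_algebraMap, sub_self]; exact Submodule.zero_mem _
    | ι v =>
      rw [body_ι, map_zero, sub_zero, filtration, pow_one, ← mul_one (ExteriorAlgebra.ι 𝕜 v)]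
      exact Submodule.mul_mem_mul ⟨v, rfl⟩ trivial
    | mul a b ha hb =>
      have e : a * b - algebraMap 𝕜 _ (body 𝕜 q (a * b)) =
          (a - algebraMap 𝕜 _ (body 𝕜 q a)) * b +
            body 𝕜 q a • (b - algebraMap 𝕜 _ (body 𝕜 q b)) := by
        rw [map_mul, map_mul, Algebra.smul_def]; noncomm_ring
      rw [e]
      refine Submodule.add_mem _ ?_ (Submodule.smul_mem _ _ hb)
      exact filtration_mul (k := 0) ha (by simp [filtration])
    | add a b ha hb =>
      have e : a + b - algebraMap 𝕜 _ (body 𝕜 q (a + b)) = (a - algebraMap 𝕜 _ (body 𝕜 q a)) +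
          (b - algebraMap 𝕜 _ (body 𝕜 q b)) := by
        rw [map_add, map_add]; abel
      rw [e]
      exact Submodule.add_mem _ ha hb
  simpa [ha] using h a

end Grassmann

section Invertible

variable {𝕜 : Type} [RCLike 𝕜] {p q : ℕ} {V : Opens (EuclideanSpace ℝ (Fin p))}

/-- A smooth `𝕜`-valued function as a superfunction. -/
def scalarSuperfunction (q : ℕ) (g : V → 𝕜) (hg : ContDiffOn ℝ ∞ (extendZero g) V) :
    superFunctions 𝕜 p q V :=
  ⟨fun y => algebraMap 𝕜 _ (g y), fun I => by
    have h : ContDiffOn ℝ ∞ (fun y => extendZero g y * Grassmann.coeff (𝕜 := 𝕜) (q := q) I 1) V :=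
      hg.mul contDiffOn_const
    refine h.congr fun y hy => ?_
    rw [extendZero_apply (V := V) _ ⟨y, hy⟩, extendZero_apply (V := V) _ ⟨y, hy⟩]
    change Grassmann.coeff I (algebraMap 𝕜 (Grassmann 𝕜 q) (g ⟨y, hy⟩)) = _
    rw [Algebra.algebraMap_eq_smul_one, map_smul, smul_eq_mul]⟩

theorem contDiffOn_body (f : superFunctions 𝕜 p q V) :
    ContDiffOn ℝ ∞ (extendZero fun y => Grassmann.body 𝕜 q (f.1 y)) V :=
  f.2.functional (Grassmann.body 𝕜 q).toLinearMap

theorem contDiffOn_det {E ι : Type} [NormedAddCommGroup E] [NormedSpace ℝ E] [Fintype ι]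
    [DecidableEq ι] {A : E → Matrix ι ι 𝕜} {s : Set E}
    (hA : ∀ i j, ContDiffOn ℝ ∞ (fun y => A y i j) s) : ContDiffOn ℝ ∞ (fun y => (A y).det) s := by
  simp only [Matrix.det_apply]
  exact ContDiffOn.sum fun σ _ =>
    ContDiffOn.const_smul (R := ℤˣ) _ (contDiffOn_prod fun i _ => hA _ _)

/-- Cramer's rule: the entries of the inverse are cofactors, again determinants, divided by the
determinant. -/
theorem contDiffOn_matrix_inv {E ι : Type} [NormedAddCommGroup E] [NormedSpace ℝ E] [Fintype ι]
    [DecidableEq ι] {A : E → Matrix ι ι 𝕜} {s : Set E}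
    (hA : ∀ i j, ContDiffOn ℝ ∞ (fun y => A y i j) s) (hdet : ∀ y ∈ s, (A y).det ≠ 0) (i j : ι) :
    ContDiffOn ℝ ∞ (fun y => (A y)⁻¹ i j) s := by
  have h : ContDiffOn ℝ ∞ (fun y => ((A y).det)⁻¹ * (A y).adjugate i j) s := by
    refine ((contDiffOn_det hA).inv hdet).mul ?_
    simp only [Matrix.adjugate_apply]
    refine contDiffOn_det fun k l => ?_
    by_cases hk : k = j
    · subst hk; simp only [Matrix.updateRow_self]; exact contDiffOn_const
    · simp only [Matrix.updateRow_ne hk]; exact hA k l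
  refine h.congr fun y hy => ?_
  rw [Matrix.inv_def, Matrix.smul_apply, Ring.inverse_eq_inv', smul_eq_mul]

/-- A matrix of superfunctions is invertible if its body is so at every point. -/
theorem isUnit_matrix_of_body {ι : Type} [Fintype ι] [DecidableEq ι]
    (M : Matrix ι ι (superFunctions 𝕜 p q V))
    (hM : ∀ y : V, (Matrix.of fun i j => Grassmann.body 𝕜 q ((M i j).1 y)).det ≠ 0) : IsUnit M := by
  set A : V → Matrix ι ι 𝕜 := fun y => Matrix.of fun i j => Grassmann.body 𝕜 q ((M i j).1 y) with hA
  have hinv : ∀ i j, ContDiffOn ℝ ∞ (extendZero fun y : V => (A y)⁻¹ i j) V := by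
    intro i j
    refine (contDiffOn_matrix_inv (s := V)
      (A := fun y => Matrix.of fun i j => extendZero (fun y => A y i j) y)
      (fun i j => contDiffOn_body (M i j)) (fun y hy => ?_) i j).congr fun y hy => ?_
    · convert hM ⟨y, hy⟩ using 3
      ext i j
      exact extendZero_apply _ (⟨y, hy⟩ : V)
    · rw [extendZero_apply (V := V) _ ⟨y, hy⟩]
      have e : A ⟨y, hy⟩ = Matrix.of fun i j => extendZero (fun y => A y i j) y := by
        ext i j
        exact (extendZero_apply (fun y => A y i j) (⟨y, hy⟩ : V)).symm
      rw [e]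
  -- `B` is the body of `M` and `C` its inverse, both regarded as matrices of superfunctions. The
  -- entries of `C * (M - B)` have no body, so this matrix is nilpotent, and `M = B * (1 + C * (M -
  -- B))` is a product of units.
  let B : Matrix ι ι (superFunctions 𝕜 p q V) :=
    Matrix.of fun i j => scalarSuperfunction q (fun y => A y i j) (contDiffOn_body (M i j))
  let C : Matrix ι ι (superFunctions 𝕜 p q V) :=
    Matrix.of fun i j => scalarSuperfunction q (fun y => (A y)⁻¹ i j) (hinv i j)
  have hval : ∀ (P Q : Matrix ι ι (superFunctions 𝕜 p q V)) (i j) (y : V),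
      ((P * Q) i j).1 y = ∑ k, (P i k).1 y * (Q k j).1 y := by
    intro P Q i j y
    rw [Matrix.mul_apply, AddSubmonoidClass.coe_finsetSum, Finset.sum_apply]
    rfl
  have hdet : ∀ y, IsUnit (A y).det := fun y => (hM y).isUnit
  have hone : ∀ i j (y : V), ((1 : Matrix ι ι (superFunctions 𝕜 p q V)) i j).1 y =
      algebraMap 𝕜 _ ((1 : Matrix ι ι 𝕜) i j) := by
    intro i j y
    by_cases h : i = j
    · subst h; simp
    · simp [Matrix.one_apply_ne h]
  have hBC : B * C = 1 := by
    ext i j : 2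
    refine funext fun y => ?_
    rw [hval, hone, ← Matrix.mul_nonsing_inv (A y) (hdet y), Matrix.mul_apply, map_sum]
    exact Finset.sum_congr rfl fun k _ => (map_mul _ _ _).symm
  have hCB : C * B = 1 := by
    ext i j : 2
    refine funext fun y => ?_
    rw [hval, hone, ← Matrix.nonsing_inv_mul (A y) (hdet y), Matrix.mul_apply, map_sum]
    exact Finset.sum_congr rfl fun k _ => (map_mul _ _ _).symm
  have hN : ∀ i j (y : V), ((C * (M - B)) i j).1 y ∈ Grassmann.filtration 𝕜 q 1 := by
    intro i j y
    rw [hval]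
    refine Submodule.sum_mem _ fun k _ => Grassmann.mem_filtration_one ?_
    rw [map_mul]
    refine mul_eq_zero_of_right _ ?_
    change Grassmann.body 𝕜 q ((M k j).1 y - algebraMap 𝕜 _ (Grassmann.body 𝕜 q ((M k j).1 y))) = 0
    rw [map_sub, Grassmann.body_algebraMap, sub_self]
  have hpow : ∀ n i j (y : V), (((C * (M - B)) ^ (n + 1)) i j).1 y ∈
      Grassmann.filtration 𝕜 q (n + 1) := by
    intro n
    induction n with
    | zero => simpa using hN
    | succ n ih =>
      intro i j y
      rw [pow_succ, hval]
      exact Submodule.sum_mem _ fun k _ => Grassmann.filtration_mul (ih i k y) (hN k j y)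
  have hnil : IsNilpotent (C * (M - B)) := by
    refine ⟨q + 1, ?_⟩
    ext i j : 2
    refine funext fun y => ?_
    have h := hpow q i j y
    rw [Grassmann.filtration_eq_bot, Submodule.mem_bot] at h
    exact h
  have hMB : M = B * (1 + C * (M - B)) := by
    rw [mul_add, ← mul_assoc, hBC]; simp
  rw [hMB]
  exact IsUnit.mul ⟨⟨B, C, hBC, hCB⟩, rfl⟩ hnil.isUnit_one_add

/-- A superfunction is invertible if its value at every point is non-zero. -/
theorem isUnit_of_body (f : superFunctions 𝕜 p q V)
    (hf : ∀ y : V, Grassmann.body 𝕜 q (f.1 y) ≠ 0) : IsUnit f := by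
  -- The case of a matrix of size one.
  obtain ⟨⟨M, N, h1, h2⟩, h⟩ := isUnit_matrix_of_body (Matrix.of fun _ _ : Unit => f)
    (fun y => by simpa using hf y)
  simp only at h
  subst h
  refine ⟨⟨f, N () (), ?_, ?_⟩, rfl⟩
  · simpa [Matrix.mul_apply] using congrFun (congrFun h1 ()) ()
  · simpa [Matrix.mul_apply] using congrFun (congrFun h2 ()) ()

end Invertible

/-! ## Values at points -/

namespace SuperChart

variable {𝕜 : Type} [RCLike 𝕜] {X : SuperSpace 𝕜} {p q : ℕ}

theorem mem_img_inf_dom {c : SuperChart X p q} {W : Opens X.carrier}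
    {u : EuclideanSpace ℝ (Fin p)} (hu : u ∈ c.img W) : u ∈ c.img (W ⊓ c.dom) :=
  ⟨hu.1, hu.2, c.base.map_target hu.1⟩

theorem base_mem_img {c : SuperChart X p q} {W : Opens X.carrier} {x : X.carrier} (hx : x ∈ c.dom)
    (hW : x ∈ W) : c.base x ∈ c.img W := by
  refine ⟨c.base.map_source hx, ?_⟩
  change c.base.symm (c.base x) ∈ W
  rwa [c.base.left_inv hx]

/-- The coordinate expression on the part of `V` in the domain of the chart. -/
def localCoord (c : SuperChart X p q) (V : Opens X.carrier) :
    X.sec V →ₐ[𝕜] superFunctions 𝕜 p q (c.img (V ⊓ c.dom)) :=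
  (c.coord (V ⊓ c.dom) inf_le_right : X.sec (V ⊓ c.dom) →ₐ[𝕜] _).comp (X.res inf_le_left)

theorem localCoord_res (c : SuperChart X p q) {V V' : Opens X.carrier} (h : V' ≤ V) (f : X.sec V)
    {u : EuclideanSpace ℝ (Fin p)} (hu) :
    (c.localCoord V' (X.res h f)).1 ⟨u, hu⟩ =
      (c.localCoord V f).1 ⟨u, c.img_mono (inf_le_inf_right _ h) hu⟩ := by
  rw [localCoord, localCoord, AlgHom.comp_apply, AlgHom.comp_apply, X.res_res,
    ← X.res_res (inf_le_inf_right _ h : V' ⊓ c.dom ≤ V ⊓ c.dom) inf_le_left f]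
  exact c.coord_res _ _ _ _

/-- The value, in the Grassmann algebra, of a section at the point with coordinates `u`. -/
def pointValue (c : SuperChart X p q) (u : EuclideanSpace ℝ (Fin p)) (V : Opens X.carrier)
    (hu : u ∈ c.img V) : X.sec V →ₐ[𝕜] Grassmann 𝕜 q :=
  ((Pi.evalAlgHom 𝕜 (fun _ : c.img (V ⊓ c.dom) => Grassmann 𝕜 q) ⟨u, mem_img_inf_dom hu⟩).comp
    (superFunctions 𝕜 p q _).val).comp (c.localCoord V)

theorem pointValue_apply (c : SuperChart X p q) (u : EuclideanSpace ℝ (Fin p)) (V : Opens X.carrier)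
    (hu : u ∈ c.img V) (f : X.sec V) :
    c.pointValue u V hu f = (c.localCoord V f).1 ⟨u, mem_img_inf_dom hu⟩ := rfl

theorem pointValue_eq_coord (c : SuperChart X p q) (u : EuclideanSpace ℝ (Fin p))
    (V : Opens X.carrier) (hV : V ≤ c.dom) (hu : u ∈ c.img V) (f : X.sec V) :
    c.pointValue u V hu f = (c.coord V hV f).1 ⟨u, hu⟩ :=
  c.coord_res hV inf_le_left f ⟨u, mem_img_inf_dom hu⟩

theorem pointValue_res (c : SuperChart X p q) (u : EuclideanSpace ℝ (Fin p))
    {V V' : Opens X.carrier} (h : V' ≤ V) (hu : u ∈ c.img V') (f : X.sec V) :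
    c.pointValue u V' hu (X.res h f) = c.pointValue u V (c.img_mono h hu) f :=
  c.localCoord_res h f _

theorem pointValue_part (c : SuperChart X p q) (u : EuclideanSpace ℝ (Fin p)) (V : Opens X.carrier)
    (hu : u ∈ c.img V) {i : ZMod 2} {f : X.sec V} (hf : f ∈ X.part V i) :
    c.pointValue u V hu f ∈ Grassmann.part q i :=
  c.coord_part _ _ i _ (X.res_part _ hf) _

/-- The only compatible family of characters of the sections over the neighbourhoods of a point
is the evaluation at the point. -/
theorem character_eq (c : SuperChart X p q) {x : X.carrier} (hx : x ∈ c.dom)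
    (χ : ∀ V : Opens X.carrier, x ∈ V → X.sec V →ₐ[𝕜] 𝕜)
    (hχ : ∀ (V V' : Opens X.carrier) (h : V' ≤ V) (hV' : x ∈ V') (f : X.sec V),
      χ V' hV' (X.res h f) = χ V (h hV') f)
    (V : Opens X.carrier) (hV : x ∈ V) (f : X.sec V) :
    χ V hV f = Grassmann.body 𝕜 q (c.pointValue (c.base x) V (base_mem_img hx hV) f) := by
  set a := Grassmann.body 𝕜 q (c.pointValue (c.base x) V (base_mem_img hx hV) f) with ha
  by_contra hne
  -- If `χ` differed from the value at the point, `g` would lie in the kernel of `χ` and yet have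
  -- non-zero body at `x`. It would then be invertible near `x`, whereas `χ` maps units to units.
  set g : X.sec V := f - algebraMap 𝕜 _ (χ V hV f) with hg
  have hχg : χ V hV g = 0 := by rw [hg, map_sub, AlgHom.commutes]; exact sub_self _
  have hbg : Grassmann.body 𝕜 q (c.pointValue (c.base x) V (base_mem_img hx hV) g) ≠ 0 := by
    rw [hg, map_sub, map_sub, AlgHom.commutes, AlgHom.commutes, ← ha]
    exact sub_ne_zero.2 (Ne.symm hne)
  have hcont := (contDiffOn_body (c.localCoord V g)).continuousOn
  have hu : c.base x ∈ c.img (V ⊓ c.dom) := mem_img_inf_dom (base_mem_img hx hV)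
  have hopen := hcont.isOpen_inter_preimage (c.img (V ⊓ c.dom)).isOpen
    (isOpen_compl_singleton (x := (0 : 𝕜)))
  set O : Set (EuclideanSpace ℝ (Fin p)) := c.img (V ⊓ c.dom) ∩ (extendZero fun y =>
    Grassmann.body 𝕜 q ((c.localCoord V g).1 y)) ⁻¹' {0}ᶜ with hO
  have huO : c.base x ∈ O := by
    refine ⟨hu, ?_⟩
    rw [mem_preimage, extendZero_apply (V := c.img (V ⊓ c.dom)) _ ⟨_, hu⟩]
    exact hbg
  -- The points near `x` where the body of `g` does not vanish.
  let W : Opens X.carrier := ⟨c.base.source ∩ c.base ⁻¹' O, c.base.isOpen_inter_preimage hopen⟩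
  have hxW : x ∈ W := ⟨hx, huO⟩
  have hWV : W ≤ V := by
    rintro y ⟨hy, hy'⟩
    have : c.base.symm (c.base y) ∈ V := (hy'.1).2.1
    rwa [c.base.left_inv hy] at this
  have hWd : W ≤ c.dom := fun y hy => hy.1
  have hunit : IsUnit (c.coord W hWd (X.res hWV g)) := by
    refine isUnit_of_body _ fun y => ?_
    have hyO : (y : EuclideanSpace ℝ (Fin p)) ∈ O := by
      have h1 := y.2.2.2
      rwa [mem_preimage, c.base.right_inv y.2.1] at h1
    have h2 := hyO.2
    rw [mem_preimage, extendZero_apply (V := c.img (V ⊓ c.dom)) _ ⟨_, hyO.1⟩] at h2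
    rw [← c.pointValue_eq_coord _ _ hWd y.2, c.pointValue_res _ hWV]
    exact h2
  have hunit' : IsUnit (X.res hWV g) := by
    have := hunit.map (c.coord W hWd).symm
    rwa [AlgEquiv.symm_apply_apply] at this
  have := hunit'.map (χ W hxW)
  rw [hχ V W hWV hxW, hχg] at this
  exact not_isUnit_zero this

end SuperChart

namespace SuperSpace

variable {𝕜 : Type} [RCLike 𝕜]

/-- An open set without points is covered by the empty family, and the sheaf axiom then identifies
all sections. -/
theorem subsingleton_sec (N : SuperSpace 𝕜) {U : Opens N.carrier} (hU : ∀ x, x ∉ U) :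
    Subsingleton (N.sec U) := by
  have h : U ≤ ⨆ i : Empty, (i.elim : Opens N.carrier) := fun x hx => (hU x hx).elim
  have h' : (⨆ i : Empty, (i.elim : Opens N.carrier)) ≤ U := iSup_le fun i => i.elim
  refine ⟨fun s t => ?_⟩
  rw [← N.res_refl le_rfl s, ← N.res_refl le_rfl t, ← N.res_res h h' s, ← N.res_res h h' t]
  exact congrArg _ (N.sheaf_ext _ _ _ fun i => i.elim)

/-- A homomorphism to the zero algebra. -/
def zeroAlgHom (A B : Type) [Ring A] [Algebra 𝕜 A] [Ring B] [Algebra 𝕜 B] [Subsingleton B] :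
    A →ₐ[𝕜] B where
  toFun _ := 0
  map_one' := Subsingleton.elim _ _
  map_mul' _ _ := Subsingleton.elim _ _
  map_zero' := rfl
  map_add' _ _ := Subsingleton.elim _ _
  commutes' _ := Subsingleton.elim _ _

open Classical in
/-- A morphism with constant underlying map. -/
def homOfPoint (N X : SuperSpace 𝕜) (x : X.carrier)
    (F : ∀ (U : Opens N.carrier) (V : Opens X.carrier), x ∈ V → X.sec V →ₐ[𝕜] N.sec U)
    (hpart : ∀ U V hx (i : ZMod 2) (f : X.sec V), f ∈ X.part V i → F U V hx f ∈ N.part U i)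
    (hres : ∀ (U U' : Opens N.carrier) (V V' : Opens X.carrier) hx hx' (hU : U' ≤ U) (hV : V' ≤ V)
      (f : X.sec V), F U' V' hx' (X.res hV f) = N.res hU (F U V hx f)) : Hom N X where
  base := fun _ => x
  continuous_base := continuous_const
  -- If `x ∉ V`, then `U` has no points and its algebra of sections is zero, so there is only one
  -- choice.
  pull U V h := if hx : x ∈ V then F U V hx else
    haveI := N.subsingleton_sec (U := U) fun y hy => hx (h y hy)
    zeroAlgHom _ _
  pull_part U V h i f hf := by
    split_ifs with hx
    · exact hpart U V hx i f hf
    · exact Submodule.zero_mem _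
  pull_res U V h U' V' h' hU hV f := by
    by_cases hx' : x ∈ V'
    · rw [dif_pos hx', dif_pos (hV hx')]
      exact hres _ _ _ _ _ _ hU hV f
    · have := N.subsingleton_sec (U := U') fun y hy => hx' (h' y hy)
      exact Subsingleton.elim _ _

theorem homOfPoint_pull {N X : SuperSpace 𝕜} {x : X.carrier} (F) (hpart) (hres)
    (U : Opens N.carrier) (V : Opens X.carrier) (h) (hx : x ∈ V) (f : X.sec V) :
    (homOfPoint N X x F hpart hres).pull U V h f = F U V hx f := by
  have e : (homOfPoint N X x F hpart hres).pull U V h = F U V hx := dif_pos hx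
  rw [e]

/-- Two morphisms that are constant at `x` agree if they do so on sections near `x`. -/
theorem hom_ext_of_base_eq {N X : SuperSpace 𝕜} {x : X.carrier} {φ ψ : Hom N X}
    (hφ : ∀ y, φ.base y = x) (hψ : ∀ y, ψ.base y = x)
    (h : ∀ U V hφ' hψ', x ∈ V → ∀ f, φ.pull U V hφ' f = ψ.pull U V hψ' f) : φ = ψ := by
  refine Hom.ext' (funext fun y => (hφ y).trans (hψ y).symm) fun U V h1 h2 s => ?_
  by_cases hx : x ∈ V
  · exact h U V h1 h2 hx s
  · have := N.subsingleton_sec (U := U) fun y hy => hx (hφ y ▸ h1 y hy)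
    exact Subsingleton.elim _ _

end SuperSpace

namespace Supermanifold

variable {𝕜 : Type} [RCLike 𝕜]

/-- The value of a section at a point. -/
def evalAt (M : Supermanifold 𝕜) (x : M.carrier) (V : Opens M.carrier) (hx : x ∈ V) :
    M.sec V →ₐ[𝕜] 𝕜 :=
  let c := (M.exists_chart x).choose_spec.choose_spec
  (Grassmann.body 𝕜 _).comp
    (c.choose.pointValue (c.choose.base x) V (SuperChart.base_mem_img c.choose_spec hx))

theorem evalAt_res (M : Supermanifold 𝕜) {x : M.carrier} (V V' : Opens M.carrier) (h : V' ≤ V)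
    (hx : x ∈ V') (f : M.sec V) : M.evalAt x V' hx (M.res h f) = M.evalAt x V (h hx) f :=
  congrArg (Grassmann.body 𝕜 _) (SuperChart.pointValue_res _ _ h
    (SuperChart.base_mem_img (M.exists_chart x).choose_spec.choose_spec.choose_spec hx) f)

theorem evalAt_odd (M : Supermanifold 𝕜) {x : M.carrier} (V : Opens M.carrier) (hx : x ∈ V)
    {f : M.sec V} (hf : f ∈ M.part V 1) : M.evalAt x V hx f = 0 :=
  Grassmann.body_odd (SuperChart.pointValue_part _ _ _
    (SuperChart.base_mem_img (M.exists_chart x).choose_spec.choose_spec.choose_spec hx) hf)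

/-- The definition of `evalAt` selects a chart; this characterization removes the dependence on the
selection. -/
theorem character_eq (M : Supermanifold 𝕜) {x : M.carrier}
    (χ : ∀ V : Opens M.carrier, x ∈ V → M.sec V →ₐ[𝕜] 𝕜)
    (hχ : ∀ (V V' : Opens M.carrier) (h : V' ≤ V) (hV' : x ∈ V') (f : M.sec V),
      χ V' hV' (M.res h f) = χ V (h hV') f)
    (V : Opens M.carrier) (hV : x ∈ V) (f : M.sec V) : χ V hV f = M.evalAt x V hV f :=
  SuperChart.character_eq _ (M.exists_chart x).choose_spec.choose_spec.choose_spec χ hχ V hV f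

/-- Evaluation at `x` after pullback is a compatible family of characters at the image point, and
there is only one such family. -/
theorem evalAt_pull {M N : Supermanifold 𝕜} (φ : M ⟶ N) (x : M.carrier) (U : Opens M.carrier)
    (V : Opens N.carrier) (h) (hx : x ∈ U) (f : N.sec V) :
    M.evalAt x U hx (SuperSpace.Hom.pull φ U V h f) = N.evalAt (φ.base x) V (h x hx) f := by
  have hc : Continuous φ.base := φ.continuous_base
  rw [← N.character_eq (x := φ.base x) (fun V hV => (M.evalAt x ⟨φ.base ⁻¹' V, V.isOpen.preimage hc⟩
    hV).comp (SuperSpace.Hom.pull φ _ V fun _ hy => hy))]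
  · rw [AlgHom.comp_apply,
      SuperSpace.Hom.pull_res_left φ ⟨φ.base ⁻¹' V, V.isOpen.preimage hc⟩ V (fun _ hy => hy) U h
        (fun y hy => h y hy), evalAt_res]
  · intro V V' hV hV' f
    simp only [AlgHom.comp_apply]
    rw [SuperSpace.Hom.pull_res φ ⟨φ.base ⁻¹' V, V.isOpen.preimage hc⟩ V (fun _ hy => hy)
      ⟨φ.base ⁻¹' V', V'.isOpen.preimage hc⟩ V' (fun _ hy => hy) (fun y hy => hV hy) hV, evalAt_res]

/-- The constant morphism with value `x`. -/
def pointHom (N M : Supermanifold 𝕜) (x : M.carrier) : N ⟶ M :=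
  SuperSpace.homOfPoint N.toSuperSpace M.toSuperSpace x
    (fun U V hx => (Algebra.ofId 𝕜 (N.sec U)).comp (M.evalAt x V hx))
    (fun U V hx i f hf => by
      rcases zmod_two_cases i with rfl | rfl
      · rw [AlgHom.comp_apply, Algebra.ofId_apply, Algebra.algebraMap_eq_smul_one]
        exact Submodule.smul_mem _ _ (N.one_mem_part U)
      · rw [AlgHom.comp_apply, M.evalAt_odd V hx hf, map_zero]
        exact Submodule.zero_mem _)
    (fun U U' V V' hx hx' hU hV f => by
      rw [AlgHom.comp_apply, evalAt_res, AlgHom.comp_apply, Algebra.ofId_apply, Algebra.ofId_apply,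
        AlgHom.commutes])

theorem pointHom_pull (N M : Supermanifold 𝕜) (x : M.carrier) (U : Opens N.carrier)
    (V : Opens M.carrier) (h) (hx : x ∈ V) (f : M.sec V) :
    SuperSpace.Hom.pull (pointHom N M x) U V h f = algebraMap 𝕜 _ (M.evalAt x V hx f) :=
  SuperSpace.homOfPoint_pull _ _ _ U V h hx f

theorem comp_pointHom {N N' M : Supermanifold 𝕜} (φ : N' ⟶ N) (x : M.carrier) :
    φ ≫ pointHom N M x = pointHom N' M x := by
  refine SuperSpace.hom_ext_of_base_eq (x := x) (fun _ => rfl) (fun _ => rfl) fun U V h h' hx f => ?_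
  rw [pointHom_pull _ _ _ _ _ _ hx]
  refine (SuperSpace.Hom.pull_comp φ _ U ⊤ V h (fun _ _ => trivial) (fun _ _ => hx) f).trans ?_
  refine (congrArg _ (pointHom_pull N M x ⊤ V (fun _ _ => hx) hx f)).trans ?_
  exact AlgHom.commutes _ _

theorem pointHom_comp {N M M' : Supermanifold 𝕜} (x : M.carrier) (ψ : M ⟶ M') :
    pointHom N M x ≫ ψ = pointHom N M' (ψ.base x) := by
  have hc : Continuous ψ.base := ψ.continuous_base
  refine SuperSpace.hom_ext_of_base_eq (x := ψ.base x) (fun _ => rfl) (fun _ => rfl)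
    fun U V h h' hx f => ?_
  rw [pointHom_pull _ _ _ _ _ _ hx]
  refine (SuperSpace.Hom.pull_comp _ ψ U ⟨ψ.base ⁻¹' V, V.isOpen.preimage hc⟩ V h (fun _ _ => hx)
    (fun _ hy => hy) f).trans ?_
  refine (pointHom_pull N M x U ⟨ψ.base ⁻¹' V, V.isOpen.preimage hc⟩ (fun _ _ => hx) hx _).trans ?_
  exact congrArg _ (evalAt_pull ψ x _ V _ _ f)

end Supermanifold

/-! ## Superderivations of the structure sheaf -/

namespace SuperSpace

variable {𝕜 : Type} [RCLike 𝕜]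

/-- The `i`-th power of the parity involution. -/
def parityPow (X : SuperSpace 𝕜) (i : ZMod 2) (U : Opens X.carrier) : X.sec U →ₐ[𝕜] X.sec U :=
  if i = 0 then AlgHom.id 𝕜 _ else X.parity U

@[simp] theorem parityPow_zero (X : SuperSpace 𝕜) (U : Opens X.carrier) (f : X.sec U) :
    X.parityPow 0 U f = f := rfl

@[simp] theorem parityPow_one (X : SuperSpace 𝕜) (U : Opens X.carrier) (f : X.sec U) :
    X.parityPow 1 U f = X.parity U f := by
  rw [parityPow, if_neg one_ne_zero]

theorem parityPow_of_mem (X : SuperSpace 𝕜) (i j : ZMod 2) {U : Opens X.carrier} {f : X.sec U}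
    (hf : f ∈ X.part U j) : X.parityPow i U f = (-1 : 𝕜) ^ (i * j).val • f := by
  rcases zmod_two_cases i with rfl | rfl
  · simp
  · rw [parityPow_one, X.parity_of_mem hf, one_mul]

/-- A superderivation of parity `i` of the structure sheaf. -/
structure SheafDerivation (X : SuperSpace 𝕜) (i : ZMod 2) where
  toFun : ∀ U : Opens X.carrier, Module.End 𝕜 (X.sec U)
  map_res : ∀ {U V : Opens X.carrier} (h : U ≤ V) (f : X.sec V),
    toFun U (X.res h f) = X.res h (toFun V f)
  map_part : ∀ (U : Opens X.carrier) (j : ZMod 2) (f : X.sec U), f ∈ X.part U j →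
    toFun U f ∈ X.part U (i + j)
  leibniz : ∀ (U : Opens X.carrier) (f g : X.sec U),
    toFun U (f * g) = toFun U f * g + X.parityPow i U f * toFun U g

theorem SheafDerivation.isSuperderivation {X : SuperSpace 𝕜} {i : ZMod 2}
    (D : X.SheafDerivation i) : X.IsSuperderivation i (D.toFun ⊤) where
  map_part := D.map_part ⊤
  leibniz j a b ha := by rw [D.leibniz, X.parityPow_of_mem i j ha, smul_mul_assoc]

/-! ### Odd superderivations from actions of `𝔸^{0|1}` -/

section Odd

variable {X Y : SuperSpace 𝕜}

theorem Hom.base_eq_of_thickenZero_comp {ψ : Hom X.thicken X}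
    (hψ : X.thickenZero.comp ψ = Hom.id X) (x : X.carrier) : ψ.base x = x :=
  congrFun (congrArg Hom.base hψ) x

theorem Hom.mem_of_thickenZero_comp {ψ : Hom X.thicken X}
    (hψ : X.thickenZero.comp ψ = Hom.id X) (U : Opens X.carrier) : ∀ x ∈ U, ψ.base x ∈ U :=
  fun x hx => by rwa [Hom.base_eq_of_thickenZero_comp hψ]

/-- The pullback of sections over `U` along an action of `𝔸^{0|1}`. -/
def oddPull (ψ : Hom X.thicken X) (hψ : X.thickenZero.comp ψ = Hom.id X) (U : Opens X.carrier) :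
    X.sec U →ₐ[𝕜] OddExt (X.parity U) :=
  ψ.pull U U (Hom.mem_of_thickenZero_comp hψ U)

/-- Setting `θ = 0` restricts the action to the zero section, where it is the identity by `hψ`. -/
theorem fst_oddPull {ψ : Hom X.thicken X} (hψ : X.thickenZero.comp ψ = Hom.id X)
    (U : Opens X.carrier) (f : X.sec U) : (oddPull ψ hψ U f).fst = f := by
  have h1 := Hom.pull_comp X.thickenZero ψ U U U (Hom.mem_of_thickenZero_comp hψ U)
    (fun _ hx => hx) (Hom.mem_of_thickenZero_comp hψ U) f
  have h2 : ∀ (φ : Hom X X) (h : φ = Hom.id X) (h' : ∀ x ∈ U, φ.base x ∈ U),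
      φ.pull U U h' f = f := by
    rintro φ rfl h'
    exact X.res_refl _ _
  exact ((h2 _ hψ _).symm.trans (h1.trans (X.res_refl _ _))).symm

/-- The odd superderivation of the structure sheaf given by an action of `𝔸^{0|1}`. -/
def oddDerivation (ψ : Hom X.thicken X) (hψ : X.thickenZero.comp ψ = Hom.id X) :
    X.SheafDerivation 1 where
  toFun U :=
    { toFun := fun f => (oddPull ψ hψ U f).snd
      map_add' := fun f g => by rw [map_add]; rfl
      map_smul' := fun c f => by rw [map_smul]; rfl }
  map_res {U V} h f := by
    have := ψ.pull_res V V (Hom.mem_of_thickenZero_comp hψ V) U U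
      (Hom.mem_of_thickenZero_comp hψ U) h h f
    exact congrArg OddExt.snd this
  map_part U j f hf := by
    have h : (oddPull ψ hψ U f).snd ∈ X.part U (j + 1) :=
      (ψ.pull_part U U (Hom.mem_of_thickenZero_comp hψ U) j f hf).2
    rw [add_comm]
    exact h
  -- With pullbacks `f + θ Df` and `g + θ Dg`, the Leibniz rule is the coefficient of `θ` in their
  -- product.
  leibniz U f g := by
    simp only [LinearMap.coe_mk, AddHom.coe_mk, map_mul, OddExt.snd_mul, fst_oddPull, parityPow_one]
    exact add_comm _ _

/-- Equivariance of `φ` for the two actions, read off in the coefficient of `θ`. -/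
theorem oddDerivation_pull {ψ : Hom X.thicken X} (hψ : X.thickenZero.comp ψ = Hom.id X)
    {χ : Hom Y.thicken Y} (hχ : Y.thickenZero.comp χ = Hom.id Y) {φ : Hom X Y}
    (h : ψ.comp φ = (thickenMap φ).comp χ) (f : Y.sec ⊤) :
    (oddDerivation ψ hψ).toFun ⊤ (φ.gpull f) = φ.gpull ((oddDerivation χ hχ).toFun ⊤ f) := by
  have h1 := Hom.pull_comp ψ φ (⊤ : Opens X.carrier) ⊤ ⊤ (fun _ _ => trivial) (fun _ _ => trivial)
    (fun _ _ => trivial) f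
  have h2 := Hom.pull_comp (thickenMap φ) χ (⊤ : Opens X.carrier) (⊤ : Opens Y.carrier) ⊤
    (fun _ _ => trivial) (fun _ _ => trivial) (fun _ _ => trivial) f
  simp only [h] at h1
  exact congrArg OddExt.snd (h1.symm.trans h2)

theorem oddDerivation_pull_eq_zero {ψ : Hom X.thicken X} (hψ : X.thickenZero.comp ψ = Hom.id X)
    {φ : Hom X Y} (h : ψ.comp φ = X.thickenProj.comp φ) (f : Y.sec ⊤) :
    (oddDerivation ψ hψ).toFun ⊤ (φ.gpull f) = 0 := by
  have h1 := Hom.pull_comp ψ φ (⊤ : Opens X.carrier) ⊤ ⊤ (fun _ _ => trivial) (fun _ _ => trivial)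
    (fun _ _ => trivial) f
  have h2 := Hom.pull_comp X.thickenProj φ (⊤ : Opens X.carrier) ⊤ ⊤
    (fun _ _ => trivial) (fun _ _ => trivial) (fun _ _ => trivial) f
  simp only [h] at h1
  exact congrArg OddExt.snd (h1.symm.trans h2)

end Odd

/-! ### Even superderivations from actions of `𝔸^{0|2}` -/

section Even

variable {X Y : SuperSpace 𝕜}

/-- An open subset of `X`, as an open subset of `X × 𝔸^{0|1}`. -/
def thickenOpen (X : SuperSpace 𝕜) (U : Opens X.carrier) : Opens X.thicken.carrier := U

theorem fst_parity (U : Opens X.carrier) (z : OddExt (X.parity U)) :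
    OddExt.fst (σ := X.parity U) (X.thicken.parity (X.thickenOpen U) z) = X.parity U z.fst := by
  obtain ⟨a, ha, b, hb, h⟩ := X.thicken.exists_even_add_odd (U := X.thickenOpen U) z
  have e : z.fst = OddExt.fst (σ := X.parity U) a + OddExt.fst (σ := X.parity U) b :=
    congrArg OddExt.fst h
  have e' : X.thicken.parity (X.thickenOpen U) z = a + -b := by
    rw [h, map_add, X.thicken.parity_even ha, X.thicken.parity_odd hb]
  refine (congrArg (OddExt.fst (σ := X.parity U)) e').trans ?_
  have h1 : X.parity U (OddExt.fst (σ := X.parity U) a) = OddExt.fst (σ := X.parity U) a :=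
    X.parity_even ha.1
  have h2 : X.parity U (OddExt.fst (σ := X.parity U) b) = -OddExt.fst (σ := X.parity U) b :=
    X.parity_odd hb.1
  rw [e, map_add, h1, h2]
  rfl

/-- An action of `𝔸^{0|2}` that is trivial when one of the parameters vanishes. -/
structure IsEvenAction (ψ : Hom X.thicken.thicken X) : Prop where
  outer : X.thicken.thickenZero.comp ψ = X.thickenProj
  inner : (thickenMap X.thickenZero).comp ψ = X.thickenProj

theorem IsEvenAction.base_eq {ψ : Hom X.thicken.thicken X} (hψ : IsEvenAction ψ) (x : X.carrier) :
    ψ.base x = x :=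
  congrFun (congrArg Hom.base hψ.outer) x

theorem IsEvenAction.mem {ψ : Hom X.thicken.thicken X} (hψ : IsEvenAction ψ) (U : Opens X.carrier) :
    ∀ x ∈ U, ψ.base x ∈ U := fun x hx => by
  have h := hψ.base_eq x
  rwa [h]

/-- The pullback of sections over `U` along an action of `𝔸^{0|2}`. -/
def evenPull (ψ : Hom X.thicken.thicken X) (hψ : IsEvenAction ψ) (U : Opens X.carrier) :
    X.sec U →ₐ[𝕜] OddExt (X.thicken.parity (X.thickenOpen U)) :=
  ψ.pull U U (hψ.mem U)

theorem fst_evenPull {ψ : Hom X.thicken.thicken X} (hψ : IsEvenAction ψ) (U : Opens X.carrier)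
    (f : X.sec U) : (evenPull ψ hψ U f).fst = OddExt.inl (X.parity U) f := by
  have hU : ∀ x ∈ U, ψ.base x ∈ U := hψ.mem U
  have h1 := Hom.pull_comp X.thicken.thickenZero ψ U U U hU (fun _ hx => hx) hU f
  have h2 : ∀ (φ : Hom X.thicken X) (h : φ = X.thickenProj) (h' : ∀ x ∈ U, φ.base x ∈ U),
      φ.pull U U h' f = OddExt.inl (X.parity U) f := by
    rintro φ rfl h'
    exact congrArg (OddExt.inl (X.parity U)) (X.res_refl _ _)
  exact ((h2 _ hψ.outer _).symm.trans (h1.trans (X.thicken.res_refl (U := X.thickenOpen U) _ _))).symm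

theorem fst_snd_evenPull {ψ : Hom X.thicken.thicken X} (hψ : IsEvenAction ψ) (U : Opens X.carrier)
    (f : X.sec U) : OddExt.fst (σ := X.parity U) (evenPull ψ hψ U f).snd = 0 := by
  have hU : ∀ x ∈ U, ψ.base x ∈ U := hψ.mem U
  have h1 := Hom.pull_comp (thickenMap X.thickenZero) ψ U U U hU (fun _ hx => hx) hU f
  have h2 : ∀ (φ : Hom X.thicken X) (h : φ = X.thickenProj) (h' : ∀ x ∈ U, φ.base x ∈ U),
      φ.pull U U h' f = OddExt.inl (X.parity U) f := by
    rintro φ rfl h'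
    exact congrArg (OddExt.inl (X.parity U)) (X.res_refl _ _)
  have h3 := congrArg (OddExt.snd (σ := X.parity U)) ((h2 _ hψ.inner _).symm.trans h1)
  exact ((X.res_refl (U := U) _ _).symm.trans h3.symm)

/-- The coefficient of the product of the two parameters in the pullback along an action of
`𝔸^{0|2}`. -/
def evenCoeff (ψ : Hom X.thicken.thicken X) (hψ : IsEvenAction ψ) (U : Opens X.carrier)
    (f : X.sec U) : X.sec U :=
  OddExt.snd (σ := X.parity U) (evenPull ψ hψ U f).snd

/-- Each of the two conditions in `IsEvenAction` eliminates the terms that involve only one of the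
parameters; the constant term and the coefficient of their product remain. -/
theorem evenPull_eq {ψ : Hom X.thicken.thicken X} (hψ : IsEvenAction ψ) (U : Opens X.carrier)
    (f : X.sec U) : evenPull ψ hψ U f =
      ⟨OddExt.inl (X.parity U) f, (⟨0, evenCoeff ψ hψ U f⟩ : OddExt (X.parity U))⟩ :=
  OddExt.ext (fst_evenPull hψ U f)
    (OddExt.ext (σ := X.parity U) (fst_snd_evenPull hψ U f) rfl)

/-- The even superderivation of the structure sheaf given by an action of `𝔸^{0|2}`. -/
def evenDerivation (ψ : Hom X.thicken.thicken X) (hψ : IsEvenAction ψ) : X.SheafDerivation 0 where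
  toFun U :=
    { toFun := evenCoeff ψ hψ U
      map_add' := fun f g => by rw [evenCoeff, map_add]; rfl
      map_smul' := fun c f => by rw [evenCoeff, map_smul]; rfl }
  map_res {U V} h f := by
    have := ψ.pull_res V V (hψ.mem V) U U (hψ.mem U) h h f
    exact congrArg (fun z : OddExt (X.thicken.parity (X.thickenOpen U)) =>
      OddExt.snd (σ := X.parity U) z.snd) this
  map_part U j f hf := by
    have h := (ψ.pull_part U U (hψ.mem U) j f hf).2.2
    rw [add_assoc, (by decide : (1 : ZMod 2) + 1 = 0), add_zero] at h
    rw [zero_add]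
    exact h
  leibniz U f g := by
    have h : evenCoeff ψ hψ U (f * g) = evenCoeff ψ hψ U f * g + f * evenCoeff ψ hψ U g := by
      rw [evenCoeff, map_mul, evenPull_eq hψ U f, evenPull_eq hψ U g, OddExt.snd_mul]
      let P : OddExt (X.parity U) := X.thicken.parity (X.thickenOpen U) (OddExt.inl (X.parity U) f)
      have hP : P.fst = X.parity U f := fst_parity U _
      -- Both odd parameters have to pass `f`, so it is twisted twice by the parity involution. The
      -- twists cancel, which leaves a Leibniz rule without sign.
      change X.parity U P.fst * evenCoeff ψ hψ U g + P.snd * 0 +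
        (X.parity U 0 * 0 + evenCoeff ψ hψ U f * g) = _
      rw [hP, X.parity_parity, mul_zero, mul_zero, zero_add, add_zero, add_comm]
    exact h

theorem evenDerivation_pull {ψ : Hom X.thicken.thicken X} (hψ : IsEvenAction ψ)
    {χ : Hom Y.thicken.thicken Y} (hχ : IsEvenAction χ) {φ : Hom X Y}
    (h : ψ.comp φ = (thickenMap (thickenMap φ)).comp χ) (f : Y.sec ⊤) :
    (evenDerivation ψ hψ).toFun ⊤ (φ.gpull f) = φ.gpull ((evenDerivation χ hχ).toFun ⊤ f) := by
  have h1 := Hom.pull_comp ψ φ (⊤ : Opens X.carrier) ⊤ ⊤ (fun _ _ => trivial) (fun _ _ => trivial)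
    (fun _ _ => trivial) f
  have h2 := Hom.pull_comp (thickenMap (thickenMap φ)) χ (⊤ : Opens X.carrier)
    (⊤ : Opens Y.carrier) ⊤
    (fun _ _ => trivial) (fun _ _ => trivial) (fun _ _ => trivial) f
  simp only [h] at h1
  exact congrArg (fun z : OddExt (X.thicken.parity (X.thickenOpen ⊤)) =>
      OddExt.snd (σ := X.parity ⊤) z.snd) (h1.symm.trans h2)

/-- If `φ` does not see the action, the pullback involves no parameters at all. -/
theorem evenDerivation_pull_eq_zero {ψ : Hom X.thicken.thicken X} (hψ : IsEvenAction ψ)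
    {φ : Hom X Y} (h : ψ.comp φ = (X.thicken.thickenProj.comp X.thickenProj).comp φ)
    (f : Y.sec ⊤) :
    (evenDerivation ψ hψ).toFun ⊤ (φ.gpull f) = 0 := by
  have h1 := Hom.pull_comp ψ φ (⊤ : Opens X.carrier) ⊤ ⊤ (fun _ _ => trivial) (fun _ _ => trivial)
    (fun _ _ => trivial) f
  have h2 := Hom.pull_comp (X.thicken.thickenProj.comp X.thickenProj) φ (⊤ : Opens X.carrier) ⊤ ⊤
    (fun _ _ => trivial) (fun _ _ => trivial) (fun _ _ => trivial) f
  simp only [h] at h1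
  exact congrArg (fun z : OddExt (X.thicken.parity (X.thickenOpen ⊤)) =>
      OddExt.snd (σ := X.parity ⊤) z.snd) (h1.symm.trans h2)

end Even

end SuperSpace

/-! ## Affine supermanifolds and tangent vectors -/

/-- The affine superspace as a supermanifold. -/
def affineSupermanifold (𝕜 : Type) [RCLike 𝕜] (p q : ℕ) : Supermanifold 𝕜 where
  toSuperSpace := affineSuperspace 𝕜 p q
  exists_chart x := ⟨p, q,
    { base := OpenPartialHomeomorph.refl _
      iso := fun W hW => AlgEquiv.ofAlgHom
        ((affineSuperspace 𝕜 p q).res fun y hy => hy.2)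
        ((affineSuperspace 𝕜 p q).res fun y hy => ⟨trivial, hy⟩) (by ext; rfl) (by ext; rfl)
      iso_part := fun W hW i f hf y => hf _
      iso_res := fun W hW W' hW' h f => rfl }, trivial⟩

/-- A tangent vector of parity `i` at `x`: a point derivation. -/
structure TangentVector {𝕜 : Type} [RCLike 𝕜] (M : Supermanifold 𝕜) (x : M.carrier) (i : ZMod 2) where
  der : ∀ V : Opens M.carrier, x ∈ V → M.sec V →ₗ[𝕜] 𝕜
  der_res : ∀ (V V' : Opens M.carrier) (h : V' ≤ V) (hx : x ∈ V') (f : M.sec V),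
    der V' hx (M.res h f) = der V (h hx) f
  der_part : ∀ (V : Opens M.carrier) (hx : x ∈ V) (f : M.sec V), f ∈ M.part V (i + 1) →
    der V hx f = 0
  -- No sign occurs for either parity, since an odd section has value zero at every point.
  leibniz : ∀ (V : Opens M.carrier) (hx : x ∈ V) (f g : M.sec V),
    der V hx (f * g) = M.evalAt x V hx f * der V hx g + der V hx f * M.evalAt x V hx g

namespace TangentVector

variable {𝕜 : Type} [RCLike 𝕜] {M : Supermanifold 𝕜} {x : M.carrier} {i : ZMod 2}

theorem der_one (t : TangentVector M x i) (V : Opens M.carrier) (hx : x ∈ V) :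
    t.der V hx 1 = 0 := by
  have h := t.leibniz V hx 1 1
  simpa using h

theorem der_algebraMap (t : TangentVector M x i) (V : Opens M.carrier) (hx : x ∈ V) (c : 𝕜) :
    t.der V hx (algebraMap 𝕜 _ c) = 0 := by
  rw [Algebra.algebraMap_eq_smul_one, map_smul, der_one, smul_zero]

/-- The first jet along an odd tangent vector. -/
def oddJet (t : TangentVector M x i) {R : Type} [Ring R] [Algebra 𝕜 R] (σ : R →ₐ[𝕜] R)
    (V : Opens M.carrier) (hx : x ∈ V) : M.sec V →ₐ[𝕜] OddExt σ where
  toFun f := ⟨algebraMap 𝕜 R (M.evalAt x V hx f), algebraMap 𝕜 R (t.der V hx f)⟩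
  map_one' := by ext <;> simp [t.der_one]
  map_zero' := by ext <;> simp
  map_add' f g := by ext <;> simp
  map_mul' f g := by ext <;> simp [t.leibniz]
  commutes' c := by ext <;> simp [t.der_algebraMap]

/-- The first jet along an even tangent vector. -/
def evenJet (t : TangentVector M x i) {R : Type} [Ring R] [Algebra 𝕜 R] (σ : R →ₐ[𝕜] R)
    (τ : OddExt σ →ₐ[𝕜] OddExt σ) (V : Opens M.carrier) (hx : x ∈ V) :
    M.sec V →ₐ[𝕜] OddExt τ where
  -- The product of the two odd parameters is even and has square zero, so it serves as the
  -- infinitesimal parameter of an even vector.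
  toFun f := ⟨algebraMap 𝕜 (OddExt σ) (M.evalAt x V hx f), ⟨0, algebraMap 𝕜 R (t.der V hx f)⟩⟩
  map_one' := by ext <;> simp [t.der_one]
  map_zero' := by ext <;> simp
  map_add' f g := by ext <;> simp
  map_mul' f g := by ext <;> simp [t.leibniz]
  commutes' c := by ext <;> simp [t.der_algebraMap]

theorem algebraMap_mem_part (N : SuperSpace 𝕜) (U : Opens N.carrier) (c : 𝕜) :
    algebraMap 𝕜 (N.sec U) c ∈ N.part U 0 := by
  rw [Algebra.algebraMap_eq_smul_one]
  exact Submodule.smul_mem _ _ (N.one_mem_part U)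

/-- The morphism `N × 𝔸^{0|1} → M` given by an odd tangent vector of `M`. -/
def oddCurve (t : TangentVector M x 1) (N : Supermanifold 𝕜) : (thickenFunctor 𝕜).obj N ⟶ M :=
  SuperSpace.homOfPoint N.toSuperSpace.thicken M.toSuperSpace x
    (fun (U : Opens N.carrier) V hx => t.oddJet (N.parity U) V hx)
    (fun (U : Opens N.carrier) V hx i f hf => by
      rcases zmod_two_cases i with rfl | rfl
      · have h := t.der_part V hx f hf
        refine ⟨algebraMap_mem_part N.toSuperSpace U _, ?_⟩
        change algebraMap 𝕜 (N.sec U) (t.der V hx f) ∈ _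
        rw [h, map_zero]
        exact Submodule.zero_mem (N.part U _)
      · have h := M.evalAt_odd V hx hf
        refine ⟨?_, algebraMap_mem_part N.toSuperSpace U _⟩
        change algebraMap 𝕜 (N.sec U) (M.evalAt x V hx f) ∈ _
        rw [h, map_zero]
        exact Submodule.zero_mem (N.part U _))
    (fun (U U' : Opens N.carrier) V V' hx hx' (hU : U' ≤ U) hV f => by
      refine OddExt.ext ?_ ?_
      · change algebraMap 𝕜 (N.sec U') (M.evalAt x V' hx' (M.res hV f)) =
          N.res hU (algebraMap 𝕜 (N.sec U) (M.evalAt x V hx f))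
        rw [M.evalAt_res, AlgHom.commutes]
      · change algebraMap 𝕜 (N.sec U') (t.der V' hx' (M.res hV f)) =
          N.res hU (algebraMap 𝕜 (N.sec U) (t.der V hx f))
        rw [t.der_res, AlgHom.commutes])

theorem oddCurve_pull (t : TangentVector M x 1) (N : Supermanifold 𝕜) (U : Opens N.carrier)
    (V : Opens M.carrier) (h) (hx : x ∈ V) (f : M.sec V) :
    SuperSpace.Hom.pull (t.oddCurve N) U V h f = t.oddJet (N.parity U) V hx f :=
  SuperSpace.homOfPoint_pull _ _ _ (id U : Opens N.toSuperSpace.thicken.carrier) V h hx f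

/-- The morphism `N × 𝔸^{0|2} → M` given by an even tangent vector of `M`. -/
def evenCurve (t : TangentVector M x 0) (N : Supermanifold 𝕜) :
    (thickenFunctor 𝕜 ⋙ thickenFunctor 𝕜).obj N ⟶ M :=
  SuperSpace.homOfPoint N.toSuperSpace.thicken.thicken M.toSuperSpace x
    (fun (U : Opens N.carrier) V hx => t.evenJet (N.parity U)
      (N.thicken.parity (N.thickenOpen U)) V hx)
    (fun (U : Opens N.carrier) V hx i f hf => by
      rcases zmod_two_cases i with rfl | rfl
      · refine ⟨⟨?_, ?_⟩, ⟨Submodule.zero_mem (N.part U _), algebraMap_mem_part N.toSuperSpace U _⟩⟩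
        · change OddExt.fst (algebraMap 𝕜 (OddExt (N.parity U)) _) ∈ _
          rw [OddExt.fst_algebraMap]
          exact algebraMap_mem_part N.toSuperSpace U _
        · change OddExt.snd (algebraMap 𝕜 (OddExt (N.parity U)) _) ∈ _
          rw [OddExt.snd_algebraMap]
          exact Submodule.zero_mem (N.part U _)
      · have h := M.evalAt_odd V hx hf
        have h' := t.der_part V hx f (by rwa [zero_add])
        refine ⟨⟨?_, ?_⟩, ⟨Submodule.zero_mem (N.part U _), ?_⟩⟩
        · change OddExt.fst (algebraMap 𝕜 (OddExt (N.parity U)) (M.evalAt x V hx f)) ∈ _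
          rw [h, map_zero]
          exact Submodule.zero_mem (N.part U _)
        · change OddExt.snd (algebraMap 𝕜 (OddExt (N.parity U)) (M.evalAt x V hx f)) ∈ _
          rw [h, map_zero]
          exact Submodule.zero_mem (N.part U _)
        · change algebraMap 𝕜 (N.sec U) (t.der V hx f) ∈ _
          rw [h', map_zero]
          exact Submodule.zero_mem (N.part U _))
    (fun (U U' : Opens N.carrier) V V' hx hx' (hU : U' ≤ U) hV f => by
      refine OddExt.ext ?_ (OddExt.ext (σ := N.parity U') (map_zero (N.res hU)).symm ?_)
      · change algebraMap 𝕜 (OddExt (N.parity U')) (M.evalAt x V' hx' (M.res hV f)) =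
          N.thicken.res (U := N.thickenOpen U') (V := N.thickenOpen U) hU
            (algebraMap 𝕜 (N.thicken.sec (N.thickenOpen U)) (M.evalAt x V hx f))
        rw [M.evalAt_res, AlgHom.commutes]
        rfl
      · change algebraMap 𝕜 (N.sec U') (t.der V' hx' (M.res hV f)) =
          N.res hU (algebraMap 𝕜 (N.sec U) (t.der V hx f))
        rw [t.der_res, AlgHom.commutes])

theorem evenCurve_pull (t : TangentVector M x 0) (N : Supermanifold 𝕜) (U : Opens N.carrier)
    (V : Opens M.carrier) (h) (hx : x ∈ V) (f : M.sec V) :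
    SuperSpace.Hom.pull (t.evenCurve N) U V h f = t.evenJet (N.parity U)
      (N.thicken.parity (N.thickenOpen U)) V hx f :=
  SuperSpace.homOfPoint_pull _ _ _ (id U : Opens N.toSuperSpace.thicken.thicken.carrier) V h hx f

/-- The coefficients of the jet are constants, and these are fixed by every pullback; so the curve
is natural in the auxiliary supermanifold. -/
theorem map_oddCurve (t : TangentVector M x 1) {N N' : Supermanifold 𝕜} (φ : N' ⟶ N) :
    (thickenFunctor 𝕜).map φ ≫ t.oddCurve N = t.oddCurve N' := by
  refine SuperSpace.hom_ext_of_base_eq (x := x) (fun _ => rfl) (fun _ => rfl)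
    fun (U : Opens N'.carrier) V h h' hx f => ?_
  refine (SuperSpace.Hom.pull_comp (SuperSpace.thickenMap φ) (t.oddCurve N) U (⊤ : Opens N.carrier)
    V h (fun _ _ => trivial) (fun _ _ => hx) f).trans ?_
  refine (congrArg _ (t.oddCurve_pull N ⊤ V (fun _ _ => hx) hx f)).trans ?_
  refine Eq.trans ?_ (t.oddCurve_pull N' U V h' hx f).symm
  exact OddExt.ext (AlgHom.commutes (SuperSpace.Hom.pull φ U ⊤ fun _ _ => trivial) _)
    (AlgHom.commutes (SuperSpace.Hom.pull φ U ⊤ fun _ _ => trivial) _)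

theorem map_evenCurve (t : TangentVector M x 0) {N N' : Supermanifold 𝕜} (φ : N' ⟶ N) :
    (thickenFunctor 𝕜 ⋙ thickenFunctor 𝕜).map φ ≫ t.evenCurve N = t.evenCurve N' := by
  refine SuperSpace.hom_ext_of_base_eq (x := x) (fun _ => rfl) (fun _ => rfl)
    fun (U : Opens N'.carrier) V h h' hx f => ?_
  refine (SuperSpace.Hom.pull_comp (SuperSpace.thickenMap (SuperSpace.thickenMap φ))
    (t.evenCurve N) U (⊤ : Opens N.carrier)
    V h (fun _ _ => trivial) (fun _ _ => hx) f).trans ?_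
  refine (congrArg _ (t.evenCurve_pull N ⊤ V (fun _ _ => hx) hx f)).trans ?_
  refine Eq.trans ?_ (t.evenCurve_pull N' U V h' hx f).symm
  refine OddExt.ext ?_ (OddExt.ext (σ := N'.parity U)
    (map_zero (SuperSpace.Hom.pull φ U ⊤ fun _ _ => trivial))
    (AlgHom.commutes (SuperSpace.Hom.pull φ U ⊤ fun _ _ => trivial) _))
  exact AlgHom.commutes (SuperSpace.Hom.pull (SuperSpace.thickenMap φ) (N'.thickenOpen U) ⊤
    fun _ _ => trivial) _

theorem zero_oddCurve (t : TangentVector M x 1) (N : Supermanifold 𝕜) :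
    (thickenZeroSection 𝕜).app N ≫ t.oddCurve N = Supermanifold.pointHom N M x := by
  refine SuperSpace.hom_ext_of_base_eq (x := x) (fun _ => rfl) (fun _ => rfl)
    fun (U : Opens N.carrier) V h h' hx f => ?_
  refine (SuperSpace.Hom.pull_comp N.thickenZero (t.oddCurve N) U U
    V h (fun _ h => h) (fun _ _ => hx) f).trans ?_
  refine (congrArg _ (t.oddCurve_pull N U V (fun _ _ => hx) hx f)).trans ?_
  refine Eq.trans ?_ (Supermanifold.pointHom_pull N M x U V h' hx f).symm
  exact N.res_refl _ _

/-- Together with `zero_evenCurve'` this says that the curve rests at `x` once either parameter is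
set to zero, which yields both conditions of `IsEvenAction`. -/
theorem zero_evenCurve (t : TangentVector M x 0) (N : Supermanifold 𝕜) :
    (thickenZeroSection 𝕜).app ((thickenFunctor 𝕜).obj N) ≫ t.evenCurve N =
      Supermanifold.pointHom _ M x := by
  refine SuperSpace.hom_ext_of_base_eq (x := x) (fun _ => rfl) (fun _ => rfl)
    fun (U : Opens N.carrier) V h h' hx f => ?_
  refine (SuperSpace.Hom.pull_comp N.thicken.thickenZero (t.evenCurve N) U U
    V h (fun _ h => h) (fun _ _ => hx) f).trans ?_
  refine (congrArg _ (t.evenCurve_pull N U V (fun _ _ => hx) hx f)).trans ?_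
  refine Eq.trans ?_ (Supermanifold.pointHom_pull ((thickenFunctor 𝕜).obj N) M x
    (N.thickenOpen U) V h' hx f).symm
  exact N.thicken.res_refl (U := N.thickenOpen U) _ _

theorem zero_evenCurve' (t : TangentVector M x 0) (N : Supermanifold 𝕜) :
    (thickenFunctor 𝕜).map ((thickenZeroSection 𝕜).app N) ≫ t.evenCurve N =
      Supermanifold.pointHom _ M x := by
  refine SuperSpace.hom_ext_of_base_eq (x := x) (fun _ => rfl) (fun _ => rfl)
    fun (U : Opens N.carrier) V h h' hx f => ?_
  refine (SuperSpace.Hom.pull_comp (SuperSpace.thickenMap N.thickenZero) (t.evenCurve N) U U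
    V h (fun _ h => h) (fun _ _ => hx) f).trans ?_
  refine (congrArg _ (t.evenCurve_pull N U V (fun _ _ => hx) hx f)).trans ?_
  refine Eq.trans ?_ (Supermanifold.pointHom_pull ((thickenFunctor 𝕜).obj N) M x
    (N.thickenOpen U) V h' hx f).symm
  have e := (OddExt.fst_algebraMap (σ := N.parity U) (M.evalAt x V hx f))
  have e' := (OddExt.snd_algebraMap (σ := N.parity U) (M.evalAt x V hx f))
  refine OddExt.ext (σ := N.parity U) ?_ ?_
  · exact (congrArg _ e).trans ((N.res_refl _ _).trans e.symm)
  · exact (map_zero (N.res (le_refl U))).trans e'.symm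

end TangentVector

/-! ## Right-invariant vector fields with a given value at the neutral element -/

namespace LieSupergroup

variable {𝕜 : Type} [RCLike 𝕜] (G : LieSupergroup 𝕜)

/-- The morphism `S → G × G` with given components. -/
def pair {S : Supermanifold 𝕜} (a b : S ⟶ G.space) : S ⟶ G.prod :=
  G.isProduct.lift (BinaryFan.mk a b)

theorem pair_fst {S : Supermanifold 𝕜} (a b : S ⟶ G.space) : G.pair a b ≫ G.fst = a :=
  G.isProduct.fac (BinaryFan.mk a b) ⟨WalkingPair.left⟩

theorem pair_snd {S : Supermanifold 𝕜} (a b : S ⟶ G.space) : G.pair a b ≫ G.snd = b :=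
  G.isProduct.fac (BinaryFan.mk a b) ⟨WalkingPair.right⟩

theorem prod_hom_ext {S : Supermanifold 𝕜} {f g : S ⟶ G.prod} (h₁ : f ≫ G.fst = g ≫ G.fst)
    (h₂ : f ≫ G.snd = g ≫ G.snd) : f = g :=
  BinaryFan.IsLimit.hom_ext G.isProduct h₁ h₂

/-- The product of two `S`-valued points. -/
def pmul {S : Supermanifold 𝕜} (a b : S ⟶ G.space) : S ⟶ G.space := G.pair a b ≫ G.mul

theorem comp_pair {S S' : Supermanifold 𝕜} (φ : S' ⟶ S) (a b : S ⟶ G.space) :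
    φ ≫ G.pair a b = G.pair (φ ≫ a) (φ ≫ b) := by
  refine G.prod_hom_ext ?_ ?_
  · rw [Category.assoc, pair_fst, pair_fst]
  · rw [Category.assoc, pair_snd, pair_snd]

theorem comp_pmul {S S' : Supermanifold 𝕜} (φ : S' ⟶ S) (a b : S ⟶ G.space) :
    φ ≫ G.pmul a b = G.pmul (φ ≫ a) (φ ≫ b) := by
  rw [pmul, pmul, ← comp_pair, Category.assoc]

theorem pair_eta {S : Supermanifold 𝕜} (φ : S ⟶ G.prod) :
    G.pair (φ ≫ G.fst) (φ ≫ G.snd) = φ :=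
  G.prod_hom_ext (G.pair_fst _ _) (G.pair_snd _ _)

/-- The point of `G.pt`. -/
def ptPoint : G.pt.carrier :=
  SuperSpace.Hom.base (G.isTerminal.from (affineSupermanifold 𝕜 0 0))
    (0 : EuclideanSpace ℝ (Fin 0))

/-- The point of `G₀` given by a morphism from the terminal object. -/
def pointOf (g : G.pt ⟶ G.space) : G.space.carrier := SuperSpace.Hom.base g G.ptPoint

/-- The neutral element of `G₀`. -/
def unit : G.space.carrier := G.pointOf G.one

/-- The constant morphism to `G.ptPoint` is a morphism into the terminal object, hence the only one.
The group axioms can therefore be rewritten with constant morphisms `pointHom`. -/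
theorem from_comp (S : Supermanifold 𝕜) (g : G.pt ⟶ G.space) :
    G.isTerminal.from S ≫ g = Supermanifold.pointHom S G.space (G.pointOf g) := by
  rw [G.isTerminal.hom_ext (G.isTerminal.from S) (Supermanifold.pointHom S G.pt G.ptPoint),
    Supermanifold.pointHom_comp]
  rfl

theorem pmul_assoc {S : Supermanifold 𝕜} (a b c : S ⟶ G.space) :
    G.pmul (G.pmul a b) c = G.pmul a (G.pmul b c) := G.mul_assoc a b c

theorem unit_pmul {S : Supermanifold 𝕜} (a : S ⟶ G.space) :
    G.pmul (Supermanifold.pointHom S G.space G.unit) a = a := by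
  rw [unit, ← from_comp]
  exact G.one_mul a

theorem pmul_unit {S : Supermanifold 𝕜} (a : S ⟶ G.space) :
    G.pmul a (Supermanifold.pointHom S G.space G.unit) = a := by
  rw [unit, ← from_comp]
  exact G.mul_one a

theorem inv_pmul {S : Supermanifold 𝕜} (a : S ⟶ G.space) :
    G.pmul (a ≫ G.inv) a = Supermanifold.pointHom S G.space G.unit := by
  rw [unit, ← from_comp]
  exact G.inv_mul a

theorem pmul_inv {S : Supermanifold 𝕜} (a : S ⟶ G.space) :
    G.pmul a (a ≫ G.inv) = Supermanifold.pointHom S G.space G.unit := by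
  rw [unit, ← from_comp]
  exact G.mul_inv a

/-! ### The left action of an infinitesimal curve on the group -/

section Action

variable {T : Supermanifold 𝕜 ⥤ Supermanifold 𝕜} (π : T ⟶ 𝟭 _)
  (γ : ∀ N : Supermanifold 𝕜, T.obj N ⟶ G.space)

/-- The action on `G` of a curve in `G`. -/
def curveAction : T.obj G.space ⟶ G.space := G.pmul (γ _) (π.app G.space)

/-- The action on the first factor of `G × G` of a curve in `G`. -/
def curveActionProd : T.obj G.prod ⟶ G.prod :=
  G.pair (G.pmul (γ _) (π.app G.prod ≫ G.fst)) (π.app G.prod ≫ G.snd)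

/-- Where the curve rests at the neutral element, multiplication by it does nothing. -/
theorem comp_curveAction {S : Supermanifold 𝕜} (z : S ⟶ T.obj G.space)
    (hz : z ≫ γ G.space = Supermanifold.pointHom S G.space G.unit) :
    z ≫ G.curveAction π γ = z ≫ π.app G.space := by
  rw [curveAction, comp_pmul, hz, unit_pmul]

theorem comp_curveActionProd {S : Supermanifold 𝕜} (z : S ⟶ T.obj G.prod)
    (hz : z ≫ γ G.prod = Supermanifold.pointHom S G.space G.unit) :
    z ≫ G.curveActionProd π γ = z ≫ π.app G.prod := by
  rw [curveActionProd, comp_pair, comp_pmul, hz, unit_pmul, ← Category.assoc, ← Category.assoc,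
    pair_eta]

theorem curveActionProd_snd : G.curveActionProd π γ ≫ G.snd = π.app G.prod ≫ G.snd :=
  G.pair_snd _ _

theorem curveActionProd_fst
    (hγ : ∀ {N N' : Supermanifold 𝕜} (φ : N' ⟶ N), T.map φ ≫ γ N = γ N') :
    G.curveActionProd π γ ≫ G.fst = T.map G.fst ≫ G.curveAction π γ := by
  rw [curveActionProd, pair_fst, curveAction, comp_pmul, hγ, π.naturality]
  rfl

/-- Associativity, `(γ a) b = γ (a b)`: multiplication is equivariant when the curve acts on the
first factor. This is the source of right-invariance. -/
theorem curveActionProd_mul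
    (hγ : ∀ {N N' : Supermanifold 𝕜} (φ : N' ⟶ N), T.map φ ≫ γ N = γ N') :
    G.curveActionProd π γ ≫ G.mul = T.map G.mul ≫ G.curveAction π γ := by
  have e : G.pmul (π.app G.prod ≫ G.fst) (π.app G.prod ≫ G.snd) = π.app G.prod ≫ G.mul := by
    rw [pmul, pair_eta]
  have e' : G.curveActionProd π γ ≫ G.mul =
    G.pmul (G.pmul (γ _) (π.app G.prod ≫ G.fst)) (π.app G.prod ≫ G.snd) := rfl
  rw [e', pmul_assoc, e, curveAction, comp_pmul, hγ, π.naturality]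
  rfl

/-- Acting on the neutral element returns the curve itself; this identifies the value of the vector
field at that point. -/
theorem map_pointHom_curveAction
    (hγ : ∀ {N N' : Supermanifold 𝕜} (φ : N' ⟶ N), T.map φ ≫ γ N = γ N') (N : Supermanifold 𝕜) :
    T.map (Supermanifold.pointHom N G.space G.unit) ≫ G.curveAction π γ = γ N := by
  rw [curveAction, comp_pmul, hγ, π.naturality]
  have e : π.app N ≫ (𝟭 (Supermanifold 𝕜)).map (Supermanifold.pointHom N G.space G.unit) =
    Supermanifold.pointHom (T.obj N) G.space G.unit := Supermanifold.comp_pointHom _ _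
  rw [e, pmul_unit]

end Action

/-- The field is the coefficient of `θ` in the pullback along `(θ, x) ↦ γ(θ) x`. The extension to `G
× G` demanded by `IsRightInvariant` is the corresponding coefficient of the action on the first
factor. -/
theorem exists_rightInvariant_odd (t : TangentVector G.space G.unit 1) :
    ∃ D : G.space.SheafDerivation 1, G.IsRightInvariant 1 (D.toFun ⊤) ∧
      ∀ V (he : G.unit ∈ V) f, G.space.evalAt G.unit V he (D.toFun V f) = t.der V he f := by
  have hz : ∀ N, (thickenZeroSection 𝕜).app N ≫ t.oddCurve N =
      Supermanifold.pointHom N G.space G.unit := t.zero_oddCurve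
  have hn : ∀ {N N' : Supermanifold 𝕜} (φ : N' ⟶ N),
    (thickenFunctor 𝕜).map φ ≫ t.oddCurve N = t.oddCurve N' := t.map_oddCurve
  have h1 : (G.space.thickenZero).comp (G.curveAction (thickenProjection 𝕜) t.oddCurve) =
      SuperSpace.Hom.id G.space.toSuperSpace :=
    (G.comp_curveAction (thickenProjection 𝕜) t.oddCurve _ (hz _)).trans
      (thickenZeroSection_projection _)
  have h2 : (G.prod.thickenZero).comp (G.curveActionProd (thickenProjection 𝕜) t.oddCurve) =
      SuperSpace.Hom.id G.prod.toSuperSpace :=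
    (G.comp_curveActionProd (thickenProjection 𝕜) t.oddCurve _ (hz _)).trans
      (thickenZeroSection_projection _)
  refine ⟨SuperSpace.oddDerivation _ h1, ⟨SuperSpace.SheafDerivation.isSuperderivation _,
    (SuperSpace.oddDerivation _ h2).toFun ⊤, SuperSpace.SheafDerivation.isSuperderivation _,
    SuperSpace.oddDerivation_pull h2 h1 (G.curveActionProd_fst _ _ hn),
    SuperSpace.oddDerivation_pull_eq_zero h2 (G.curveActionProd_snd _ _),
    SuperSpace.oddDerivation_pull h2 h1 (G.curveActionProd_mul _ _ hn)⟩, fun V he f => ?_⟩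
  -- Precomposing the action with the constant morphism at the neutral element gives the curve;
  -- comparing the coefficients of `θ` on both sides computes the value of the field there.
  have key := G.map_pointHom_curveAction (thickenProjection 𝕜) t.oddCurve hn G.space
  have hV : ∀ x ∈ V, SuperSpace.Hom.base (G.curveAction (thickenProjection 𝕜) t.oddCurve) x ∈ V :=
    SuperSpace.Hom.mem_of_thickenZero_comp h1 V
  have e1 := SuperSpace.Hom.pull_comp
    (SuperSpace.thickenMap (Supermanifold.pointHom G.space G.space G.unit))
    (G.curveAction (thickenProjection 𝕜) t.oddCurve) (⊤ : Opens G.space.carrier) V V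
    (fun _ _ => hV _ he) (fun _ _ => he) hV f
  have e2 : ∀ (φ : (thickenFunctor 𝕜).obj G.space ⟶ G.space) (_ : φ = t.oddCurve G.space) (h),
      SuperSpace.Hom.pull φ (⊤ : Opens G.space.carrier) V h f =
        t.oddJet (G.space.parity ⊤) V he f := by
    rintro φ rfl h
    exact t.oddCurve_pull G.space ⊤ V h he f
  have e3 := congrArg (OddExt.snd (σ := G.space.parity ⊤)) ((e2 _ key _).symm.trans e1)
  have e4 := e3.trans (Supermanifold.pointHom_pull G.space G.space G.unit ⊤ V (fun _ _ => he) he _)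
  have e5 := congrArg (G.space.evalAt G.unit ⊤ trivial) e4
  have e6 := (AlgHom.commutes (G.space.evalAt G.unit ⊤ trivial) (t.der V he f)).symm.trans
    (e5.trans (AlgHom.commutes (G.space.evalAt G.unit ⊤ trivial) _))
  exact e6.symm

/-- As in the odd case, with two odd parameters. The dual numbers, which would be the obvious
parameter space for an even vector, do not come from a supermanifold, whereas `𝔸^{0|2}` does. -/
theorem exists_rightInvariant_even (t : TangentVector G.space G.unit 0) :
    ∃ D : G.space.SheafDerivation 0, G.IsRightInvariant 0 (D.toFun ⊤) ∧
      ∀ V (he : G.unit ∈ V) f, G.space.evalAt G.unit V he (D.toFun V f) = t.der V he f := by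
  let π : thickenFunctor 𝕜 ⋙ thickenFunctor 𝕜 ⟶ 𝟭 (Supermanifold 𝕜) :=
    { app := fun N => (thickenProjection 𝕜).app _ ≫ (thickenProjection 𝕜).app N
      naturality := fun N N' φ => by
        have h1 := (thickenProjection 𝕜).naturality ((thickenFunctor 𝕜).map φ)
        have h2 := (thickenProjection 𝕜).naturality φ
        exact (Category.assoc _ _ _).symm.trans ((congrArg (· ≫ _) h1).trans
          ((Category.assoc _ _ _).trans ((congrArg (_ ≫ ·) h2).trans (Category.assoc _ _ _).symm))) }
  have hz : ∀ N, (thickenZeroSection 𝕜).app ((thickenFunctor 𝕜).obj N) ≫ t.evenCurve N =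
      Supermanifold.pointHom _ G.space G.unit := t.zero_evenCurve
  have hz' : ∀ N, (thickenFunctor 𝕜).map ((thickenZeroSection 𝕜).app N) ≫ t.evenCurve N =
      Supermanifold.pointHom _ G.space G.unit := t.zero_evenCurve'
  have hn : ∀ {N N' : Supermanifold 𝕜} (φ : N' ⟶ N),
    (thickenFunctor 𝕜 ⋙ thickenFunctor 𝕜).map φ ≫ t.evenCurve N = t.evenCurve N' := t.map_evenCurve
  have hp : ∀ N, (thickenZeroSection 𝕜).app ((thickenFunctor 𝕜).obj N) ≫ π.app N =
      (thickenProjection 𝕜).app N := fun N =>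
    (Category.assoc _ _ _).symm.trans ((congrArg (· ≫ _) (thickenZeroSection_projection _)).trans
      (Category.id_comp _))
  have hp' : ∀ N, (thickenFunctor 𝕜).map ((thickenZeroSection 𝕜).app N) ≫ π.app N =
      (thickenProjection 𝕜).app N := fun N => by
    have h1 := (thickenProjection 𝕜).naturality ((thickenZeroSection 𝕜).app N)
    exact (Category.assoc _ _ _).symm.trans ((congrArg (· ≫ _) h1).trans
      ((Category.assoc _ _ _).trans ((congrArg (_ ≫ ·) (thickenZeroSection_projection N)).trans
        (Category.comp_id _))))
  have h1 : SuperSpace.IsEvenAction (X := G.space.toSuperSpace) (G.curveAction π t.evenCurve) :=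
    ⟨(G.comp_curveAction π t.evenCurve _ (hz _)).trans (hp _),
      (G.comp_curveAction π t.evenCurve _ (hz' _)).trans (hp' _)⟩
  have h2 : SuperSpace.IsEvenAction (X := G.prod.toSuperSpace) (G.curveActionProd π t.evenCurve) :=
    ⟨(G.comp_curveActionProd π t.evenCurve _ (hz _)).trans (hp _),
      (G.comp_curveActionProd π t.evenCurve _ (hz' _)).trans (hp' _)⟩
  refine ⟨SuperSpace.evenDerivation _ h1, ⟨SuperSpace.SheafDerivation.isSuperderivation _,
    (SuperSpace.evenDerivation _ h2).toFun ⊤, SuperSpace.SheafDerivation.isSuperderivation _,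
    SuperSpace.evenDerivation_pull h2 h1 (G.curveActionProd_fst _ _ hn),
    SuperSpace.evenDerivation_pull_eq_zero h2 (G.curveActionProd_snd _ _),
    SuperSpace.evenDerivation_pull h2 h1 (G.curveActionProd_mul _ _ hn)⟩, fun V he f => ?_⟩
  have key := G.map_pointHom_curveAction π t.evenCurve hn G.space
  have hV : ∀ x ∈ V, SuperSpace.Hom.base (G.curveAction π t.evenCurve) x ∈ V := h1.mem V
  have e1 := SuperSpace.Hom.pull_comp
    (SuperSpace.thickenMap (SuperSpace.thickenMap
      (Supermanifold.pointHom G.space G.space G.unit)))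
    (G.curveAction π t.evenCurve) (⊤ : Opens G.space.carrier) V V
    (fun _ _ => hV _ he) (fun _ _ => he) hV f
  have e2 : ∀ (φ : (thickenFunctor 𝕜 ⋙ thickenFunctor 𝕜).obj G.space ⟶ G.space)
      (_ : φ = t.evenCurve G.space) (h),
      SuperSpace.Hom.pull φ (⊤ : Opens G.space.carrier) V h f =
        t.evenJet (G.space.parity ⊤) (G.space.thicken.parity (G.space.thickenOpen ⊤)) V he f := by
    rintro φ rfl h
    exact t.evenCurve_pull G.space ⊤ V h he f
  have e3 := congrArg (fun z : OddExt (G.space.thicken.parity (G.space.thickenOpen ⊤)) =>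
    OddExt.snd (σ := G.space.parity ⊤) z.snd) ((e2 _ key _).symm.trans e1)
  have e4 := e3.trans (Supermanifold.pointHom_pull G.space G.space G.unit ⊤ V (fun _ _ => he) he _)
  have e5 := congrArg (G.space.evalAt G.unit ⊤ trivial) e4
  have e6 := (AlgHom.commutes (G.space.evalAt G.unit ⊤ trivial) (t.der V he f)).symm.trans
    (e5.trans (AlgHom.commutes (G.space.evalAt G.unit ⊤ trivial) _))
  exact e6.symm

/-- Every tangent vector at the neutral element extends to a right-invariant vector field. -/
theorem exists_rightInvariant {i : ZMod 2} (t : TangentVector G.space G.unit i) :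
    ∃ D : G.space.SheafDerivation i, G.IsRightInvariant i (D.toFun ⊤) ∧
      ∀ V (he : G.unit ∈ V) f, G.space.evalAt G.unit V he (D.toFun V f) = t.der V he f := by
  rcases zmod_two_cases i with rfl | rfl
  · exact G.exists_rightInvariant_even t
  · exact G.exists_rightInvariant_odd t

end LieSupergroup

/-! ## The underlying space of a Lie supergroup is a Hausdorff space -/

namespace SuperChart

variable {𝕜 : Type} [RCLike 𝕜] {p q n : ℕ} {M : Supermanifold 𝕜}

/-- The morphism from an affine space given by a smooth map to the image of a chart. -/
def paramHom (c : SuperChart M.toSuperSpace p q)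
    (s : EuclideanSpace ℝ (Fin n) → EuclideanSpace ℝ (Fin p)) (hs : ContDiff ℝ ∞ s)
    (hsc : ∀ y, s y ∈ c.base.target) : affineSupermanifold 𝕜 n 0 ⟶ M where
  base := fun y : EuclideanSpace ℝ (Fin n) => c.base.symm (s y)
  continuous_base := c.base.symm.continuousOn.comp_continuous hs.continuous hsc
  pull := fun (U : Opens (EuclideanSpace ℝ (Fin n))) V
      (h : ∀ y ∈ U, c.base.symm (s y) ∈ V) =>
    show M.sec V →ₐ[𝕜] superFunctions 𝕜 n 0 U from
    -- The odd coordinates are sent to zero, so only the body of the coordinate expression is pulled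
    -- back.
    { toFun := fun f => scalarSuperfunction 0
        (fun y : U => Grassmann.body 𝕜 q (c.pointValue (s y) V ⟨hsc y, h y y.2⟩ f)) (by
          refine ((contDiffOn_body (c.localCoord V f)).comp hs.contDiffOn
            (s := (U : Set (EuclideanSpace ℝ (Fin n))))
            fun y hy => mem_img_inf_dom ⟨hsc y, h y hy⟩).congr fun y hy => ?_
          rw [extendZero_apply (V := U) _ ⟨y, hy⟩]
          exact (extendZero_apply (V := c.img (V ⊓ c.dom))
            (fun y => Grassmann.body 𝕜 q ((c.localCoord V f).1 y))
            ⟨s y, mem_img_inf_dom ⟨hsc y, h y hy⟩⟩).symm)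
      map_one' := Subtype.ext (funext fun y => by simp [scalarSuperfunction])
      map_mul' := fun f g => Subtype.ext (funext fun y => by simp [scalarSuperfunction])
      map_zero' := Subtype.ext (funext fun y => by simp [scalarSuperfunction])
      map_add' := fun f g => Subtype.ext (funext fun y => by simp [scalarSuperfunction])
      commutes' := fun a => Subtype.ext (funext fun y => by
        change algebraMap 𝕜 (Grassmann 𝕜 0) (Grassmann.body 𝕜 q (c.pointValue (s y) V _
          (algebraMap 𝕜 _ a))) = algebraMap 𝕜 (Grassmann 𝕜 0) a
        rw [AlgHom.commutes, AlgHom.commutes]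
        rfl) }
  pull_part := fun (U : Opens (EuclideanSpace ℝ (Fin n))) V
      (h : ∀ y ∈ U, c.base.symm (s y) ∈ V) i f hf => fun y => by
    change algebraMap 𝕜 (Grassmann 𝕜 0) (Grassmann.body 𝕜 q (c.pointValue (s y.1) V
      ⟨hsc y.1, h y.1 y.2⟩ f)) ∈ _
    rcases zmod_two_cases i with rfl | rfl
    · rw [Algebra.algebraMap_eq_smul_one]
      exact Submodule.smul_mem _ _ (SetLike.GradedOne.one_mem (A := CliffordAlgebra.evenOdd _))
    · have e : algebraMap 𝕜 (Grassmann 𝕜 0) (Grassmann.body 𝕜 q (c.pointValue (s y.1) V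
          ⟨hsc y.1, h y.1 y.2⟩ f)) = 0 :=
        (congrArg _ (Grassmann.body_odd (c.pointValue_part _ _ _ hf))).trans (map_zero _)
      exact Eq.mpr (congrArg (· ∈ Grassmann.part 0 1) e) (Submodule.zero_mem _)
  pull_res := fun (U : Opens (EuclideanSpace ℝ (Fin n))) V h
      (U' : Opens (EuclideanSpace ℝ (Fin n))) V' h' hU hV f =>
    Subtype.ext (funext fun y => congrArg (fun z => algebraMap 𝕜 (Grassmann 𝕜 0)
      (Grassmann.body 𝕜 q z)) (c.pointValue_res (s y.1) hV ⟨hsc y.1, h' y.1 y.2⟩ f))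

end SuperChart

namespace Supermanifold

variable {𝕜 : Type} [RCLike 𝕜]

/-- A smooth parametrization of a neighbourhood of a point. -/
theorem exists_param (M : Supermanifold 𝕜) (x : M.carrier) :
    ∃ (p q : ℕ) (c : SuperChart M.toSuperSpace p q)
      (s : EuclideanSpace ℝ (Fin p) → EuclideanSpace ℝ (Fin p)), ContDiff ℝ ∞ s ∧
      (∀ y, s y ∈ c.base.target) ∧
      Filter.map (fun y => c.base.symm (s y)) (nhds 0) = nhds x ∧ c.base.symm (s 0) = x := by
  obtain ⟨p, q, c, hx⟩ := M.exists_chart x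
  obtain ⟨r, hr, hball⟩ := Metric.isOpen_iff.1 c.base.open_target _ (c.base.map_source hx)
  -- A diffeomorphism of `ℝ^p` onto a ball in the chart makes the parametrization defined on the
  -- whole affine space, so that it gives a morphism of supermanifolds.
  refine ⟨p, q, c, OpenPartialHomeomorph.univBall (c.base x) r,
    OpenPartialHomeomorph.contDiff_univBall, fun y => hball ?_, ?_, ?_⟩
  · rw [← OpenPartialHomeomorph.univBall_target (c.base x) hr]
    exact (OpenPartialHomeomorph.univBall (c.base x) r).map_source (by simp)
  · have h := ((OpenPartialHomeomorph.univBall (c.base x) r).trans c.base.symm).map_nhds_eq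
      (x := 0) (by
        rw [OpenPartialHomeomorph.trans_source]
        refine ⟨by simp, ?_⟩
        change OpenPartialHomeomorph.univBall (c.base x) r 0 ∈ c.base.target
        rw [OpenPartialHomeomorph.univBall_apply_zero]
        exact c.base.map_source hx)
    refine h.trans ?_
    change nhds (c.base.symm (OpenPartialHomeomorph.univBall (c.base x) r 0)) = _
    rw [OpenPartialHomeomorph.univBall_apply_zero, c.base.left_inv hx]
  · rw [OpenPartialHomeomorph.univBall_apply_zero, c.base.left_inv hx]

/-- The hypothesis puts `y` into a chart domain around `x`, and a chart separates the points of its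
domain. -/
theorem eq_of_forall_nhds_mem (M : Supermanifold 𝕜) {x y : M.carrier}
    (h : ∀ U ∈ nhds x, y ∈ U) : x = y := by
  obtain ⟨p, q, c, hx⟩ := M.exists_chart x
  by_contra hne
  have hy : y ∈ c.base.source := h _ (c.base.open_source.mem_nhds hx)
  have hc : c.base x ≠ c.base y := fun e => hne (c.base.injOn hx hy e)
  exact h _ ((c.base.continuousAt hx).preimage_mem_nhds (isOpen_ne.mem_nhds hc)) rfl

end Supermanifold

namespace LieSupergroup

variable {𝕜 : Type} [RCLike 𝕜] (G : LieSupergroup 𝕜)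

/-- Precomposition with the constant morphism at `s` turns `a` and `b` into points of the group,
where equality of the base points is equality of morphisms. -/
theorem base_pmul_inv_eq_unit {S : Supermanifold 𝕜} (a b : S ⟶ G.space) (s : S.carrier)
    (h : SuperSpace.Hom.base a s = SuperSpace.Hom.base b s) :
    SuperSpace.Hom.base (G.pmul (a ≫ G.inv) b) s = G.unit := by
  have h1 : Supermanifold.pointHom S S s ≫ G.pmul (a ≫ G.inv) b =
      Supermanifold.pointHom S G.space G.unit := by
    have h2 : Supermanifold.pointHom S S s ≫ a = Supermanifold.pointHom S S s ≫ b := by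
      rw [Supermanifold.pointHom_comp, Supermanifold.pointHom_comp, h]
    rw [comp_pmul, ← Category.assoc, h2, inv_pmul]
  exact congrFun (congrArg SuperSpace.Hom.base h1) s

theorem base_eq_of_pmul_inv_eq_unit {S : Supermanifold 𝕜} (a b : S ⟶ G.space) (s : S.carrier)
    (h : SuperSpace.Hom.base (G.pmul (a ≫ G.inv) b) s = G.unit) :
    SuperSpace.Hom.base a s = SuperSpace.Hom.base b s := by
  have h1 : Supermanifold.pointHom S S s ≫ G.pmul (a ≫ G.inv) b =
      Supermanifold.pointHom S G.space G.unit := by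
    rw [Supermanifold.pointHom_comp, h]
  have h2 : G.pmul (Supermanifold.pointHom S S s ≫ a)
      (Supermanifold.pointHom S S s ≫ G.pmul (a ≫ G.inv) b) =
      Supermanifold.pointHom S S s ≫ b := by
    rw [comp_pmul, ← pmul_assoc, ← Category.assoc, pmul_inv, unit_pmul]
  rw [h1, pmul_unit] at h2
  exact congrFun (congrArg SuperSpace.Hom.base h2) s

/-- In a topological group one would use that the diagonal is the preimage of `e` under `(x, y) ↦
x⁻¹ y`. The product topology on the underlying space of `G.prod` is not at hand, so this map is
tested on a product of two parameter spaces. -/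
theorem t2Space : T2Space G.space.carrier := by
  rw [t2_iff_nhds]
  intro x y hxy
  obtain ⟨p, q, c, s, hs, hsc, hsn, hs0⟩ := G.space.exists_param x
  obtain ⟨p', q', c', s', hs', hsc', hsn', hs0'⟩ := G.space.exists_param y
  let e : EuclideanSpace ℝ (Fin (p + p')) ≃L[ℝ]
    EuclideanSpace ℝ (Fin p) × EuclideanSpace ℝ (Fin p') := EuclideanSpace.finAddEquivProd
  -- Smooth families through `x` and `y`, depending on separate groups of the parameters.
  let a := c.paramHom (fun z : EuclideanSpace ℝ (Fin (p + p')) => s (e z).1)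
    (hs.comp (contDiff_fst.comp e.contDiff)) (fun z => hsc _)
  let b := c'.paramHom (fun z : EuclideanSpace ℝ (Fin (p + p')) => s' (e z).2)
    (hs'.comp (contDiff_snd.comp e.contDiff)) (fun z => hsc' _)
  let F : EuclideanSpace ℝ (Fin (p + p')) → G.space.carrier :=
    SuperSpace.Hom.base (G.pmul (a ≫ G.inv) b)
  have hF : Continuous F := SuperSpace.Hom.continuous_base (G.pmul (a ≫ G.inv) b)
  -- If the neighbourhoods of `x` and `y` always meet, there are parameters arbitrarily close to
  -- zero at which both families agree, and there `F` is the neutral element. By continuity the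
  -- latter lies in every neighbourhood of `F` at zero.
  have hz : F (e.symm 0) = G.unit := by
    refine G.space.eq_of_forall_nhds_mem fun U hU => ?_
    have hU' := (hF.comp e.symm.continuous).continuousAt.preimage_mem_nhds (x := 0) hU
    obtain ⟨A, hA, B, hB, hAB⟩ := mem_nhds_prod_iff.1 hU'
    have h1 : (fun y => c.base.symm (s y)) '' A ∈ nhds x := hsn ▸ Filter.image_mem_map hA
    have h2 : (fun y => c'.base.symm (s' y)) '' B ∈ nhds y := hsn' ▸ Filter.image_mem_map hB
    obtain ⟨w, ⟨u, hu, rfl⟩, ⟨v, hv, hw⟩⟩ := (Filter.inf_neBot_iff.1 hxy) h1 h2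
    have h3 : F (e.symm (u, v)) ∈ U := hAB (Set.mk_mem_prod hu hv)
    have h4 : F (e.symm (u, v)) = G.unit := by
      refine G.base_pmul_inv_eq_unit a b (e.symm (u, v) : EuclideanSpace ℝ (Fin (p + p'))) ?_
      change c.base.symm (s (e (e.symm (u, v))).1) = c'.base.symm (s' (e (e.symm (u, v))).2)
      rw [e.apply_symm_apply]
      exact hw.symm
    rwa [h4] at h3
  have h5 := G.base_eq_of_pmul_inv_eq_unit a b (e.symm 0 : EuclideanSpace ℝ (Fin (p + p'))) hz
  change c.base.symm (s (e (e.symm 0)).1) = c'.base.symm (s' (e (e.symm 0)).2) at h5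
  rw [e.apply_symm_apply] at h5
  rw [← hs0, ← hs0']
  exact h5

end LieSupergroup

/-! ## Derivations of superfunctions -/

/-- Hadamard's lemma. -/
theorem exists_smooth_sub_eq_sum {𝕜 : Type} [RCLike 𝕜] {p : ℕ} {V : Set (EuclideanSpace ℝ (Fin p))}
    (hV : IsOpen V) (hc : Convex ℝ V) {g : EuclideanSpace ℝ (Fin p) → 𝕜} (hg : ContDiffOn ℝ ∞ g V)
    {y : EuclideanSpace ℝ (Fin p)} (hy : y ∈ V) :
    ∃ h : Fin p → EuclideanSpace ℝ (Fin p) → 𝕜, (∀ k, ContDiffOn ℝ ∞ (h k) V) ∧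
      ∀ x ∈ V, g x = g y + ∑ k, ((x k - y k : ℝ) : 𝕜) * h k x := by
  -- A smooth step in place of the identity on `[0, 1]`: its derivative has compact support, so the
  -- usual integral over a segment becomes an integral over `ℝ` of a compactly supported integrand.
  let τ : ℝ → ℝ := Real.smoothTransition
  have hτ : ContDiff ℝ ∞ τ := Real.smoothTransition.contDiff
  have hτ' : ContDiff ℝ ∞ (deriv τ) := by
    have : ContDiff ℝ ((∞ : ℕ∞ω) + 1) τ := hτ
    exact (contDiff_succ_iff_deriv.1 this).2.2
  have hsupp : ∀ s, s ∉ Icc (0 : ℝ) 1 → deriv τ s = 0 := by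
    intro s hs
    have : τ =ᶠ[nhds s] fun _ => τ s := by
      rw [mem_Icc, not_and_or, not_le, not_le] at hs
      rcases hs with hs | hs
      · filter_upwards [Iio_mem_nhds hs] with t ht
        exact (Real.smoothTransition.zero_of_nonpos (le_of_lt ht)).trans
          (Real.smoothTransition.zero_of_nonpos hs.le).symm
      · filter_upwards [Ioi_mem_nhds hs] with t ht
        exact (Real.smoothTransition.one_of_one_le (le_of_lt ht)).trans
          (Real.smoothTransition.one_of_one_le hs.le).symm
    rw [this.deriv_eq, deriv_const]
  have hmem : ∀ x ∈ V, ∀ s, y + τ s • (x - y) ∈ V := fun x hx s =>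
    hc.add_smul_sub_mem hy hx ⟨Real.smoothTransition.nonneg s, Real.smoothTransition.le_one s⟩
  have hdg : ContDiffOn ℝ ∞ (fderiv ℝ g) V := hg.fderiv_of_isOpen hV le_rfl
  let F : Fin p → EuclideanSpace ℝ (Fin p) → ℝ → 𝕜 := fun k x s =>
    deriv τ s • fderiv ℝ g (y + τ s • (x - y)) (EuclideanSpace.single k 1)
  have hF : ∀ k, ContDiffOn ℝ ∞ (fun z : EuclideanSpace ℝ (Fin p) × ℝ => F k z.1 z.2)
      (V ×ˢ univ) := by
    intro k
    have h1 : ContDiffOn ℝ ∞ (fun z : EuclideanSpace ℝ (Fin p) × ℝ =>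
        fderiv ℝ g (y + τ z.2 • (z.1 - y))) (V ×ˢ univ) := by
      refine hdg.comp (ContDiff.contDiffOn ?_) fun z hz => hmem z.1 hz.1 z.2
      exact contDiff_const.add ((hτ.comp contDiff_snd).smul (contDiff_fst.sub contDiff_const))
    exact (hτ'.comp contDiff_snd).contDiffOn.smul (h1.clm_apply contDiffOn_const)
  refine ⟨fun k x => ∫ s, F k x s, fun k => ?_, fun x hx => ?_⟩
  -- The integral is the convolution at `0` of the constant `1` with the reflected integrand; this
  -- gives smooth dependence on the parameter `x`.
  · have := contDiffOn_convolution_right_with_param_comp (n := ⊤) (μ := (volume : Measure ℝ))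
      (ContinuousLinearMap.lsmul ℝ ℝ : ℝ →L[ℝ] 𝕜 →L[ℝ] 𝕜)
      (v := fun _ : EuclideanSpace ℝ (Fin p) => (0 : ℝ)) contDiffOn_const (f := fun _ : ℝ => (1 : ℝ))
      (g := fun x s => F k x (-s)) hV (isCompact_Icc (a := (-1 : ℝ)) (b := 0)) (fun x s _ hs => by
        have : -s ∉ Icc (0 : ℝ) 1 := fun h => hs ⟨by linarith [h.2], by linarith [h.1]⟩
        simp [F, hsupp _ this]) (locallyIntegrable_const 1)
      ((hF k).comp (contDiff_fst.prodMk contDiff_snd.neg).contDiffOn fun z hz => ⟨hz.1, trivial⟩)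
    refine this.congr fun x hx => ?_
    simp [convolution]
  · have hcont : ∀ k, Continuous (F k x) := fun k => by
      have := (hF k).continuousOn.comp_continuous
        (continuous_const.prodMk continuous_id : Continuous fun s : ℝ => (x, s))
        fun s => ⟨hx, trivial⟩
      exact this
    have hint : ∀ k, ∫ s, F k x s = ∫ s in (-1)..2, F k x s := fun k => by
      refine (intervalIntegral.integral_eq_integral_of_support_subset fun s hs => ?_).symm
      by_contra hcon
      refine hs ?_
      have : s ∉ Icc (0 : ℝ) 1 := fun h => hcon ⟨by linarith [h.1], by linarith [h.2]⟩
      simp [F, hsupp _ this]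
    have hder : ∀ s, HasDerivAt (fun s => g (y + τ s • (x - y)))
        (∑ k, ((x k - y k : ℝ) : 𝕜) * F k x s) s := by
      intro s
      have h1 : HasDerivAt (fun s => y + τ s • (x - y)) (deriv τ s • (x - y)) s :=
        (((hτ.differentiable (by simp)) s).hasDerivAt.smul_const (x - y)).const_add y
      have h2 : HasFDerivAt g (fderiv ℝ g (y + τ s • (x - y))) (y + τ s • (x - y)) :=
        ((hg.contDiffAt (hV.mem_nhds (hmem x hx s))).differentiableAt (by simp)).hasFDerivAt
      have h3 := h2.comp_hasDerivAt s h1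
      refine h3.congr_deriv ?_
      have h4 : x - y = ∑ k, (x k - y k) • EuclideanSpace.single k (1 : ℝ) := by
        ext j
        simp [Finset.sum_apply, Pi.single_apply]
      have h5 : fderiv ℝ g (y + τ s • (x - y)) (x - y) = fderiv ℝ g (y + τ s • (x - y))
        (∑ k, (x k - y k) • EuclideanSpace.single k (1 : ℝ)) := congrArg _ h4
      rw [map_smul, h5, map_sum, Finset.smul_sum]
      refine Finset.sum_congr rfl fun k _ => ?_
      rw [map_smul, ← RCLike.real_smul_eq_coe_mul, smul_comm]
    -- The interval from `-1` to `2` contains `[0, 1]`, and `τ` takes the values `0` and `1` at its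
    -- ends.
    have hFTC := intervalIntegral.integral_eq_sub_of_hasDerivAt (a := -1) (b := 2)
      (fun s _ => hder s) ((continuous_finsetSum _ fun k _ =>
        continuous_const.mul (hcont k)).intervalIntegrable _ _)
    have e1 : τ 2 = 1 := Real.smoothTransition.one_of_one_le (by norm_num)
    have e2 : τ (-1) = 0 := Real.smoothTransition.zero_of_nonpos (by norm_num)
    rw [e1, e2, one_smul, zero_smul, add_zero, add_sub_cancel, intervalIntegral.integral_finsetSum
      (f := fun k s => ((x k - y k : ℝ) : 𝕜) * F k x s)
      (fun k _ => (continuous_const.mul (hcont k)).intervalIntegrable _ _)] at hFTC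
    rw [eq_add_of_sub_eq' hFTC.symm]
    congr 1
    refine Finset.sum_congr rfl fun k _ => ?_
    rw [intervalIntegral.integral_const_mul]
    exact congrArg _ (hint k).symm

namespace Grassmann

variable {𝕜 : Type} [RCLike 𝕜] {q : ℕ}

/-- The (left) derivative by `ξ_l`. -/
def oddPartial (l : Fin q) : Grassmann 𝕜 q →ₗ[𝕜] Grassmann 𝕜 q :=
  CliffordAlgebra.contractLeft (LinearMap.proj l : Module.Dual 𝕜 (Fin q → 𝕜))

theorem oddPartial_ι (l : Fin q) (m : Fin q → 𝕜) :
    oddPartial l (ExteriorAlgebra.ι 𝕜 m) = algebraMap 𝕜 _ (m l) :=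
  CliffordAlgebra.contractLeft_ι _ _ _

theorem oddPartial_algebraMap (l : Fin q) (a : 𝕜) :
    oddPartial l (algebraMap 𝕜 (Grassmann 𝕜 q) a) = 0 :=
  CliffordAlgebra.contractLeft_algebraMap _ _ _

theorem oddPartial_mul (l : Fin q) (a b : Grassmann 𝕜 q) :
    oddPartial l (a * b) = oddPartial l a * b + involution 𝕜 q a * oddPartial l b := by
  induction a using ExteriorAlgebra.induction generalizing b with
  | algebraMap r =>
    rw [oddPartial_algebraMap, AlgHom.commutes, zero_mul, zero_add, ← Algebra.smul_def,
      ← Algebra.smul_def, map_smul]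
  | ι m =>
    have h : oddPartial l (ExteriorAlgebra.ι 𝕜 m * b) =
      m l • b - ExteriorAlgebra.ι 𝕜 m * oddPartial l b := CliffordAlgebra.contractLeft_ι_mul _ _ _
    rw [h, oddPartial_ι, involution_ι, ← Algebra.smul_def, neg_mul, sub_eq_add_neg]
  | mul x y hx hy =>
    rw [mul_assoc, hx, hy, hx, map_mul]
    noncomm_ring
  | add x y hx hy =>
    rw [add_mul, map_add, hx, hy, map_add, map_add]
    noncomm_ring

end Grassmann

/-! ## Partial derivatives and the chain rule -/

theorem Grassmann.odd_mul {𝕜 : Type} [RCLike 𝕜] {q : ℕ} {a : Grassmann 𝕜 q} (ha : a ∈ part q 1)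
    (f : Grassmann 𝕜 q) : a * f = involution 𝕜 q f * a := by
  obtain ⟨b, hb, c, hc, rfl⟩ := exists_even_add_odd f
  rw [map_add, involution_even hb, involution_odd hc, mul_add, add_mul, supercomm ha hb,
    supercomm ha hc]
  have e1 : ((1 : ZMod 2) * 0).val = 0 := rfl
  have e2 : ((1 : ZMod 2) * 1).val = 1 := rfl
  rw [e1, e2, pow_zero, one_smul, pow_one, neg_one_smul, neg_mul]

theorem Grassmann.even_mul {𝕜 : Type} [RCLike 𝕜] {q : ℕ} {a : Grassmann 𝕜 q} (ha : a ∈ part q 0)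
    (f : Grassmann 𝕜 q) : a * f = f * a := by
  obtain ⟨b, hb, c, hc, rfl⟩ := exists_even_add_odd f
  rw [mul_add, add_mul, supercomm ha hb, supercomm ha hc, zero_mul, zero_mul]
  simp

theorem Grassmann.ext_coeff {𝕜 : Type} [RCLike 𝕜] {q : ℕ} {a b : Grassmann 𝕜 q}
    (h : ∀ I, coeff I a = coeff I b) : a = b :=
  (monomialBasis 𝕜 q).ext_elem h

theorem Grassmann.coeff_monomialBasis {𝕜 : Type} [RCLike 𝕜] {q : ℕ} (I J : Finset (Fin q)) :
    coeff I (monomialBasis 𝕜 q J) = if J = I then 1 else 0 := by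
  rw [coeff, Module.Basis.coord_apply, Module.Basis.repr_self, Finsupp.single_apply]

namespace superFunctions

variable {𝕜 : Type} [RCLike 𝕜] {p q : ℕ} {V : Opens (EuclideanSpace ℝ (Fin p))}

theorem differentiableAt_functional (f : superFunctions 𝕜 p q V) (T : Grassmann 𝕜 q →ₗ[𝕜] 𝕜)
    (y : V) : DifferentiableAt ℝ (extendZero fun z => T (f.1 z)) (y : EuclideanSpace ℝ (Fin p)) :=
  ((f.2.functional T).contDiffAt (V.isOpen.mem_nhds y.2)).differentiableAt (by simp)

theorem extendZero_eventuallyEq {g : V → 𝕜} {G : EuclideanSpace ℝ (Fin p) → 𝕜}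
    (h : ∀ z : V, g z = G z) (y : V) :
    extendZero g =ᶠ[nhds (y : EuclideanSpace ℝ (Fin p))] G := by
  filter_upwards [V.isOpen.mem_nhds y.2] with z hz
  exact (extendZero_apply g ⟨z, hz⟩).trans (h _)

theorem coeff_evenDeriv (k : Fin p) (f : superFunctions 𝕜 p q V) (y : V) (I : Finset (Fin q)) :
    Grassmann.coeff I (evenDeriv k f y) =
      fderiv ℝ (extendZero fun z => Grassmann.coeff I (f.1 z)) y (EuclideanSpace.single k 1) := by
  rw [evenDeriv, map_sum, Finset.sum_eq_single I]
  · rw [map_smul, Grassmann.coeff_monomialBasis, if_pos rfl, smul_eq_mul, mul_one]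
  · intro J _ hJ
    rw [map_smul, Grassmann.coeff_monomialBasis, if_neg hJ, smul_zero]
  · simp

/-- The partial derivative by `x_k`. -/
def evenPartial (k : Fin p) : superFunctions 𝕜 p q V →ₗ[𝕜] superFunctions 𝕜 p q V where
  toFun f := ⟨evenDeriv k f, fun I => by
    refine (((f.2 I).fderiv_of_isOpen V.isOpen (m := ∞) le_rfl).clm_apply
      (contDiffOn_const (c := EuclideanSpace.single k (1 : ℝ)))).congr fun y hy => ?_
    exact (extendZero_apply (V := V) _ ⟨y, hy⟩).trans (coeff_evenDeriv k f ⟨y, hy⟩ I)⟩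
  map_add' f g := by
    refine Subtype.ext (funext fun y => Grassmann.ext_coeff fun I => ?_)
    refine (coeff_evenDeriv k (f + g) y I).trans ?_
    change _ = Grassmann.coeff I (evenDeriv k f y + evenDeriv k g y)
    rw [map_add, coeff_evenDeriv, coeff_evenDeriv, ← add_apply,
      ← fderiv_add (differentiableAt_functional f _ y) (differentiableAt_functional g _ y)]
    refine congrArg (fun L : EuclideanSpace ℝ (Fin p) →L[ℝ] 𝕜 => L _)
      (Filter.EventuallyEq.fderiv_eq (extendZero_eventuallyEq (fun z => ?_) y))
    rw [Pi.add_apply, extendZero_apply, extendZero_apply]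
    exact map_add _ _ _
  map_smul' c f := by
    refine Subtype.ext (funext fun y => Grassmann.ext_coeff fun I => ?_)
    refine (coeff_evenDeriv k (c • f) y I).trans ?_
    change _ = Grassmann.coeff I (c • evenDeriv k f y)
    rw [map_smul, coeff_evenDeriv, ← smul_apply,
      ← fderiv_const_smul (differentiableAt_functional f _ y)]
    refine congrArg (fun L : EuclideanSpace ℝ (Fin p) →L[ℝ] 𝕜 => L _)
      (Filter.EventuallyEq.fderiv_eq (extendZero_eventuallyEq (fun z => ?_) y))
    rw [Pi.smul_apply, extendZero_apply]
    exact map_smul (Grassmann.coeff I) c (f.1 z)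

/-- The coefficients of a product are bilinear in those of the factors, with the structure constants
of the Grassmann algebra; the scalar product rule applies to each term. -/
theorem evenPartial_mul (k : Fin p) (f g : superFunctions 𝕜 p q V) :
    evenPartial k (f * g) = evenPartial k f * g + f * evenPartial k g := by
  refine Subtype.ext (funext fun y => Grassmann.ext_coeff fun I => ?_)
  refine (coeff_evenDeriv k (f * g) y I).trans ?_
  change _ = Grassmann.coeff I (evenDeriv k f y * g.1 y + f.1 y * evenDeriv k g y)
  rw [map_add, Grassmann.coeff_mul, Grassmann.coeff_mul, ← Finset.sum_add_distrib]
  simp only [coeff_evenDeriv, ← Finset.sum_add_distrib]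
  have hd : HasFDerivAt (fun z : EuclideanSpace ℝ (Fin p) => ∑ J, ∑ L,
      extendZero (fun y => Grassmann.coeff J (f.1 y)) z *
        extendZero (fun y => Grassmann.coeff L (g.1 y)) z *
        Grassmann.coeff I (Grassmann.monomialBasis 𝕜 q J * Grassmann.monomialBasis 𝕜 q L)) _
      (y : EuclideanSpace ℝ (Fin p)) :=
    HasFDerivAt.fun_sum fun J _ => HasFDerivAt.fun_sum fun L _ =>
      ((differentiableAt_functional f (Grassmann.coeff J) y).hasFDerivAt.mul
        (differentiableAt_functional g (Grassmann.coeff L) y).hasFDerivAt).mul_const _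
  rw [Filter.EventuallyEq.fderiv_eq (extendZero_eventuallyEq (fun z => ?_) y), hd.fderiv]
  · rw [sum_apply]
    refine Finset.sum_congr rfl fun J _ => ?_
    rw [sum_apply]
    refine Finset.sum_congr rfl fun L _ => ?_
    simp only [smul_apply, add_apply, smul_eq_mul]
    rw [extendZero_apply, extendZero_apply]
    ring
  · refine (Grassmann.coeff_mul I (f.1 z) (g.1 z)).trans ?_
    simp only [extendZero_apply]

/-- The left partial derivative by `ξ_l`. -/
def oddPartial (l : Fin q) : superFunctions 𝕜 p q V →ₗ[𝕜] superFunctions 𝕜 p q V where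
  toFun f := ⟨fun y => Grassmann.oddPartial l (f.1 y), f.2.map' _⟩
  map_add' f g := Subtype.ext (funext fun y => map_add _ (f.1 y) (g.1 y))
  map_smul' c f := Subtype.ext (funext fun y => map_smul (Grassmann.oddPartial l) c (f.1 y))

/-- The powers of the parity involution. -/
def parityPow (i : ZMod 2) : superFunctions 𝕜 p q V →ₐ[𝕜] superFunctions 𝕜 p q V :=
  if i = 0 then AlgHom.id 𝕜 _ else superInvolution 𝕜 q V

@[simp] theorem parityPow_zero (f : superFunctions 𝕜 p q V) : parityPow 0 f = f := rfl

@[simp] theorem parityPow_one (f : superFunctions 𝕜 p q V) :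
    parityPow 1 f = superInvolution 𝕜 q V f := by
  rw [parityPow, if_neg one_ne_zero]

theorem superInvolution_superInvolution (f : superFunctions 𝕜 p q V) :
    superInvolution 𝕜 q V (superInvolution 𝕜 q V f) = f :=
  Subtype.ext (funext fun y => Grassmann.involution_involution (f.1 y))

theorem parityPow_parityPow (i j : ZMod 2) (f : superFunctions 𝕜 p q V) :
    parityPow i (parityPow j f) = parityPow (i + j) f := by
  have e : (1 : ZMod 2) + 1 = 0 := by decide
  rcases zmod_two_cases i with rfl | rfl <;> rcases zmod_two_cases j with rfl | rfl <;>
    simp [e, superInvolution_superInvolution]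

theorem mul_eq_parityPow_mul {i : ZMod 2} {a : superFunctions 𝕜 p q V}
    (ha : ∀ y, a.1 y ∈ Grassmann.part q i) (f : superFunctions 𝕜 p q V) :
    a * f = parityPow i f * a := by
  refine Subtype.ext (funext fun y => ?_)
  rcases zmod_two_cases i with rfl | rfl
  · exact Grassmann.even_mul (ha y) _
  · rw [parityPow_one]
    exact Grassmann.odd_mul (ha y) _

variable (𝕜 V) in
/-- The coordinate functions. -/
def coordFn (j : Fin p ⊕ Fin q) : superFunctions 𝕜 p q V :=
  Sum.elim (evenCoord 𝕜 p q V) (oddCoord 𝕜 p q V) j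

/-- The parity of a coordinate. -/
def coordParity (j : Fin p ⊕ Fin q) : ZMod 2 := Sum.elim (fun _ => 0) (fun _ => 1) j

/-- The partial derivative by a coordinate. -/
def coordPartial (j : Fin p ⊕ Fin q) : superFunctions 𝕜 p q V →ₗ[𝕜] superFunctions 𝕜 p q V :=
  Sum.elim evenPartial oddPartial j

theorem coordPartial_mul (j : Fin p ⊕ Fin q) (f g : superFunctions 𝕜 p q V) :
    coordPartial j (f * g) =
      coordPartial j f * g + parityPow (coordParity j) f * coordPartial j g := by
  rcases j with k | l
  · exact evenPartial_mul k f g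
  · refine Subtype.ext (funext fun y => ?_)
    change Grassmann.oddPartial l (f.1 y * g.1 y) =
      Grassmann.oddPartial l (f.1 y) * g.1 y + (parityPow 1 f).1 y * Grassmann.oddPartial l (g.1 y)
    rw [parityPow_one]
    exact Grassmann.oddPartial_mul l _ _

theorem evenDeriv_of_coeff_eq (k : Fin p) (f : superFunctions 𝕜 p q V) (y : V)
    (g : EuclideanSpace ℝ (Fin p) → 𝕜) (hg : DifferentiableAt ℝ g y) (a : Grassmann 𝕜 q)
    (h : ∀ z : V, f.1 z = g z • a) :
    evenDeriv k f y = fderiv ℝ g y (EuclideanSpace.single k 1) • a := by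
  refine Grassmann.ext_coeff fun I => ?_
  rw [coeff_evenDeriv, map_smul, smul_eq_mul]
  have e : extendZero (fun z => Grassmann.coeff I (f.1 z)) =ᶠ[nhds (y : EuclideanSpace ℝ (Fin p))]
      fun z => g z * Grassmann.coeff I a :=
    extendZero_eventuallyEq (fun z => by rw [h, map_smul, smul_eq_mul]) y
  rw [e.fderiv_eq, (hg.hasFDerivAt.mul_const (Grassmann.coeff I a)).fderiv]
  simp [mul_comm]

theorem coordPartial_coordFn (i j : Fin p ⊕ Fin q) :
    coordPartial i (coordFn 𝕜 V j) = if i = j then 1 else 0 := by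
  refine Subtype.ext (funext fun y => ?_)
  rcases i with k | l <;> rcases j with m | n
  · have hd : HasFDerivAt (fun z : EuclideanSpace ℝ (Fin p) => ((z m : ℝ) : 𝕜))
        ((RCLike.ofRealCLM (K := 𝕜)).comp (EuclideanSpace.proj m)) (y : EuclideanSpace ℝ (Fin p)) :=
      ((RCLike.ofRealCLM (K := 𝕜)).comp
        (EuclideanSpace.proj m : EuclideanSpace ℝ (Fin p) →L[ℝ] ℝ)).hasFDerivAt
    refine (evenDeriv_of_coeff_eq k (evenCoord 𝕜 p q V m) y (fun z => ((z m : ℝ) : 𝕜)) hd.differentiableAt 1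
      fun z => Algebra.algebraMap_eq_smul_one _).trans ?_
    rw [hd.fderiv]
    by_cases h : k = m
    · subst h; simp
    · simp [h, Ne.symm h]
  · refine (evenDeriv_of_coeff_eq k (oddCoord 𝕜 p q V n) y (fun z => (1 : 𝕜)) (differentiableAt_const _)
      (ExteriorAlgebra.ι 𝕜 (Pi.single n 1)) fun z => (one_smul _ _).symm).trans ?_
    simp
  · refine (Grassmann.oddPartial_algebraMap l _).trans ?_
    simp
  · refine (Grassmann.oddPartial_ι l _).trans ?_
    by_cases h : l = n
    · subst h; simp
    · simp [h]

variable (𝕜 V) in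
/-- A constant superfunction. -/
def const (a : Grassmann 𝕜 q) : superFunctions 𝕜 p q V :=
  ⟨fun _ => a, fun I => (contDiffOn_const (c := Grassmann.coeff I a)).congr
    fun y hy => extendZero_apply _ (⟨y, hy⟩ : V)⟩

theorem sum_scalar_mul_const (f : superFunctions 𝕜 p q V) :
    f = ∑ I, scalarSuperfunction q (fun y => Grassmann.coeff I (f.1 y)) (f.2 I) *
      const 𝕜 V (Grassmann.monomialBasis 𝕜 q I) := by
  refine Subtype.ext (funext fun y => ?_)
  rw [AddSubmonoidClass.coe_finsetSum, Finset.sum_apply]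
  conv_lhs => rw [← (Grassmann.monomialBasis 𝕜 q).sum_repr (f.1 y)]
  exact Finset.sum_congr rfl fun I _ => Algebra.smul_def _ _

/-- A superderivation that annihilates the coordinates vanishes. -/
theorem derivation_eq_zero (hV : Convex ℝ (V : Set (EuclideanSpace ℝ (Fin p)))) {i : ZMod 2}
    (D : superFunctions 𝕜 p q V →ₗ[𝕜] superFunctions 𝕜 p q V)
    (hD : ∀ f g, D (f * g) = D f * g + parityPow i f * D g)
    (hz : ∀ j, D (coordFn 𝕜 V j) = 0) (f : superFunctions 𝕜 p q V) : D f = 0 := by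
  have h1 : D 1 = 0 := by simpa using hD 1 1
  have hs : ∀ a : 𝕜, D (algebraMap 𝕜 _ a) = 0 := fun a => by
    rw [Algebra.algebraMap_eq_smul_one, map_smul, h1, smul_zero]
  -- Constants are polynomials in the odd coordinates.
  have hconst : ∀ a : Grassmann 𝕜 q, D (const 𝕜 V a) = 0 := by
    intro a
    induction a using ExteriorAlgebra.induction with
    | algebraMap r => exact hs r
    | ι m =>
      have e : const 𝕜 V (ExteriorAlgebra.ι 𝕜 m) = ∑ l, m l • coordFn 𝕜 V (Sum.inr l) := by
        refine Subtype.ext (funext fun y => ?_)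
        rw [AddSubmonoidClass.coe_finsetSum, Finset.sum_apply]
        change ExteriorAlgebra.ι 𝕜 m = ∑ l, m l • ExteriorAlgebra.ι 𝕜 (Pi.single l 1)
        conv_lhs => rw [pi_eq_sum_univ' m, map_sum]
        exact Finset.sum_congr rfl fun l _ => by rw [map_smul]
      rw [e, map_sum]
      exact Finset.sum_eq_zero fun l _ => by rw [map_smul, hz, smul_zero]
    | mul a b ha hb =>
      have e : const 𝕜 V (a * b) = const 𝕜 V a * const 𝕜 V b := rfl
      rw [e, hD, ha, hb, zero_mul, mul_zero, add_zero]
    | add a b ha hb =>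
      have e : const 𝕜 V (a + b) = const 𝕜 V a + const 𝕜 V b := rfl
      rw [e, map_add, ha, hb, add_zero]
  have hscalar : ∀ (g : V → 𝕜) (hg : ContDiffOn ℝ ∞ (extendZero g) V),
      D (scalarSuperfunction q g hg) = 0 := by
    intro g hg
    refine Subtype.ext (funext fun y => ?_)
    -- Hadamard's lemma at `y` writes `g` as a constant plus terms `(x_k - y_k) h_k`. After applying
    -- `D`, one half of each term vanishes because `D` kills the coordinates, the other half because
    -- `x_k - y_k` is zero at `y`.
    obtain ⟨h, hh, hgh⟩ := exists_smooth_sub_eq_sum V.isOpen hV hg y.2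
    have hh' : ∀ k, ContDiffOn ℝ ∞ (extendZero fun z : V => h k z) V := fun k =>
      (hh k).congr fun z hz => extendZero_apply (V := V) _ ⟨z, hz⟩
    have e : scalarSuperfunction q g hg = algebraMap 𝕜 _ (g y) +
        ∑ k, (coordFn 𝕜 V (Sum.inl k) - algebraMap 𝕜 _ ((y.1 k : ℝ) : 𝕜)) *
          scalarSuperfunction q (fun z : V => h k z) (hh' k) := by
      refine Subtype.ext (funext fun z => ?_)
      change algebraMap 𝕜 (Grassmann 𝕜 q) (g z) = algebraMap 𝕜 _ (g y) + _
      rw [AddSubmonoidClass.coe_finsetSum, Finset.sum_apply]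
      have := hgh z z.2
      rw [extendZero_apply, extendZero_apply] at this
      rw [this, map_add, map_sum]
      refine congrArg _ (Finset.sum_congr rfl fun k _ => ?_)
      change _ = (algebraMap 𝕜 (Grassmann 𝕜 q) ((z.1 k : ℝ) : 𝕜) -
        algebraMap 𝕜 (Grassmann 𝕜 q) ((y.1 k : ℝ) : 𝕜)) * algebraMap 𝕜 (Grassmann 𝕜 q) (h k z)
      rw [← map_sub, ← map_mul, RCLike.ofReal_sub]
    rw [e, map_add, hs, zero_add, map_sum, AddSubmonoidClass.coe_finsetSum, Finset.sum_apply]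
    refine Finset.sum_eq_zero fun k _ => ?_
    rw [hD, map_sub, hz, hs, sub_zero, zero_mul, zero_add]
    have e0 : (parityPow i (coordFn 𝕜 V (Sum.inl k) -
        algebraMap 𝕜 (superFunctions 𝕜 p q V) ((y.1 k : ℝ) : 𝕜))).1 y = 0 := by
      have e1 : (coordFn 𝕜 V (Sum.inl k) -
          algebraMap 𝕜 (superFunctions 𝕜 p q V) ((y.1 k : ℝ) : 𝕜)).1 y = 0 :=
        sub_self (algebraMap 𝕜 (Grassmann 𝕜 q) ((y.1 k : ℝ) : 𝕜))
      rcases zmod_two_cases i with rfl | rfl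
      · exact e1
      · rw [parityPow_one, superInvolution_apply, e1, map_zero]
    change (parityPow i (coordFn 𝕜 V (Sum.inl k) -
        algebraMap 𝕜 (superFunctions 𝕜 p q V) ((y.1 k : ℝ) : 𝕜))).1 y * _ = 0
    rw [e0, zero_mul]
  rw [sum_scalar_mul_const f, map_sum]
  exact Finset.sum_eq_zero fun I _ => by
    rw [hD, hscalar, hconst, zero_mul, mul_zero, add_zero]

/-- The chain rule for superderivations. -/
theorem derivation_eq_sum (hV : Convex ℝ (V : Set (EuclideanSpace ℝ (Fin p)))) {i : ZMod 2}
    (D : superFunctions 𝕜 p q V →ₗ[𝕜] superFunctions 𝕜 p q V)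
    (hD : ∀ f g, D (f * g) = D f * g + parityPow i f * D g)
    (hz : ∀ j y, (D (coordFn 𝕜 V j)).1 y ∈ Grassmann.part q (i + coordParity j))
    (f : superFunctions 𝕜 p q V) : D f = ∑ j, D (coordFn 𝕜 V j) * coordPartial j f := by
  -- The difference of the two sides is again a superderivation of parity `i`, and it kills the
  -- coordinates.
  have key := derivation_eq_zero (i := i) hV
    (D - ∑ j, (LinearMap.mulLeft 𝕜 (D (coordFn 𝕜 V j))).comp (coordPartial j))
    (fun f g => by
      simp only [LinearMap.sub_apply, LinearMap.sum_apply, LinearMap.comp_apply,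
        LinearMap.mulLeft_apply, hD, coordPartial_mul, mul_add, Finset.sum_add_distrib]
      -- Passing `f` over a coefficient of parity `i + |j|` compensates the `|j|`-fold twist from
      -- the partial derivative and leaves the twist by `i`.
      have e : ∀ j, D (coordFn 𝕜 V j) * (parityPow (coordParity j) f * coordPartial j g) =
          parityPow i f * (D (coordFn 𝕜 V j) * coordPartial j g) := fun j => by
        have e2 : i + coordParity j + coordParity j = i := by
          rw [add_assoc, ← two_mul]
          simp [(by decide : (2 : ZMod 2) = 0)]
        rw [← mul_assoc, mul_eq_parityPow_mul (hz j), parityPow_parityPow, e2, mul_assoc]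
      simp only [e, ← Finset.mul_sum, sub_mul, mul_sub, Finset.sum_mul, mul_assoc]
      abel)
    (fun j => by
      simp only [LinearMap.sub_apply, LinearMap.sum_apply, LinearMap.comp_apply,
        LinearMap.mulLeft_apply, coordPartial_coordFn]
      simp) f
  simp only [LinearMap.sub_apply, LinearMap.sum_apply, LinearMap.comp_apply,
    LinearMap.mulLeft_apply] at key
  exact sub_eq_zero.1 key

end superFunctions

/-! ## Invariant frames near the neutral element -/

namespace Grassmann

variable {𝕜 : Type} [RCLike 𝕜] {q : ℕ}

theorem oddPartial_involution (l : Fin q) (a : Grassmann 𝕜 q) :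
    oddPartial l (involution 𝕜 q a) = -involution 𝕜 q (oddPartial l a) := by
  induction a using ExteriorAlgebra.induction with
  | algebraMap r => rw [AlgHom.commutes, oddPartial_algebraMap, map_zero, neg_zero]
  | ι m => rw [involution_ι, map_neg, oddPartial_ι, AlgHom.commutes]
  | mul x y hx hy =>
    rw [map_mul, oddPartial_mul, oddPartial_mul, hx, hy, map_add, map_mul, map_mul]
    noncomm_ring
  | add x y hx hy => rw [map_add, map_add, hx, hy, map_add, map_add, neg_add]

theorem oddPartial_even (l : Fin q) {a : Grassmann 𝕜 q} (ha : a ∈ part q 0) :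
    oddPartial l a ∈ part q 1 := by
  have h := oddPartial_involution l a
  rw [mem_even_iff.1 ha] at h
  exact mem_odd_iff.2 (neg_eq_iff_eq_neg.1 h.symm)

theorem body_involution (a : Grassmann 𝕜 q) : body 𝕜 q (involution 𝕜 q a) = body 𝕜 q a := by
  obtain ⟨b, hb, c, hc, rfl⟩ := exists_even_add_odd a
  rw [map_add, map_add, map_add, involution_even hb, involution_odd hc, map_neg, body_odd hc,
    neg_zero]

theorem sum_coeff_mul (T : Grassmann 𝕜 q →ₗ[𝕜] 𝕜) (a : Grassmann 𝕜 q) :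
    T a = ∑ I, coeff I a * T (monomialBasis 𝕜 q I) := by
  conv_lhs => rw [← (monomialBasis 𝕜 q).sum_repr a, map_sum]
  exact Finset.sum_congr rfl fun I _ => by rw [map_smul]; rfl

end Grassmann

namespace superFunctions

variable {𝕜 : Type} [RCLike 𝕜] {p q : ℕ} {V V' : Opens (EuclideanSpace ℝ (Fin p))}

theorem functional_evenDeriv (T : Grassmann 𝕜 q →ₗ[𝕜] 𝕜) (k : Fin p) (f : superFunctions 𝕜 p q V)
    (y : V) : T (evenDeriv k f y) =
      fderiv ℝ (extendZero fun z => T (f.1 z)) y (EuclideanSpace.single k 1) := by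
  have hd : HasFDerivAt (fun z : EuclideanSpace ℝ (Fin p) => ∑ I,
      extendZero (fun y => Grassmann.coeff I (f.1 y)) z * T (Grassmann.monomialBasis 𝕜 q I)) _
      (y : EuclideanSpace ℝ (Fin p)) :=
    HasFDerivAt.fun_sum fun I _ =>
      (differentiableAt_functional f (Grassmann.coeff I) y).hasFDerivAt.mul_const _
  rw [Filter.EventuallyEq.fderiv_eq (extendZero_eventuallyEq (fun z => ?_) y), hd.fderiv,
    Grassmann.sum_coeff_mul]
  · rw [sum_apply]
    refine Finset.sum_congr rfl fun I _ => ?_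
    rw [coeff_evenDeriv, smul_apply, smul_eq_mul, mul_comm]
  · rw [Grassmann.sum_coeff_mul]
    simp only [extendZero_apply]

theorem coordPartial_congr (j : Fin p ⊕ Fin q) {f : superFunctions 𝕜 p q V}
    {f' : superFunctions 𝕜 p q V'} (y : EuclideanSpace ℝ (Fin p)) (hy : y ∈ V) (hy' : y ∈ V')
    (h : ∀ z (hz : z ∈ V) (hz' : z ∈ V'), f.1 ⟨z, hz⟩ = f'.1 ⟨z, hz'⟩) :
    (coordPartial j f).1 ⟨y, hy⟩ = (coordPartial j f').1 ⟨y, hy'⟩ := by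
  rcases j with k | l
  · refine Grassmann.ext_coeff fun I => ?_
    refine (coeff_evenDeriv k f ⟨y, hy⟩ I).trans
      (Eq.trans ?_ (coeff_evenDeriv k f' ⟨y, hy'⟩ I).symm)
    refine congrArg (fun L : EuclideanSpace ℝ (Fin p) →L[ℝ] 𝕜 => L _)
      (Filter.EventuallyEq.fderiv_eq ?_)
    filter_upwards [V.isOpen.mem_nhds hy, V'.isOpen.mem_nhds hy'] with z hz hz'
    rw [extendZero_apply (V := V) _ ⟨z, hz⟩, extendZero_apply (V := V') _ ⟨z, hz'⟩, h z hz hz']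
  · exact congrArg (Grassmann.oddPartial l) (h y hy hy')

theorem body_parityPow (i : ZMod 2) (f : superFunctions 𝕜 p q V) (y : V) :
    Grassmann.body 𝕜 q ((parityPow i f).1 y) = Grassmann.body 𝕜 q (f.1 y) := by
  rcases zmod_two_cases i with rfl | rfl
  · rfl
  · rw [parityPow_one, superInvolution_apply, Grassmann.body_involution]

theorem body_coordPartial_mul (j : Fin p ⊕ Fin q) (f g : superFunctions 𝕜 p q V) (y : V) :
    Grassmann.body 𝕜 q ((coordPartial j (f * g)).1 y) =
      Grassmann.body 𝕜 q (f.1 y) * Grassmann.body 𝕜 q ((coordPartial j g).1 y) +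
        Grassmann.body 𝕜 q ((coordPartial j f).1 y) * Grassmann.body 𝕜 q (g.1 y) := by
  rw [coordPartial_mul, ← body_parityPow (coordParity j) f y, ← map_mul, ← map_mul, ← map_add,
    add_comm]
  rfl

end superFunctions

open superFunctions

namespace SuperChart

variable {𝕜 : Type} [RCLike 𝕜] {p q : ℕ} {M : Supermanifold 𝕜}

theorem evalAt_eq (c : SuperChart M.toSuperSpace p q) {x : M.carrier} (hx : x ∈ c.dom)
    (V : Opens M.carrier) (hV : x ∈ V) (f : M.sec V) :
    M.evalAt x V hV f =
      Grassmann.body 𝕜 q (c.pointValue (c.base x) V (base_mem_img hx hV) f) :=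
  c.character_eq hx (fun V hV => M.evalAt x V hV) (fun V V' h hV' f => M.evalAt_res V V' h hV' f)
    V hV f

/-- The partial derivative by a coordinate at a point. -/
def coordDer (c : SuperChart M.toSuperSpace p q) (u : EuclideanSpace ℝ (Fin p))
    (j : Fin p ⊕ Fin q) (V : Opens M.carrier) (hu : u ∈ c.img V) : M.sec V →ₗ[𝕜] 𝕜 where
  toFun f := Grassmann.body 𝕜 q ((coordPartial j (c.localCoord V f)).1 ⟨u, mem_img_inf_dom hu⟩)
  map_add' f g := by
    rw [map_add, map_add]
    exact map_add (Grassmann.body 𝕜 q) _ _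
  map_smul' a f := by
    rw [map_smul, map_smul]
    exact map_smul (Grassmann.body 𝕜 q) _ _

theorem coordDer_apply (c : SuperChart M.toSuperSpace p q) (u : EuclideanSpace ℝ (Fin p))
    (j : Fin p ⊕ Fin q) (V : Opens M.carrier) (hu : u ∈ c.img V) (f : M.sec V) :
    c.coordDer u j V hu f =
      Grassmann.body 𝕜 q ((coordPartial j (c.localCoord V f)).1 ⟨u, mem_img_inf_dom hu⟩) := rfl

theorem coordDer_mul (c : SuperChart M.toSuperSpace p q) (u : EuclideanSpace ℝ (Fin p))
    (j : Fin p ⊕ Fin q) (V : Opens M.carrier) (hu : u ∈ c.img V) (f g : M.sec V) :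
    c.coordDer u j V hu (f * g) =
      Grassmann.body 𝕜 q (c.pointValue u V hu f) * c.coordDer u j V hu g +
        c.coordDer u j V hu f * Grassmann.body 𝕜 q (c.pointValue u V hu g) := by
  rw [coordDer_apply, map_mul, body_coordPartial_mul, pointValue_apply, pointValue_apply,
    coordDer_apply, coordDer_apply]

/-- An even partial derivative preserves and an odd one reverses parity; in both cases the result is
odd and has no body. -/
theorem coordDer_part (c : SuperChart M.toSuperSpace p q) (u : EuclideanSpace ℝ (Fin p))
    (j : Fin p ⊕ Fin q) (V : Opens M.carrier) (hu : u ∈ c.img V) (f : M.sec V)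
    (hf : f ∈ M.part V (coordParity j + 1)) : c.coordDer u j V hu f = 0 := by
  have hf' : ∀ y, (c.localCoord V f).1 y ∈ Grassmann.part q (coordParity j + 1) :=
    fun y => c.coord_part _ _ _ _ (M.res_part _ hf) _
  rcases j with k | l
  · refine (functional_evenDeriv (Grassmann.body 𝕜 q).toLinearMap k _ _).trans ?_
    have e : extendZero (fun z => (Grassmann.body 𝕜 q).toLinearMap ((c.localCoord V f).1 z))
        =ᶠ[nhds u] fun _ => 0 :=
      extendZero_eventuallyEq (fun z => Grassmann.body_odd (hf' z)) ⟨u, mem_img_inf_dom hu⟩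
    rw [e.fderiv_eq]
    simp
  · have e : coordParity (Sum.inr l : Fin p ⊕ Fin q) + 1 = 0 := by
      change (1 : ZMod 2) + 1 = 0
      decide
    rw [e] at hf'
    exact Grassmann.body_odd (Grassmann.oddPartial_even l (hf' _))

/-- The tangent vector given by the partial derivative by a coordinate. -/
def coordTangent (c : SuperChart M.toSuperSpace p q) {x : M.carrier} (hx : x ∈ c.dom)
    (j : Fin p ⊕ Fin q) : TangentVector M x (coordParity j) where
  der V hV := c.coordDer (c.base x) j V (base_mem_img hx hV)
  der_res V V' h hV f := congrArg (Grassmann.body 𝕜 q)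
    (coordPartial_congr j _ _ _ fun z hz hz' => c.localCoord_res h f hz)
  der_part V hV f hf := c.coordDer_part _ j V _ f hf
  leibniz V hV f g := by
    rw [c.evalAt_eq hx V hV f, c.evalAt_eq hx V hV g, coordDer_mul]

theorem coordTangent_der (c : SuperChart M.toSuperSpace p q) {x : M.carrier} (hx : x ∈ c.dom)
    (j : Fin p ⊕ Fin q) (W : Opens M.carrier) (hW : W ≤ c.dom) (hV : x ∈ W) (f : M.sec W) :
    (c.coordTangent hx j).der W hV f =
      Grassmann.body 𝕜 q ((coordPartial j (c.coord W hW f)).1 ⟨c.base x, base_mem_img hx hV⟩) :=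
  congrArg (Grassmann.body 𝕜 q) (coordPartial_congr j _ _ _
    fun z hz hz' => c.coord_res hW inf_le_left f ⟨z, hz⟩)

/-! ### Superderivations in coordinates -/

section LocalDerivation

variable {X : SuperSpace 𝕜} {i : ZMod 2}

/-- The coordinate expression of a superderivation. -/
def localDerivation (c : SuperChart X p q) (W : Opens X.carrier) (hW : W ≤ c.dom)
    (D : X.SheafDerivation i) :
    superFunctions 𝕜 p q (c.img W) →ₗ[𝕜] superFunctions 𝕜 p q (c.img W) :=
  (c.coord W hW).toLinearMap ∘ₗ D.toFun W ∘ₗ (c.coord W hW).symm.toLinearMap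

theorem localDerivation_apply (c : SuperChart X p q) (W : Opens X.carrier) (hW : W ≤ c.dom)
    (D : X.SheafDerivation i) (f : superFunctions 𝕜 p q (c.img W)) :
    c.localDerivation W hW D f = c.coord W hW (D.toFun W ((c.coord W hW).symm f)) := rfl

theorem coord_parityPow (c : SuperChart X p q) (W : Opens X.carrier) (hW : W ≤ c.dom) (i : ZMod 2)
    (f : X.sec W) : c.coord W hW (X.parityPow i W f) = parityPow i (c.coord W hW f) := by
  rcases zmod_two_cases i with rfl | rfl
  · rfl
  · rw [SuperSpace.parityPow_one, superFunctions.parityPow_one, coord_parity]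

theorem localDerivation_mul (c : SuperChart X p q) (W : Opens X.carrier) (hW : W ≤ c.dom)
    (D : X.SheafDerivation i) (f g : superFunctions 𝕜 p q (c.img W)) :
    c.localDerivation W hW D (f * g) =
      c.localDerivation W hW D f * g + parityPow i f * c.localDerivation W hW D g := by
  rw [localDerivation_apply, map_mul, D.leibniz, map_add, map_mul, map_mul, coord_parityPow,
    AlgEquiv.apply_symm_apply, AlgEquiv.apply_symm_apply]
  rfl

/-- A chart is required to preserve parity in one direction only. The other direction follows
because the even and odd parts are complementary on both sides. -/
theorem coord_symm_part (c : SuperChart X p q) (W : Opens X.carrier) (hW : W ≤ c.dom)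
    {f : superFunctions 𝕜 p q (c.img W)} {i : ZMod 2} (hf : ∀ y, f.1 y ∈ Grassmann.part q i) :
    (c.coord W hW).symm f ∈ X.part W i := by
  rcases zmod_two_cases i with rfl | rfl
  · refine X.mem_even_of_parity ((c.coord W hW).injective ?_)
    rw [coord_parity, AlgEquiv.apply_symm_apply]
    exact Subtype.ext (funext fun y => Grassmann.involution_even (hf y))
  · obtain ⟨a, ha, b, hb, h⟩ := X.exists_even_add_odd ((c.coord W hW).symm f)
    have h0 : a = 0 := by
      refine (c.coord W hW).injective (Subtype.ext (funext fun y => ?_))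
      have h1 : (c.coord W hW a).1 y = f.1 y - (c.coord W hW b).1 y := by
        rw [← AlgEquiv.apply_symm_apply (c.coord W hW) f, h, map_add]
        exact (add_sub_cancel_right _ _).symm
      have h2 : (c.coord W hW a).1 y ∈ Grassmann.part q 1 := by
        rw [h1]
        exact Submodule.sub_mem _ (hf y) (c.coord_part W hW 1 b hb y)
      have h3 := (CliffordAlgebra.evenOdd_isCompl
        (Q := (0 : QuadraticForm 𝕜 (Fin q → 𝕜)))).disjoint
      rw [map_zero]
      exact Submodule.disjoint_def.1 h3 _ (c.coord_part W hW 0 a ha y) h2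
    rw [h, h0, zero_add]
    exact hb

theorem localDerivation_part (c : SuperChart X p q) (W : Opens X.carrier) (hW : W ≤ c.dom)
    (D : X.SheafDerivation i) {f : superFunctions 𝕜 p q (c.img W)} {j : ZMod 2}
    (hf : ∀ y, f.1 y ∈ Grassmann.part q j) (y) :
    (c.localDerivation W hW D f).1 y ∈ Grassmann.part q (i + j) :=
  c.coord_part W hW _ _ (D.map_part W j _ (c.coord_symm_part W hW hf)) y

theorem localDerivation_res (c : SuperChart X p q) {W W' : Opens X.carrier} (hW : W ≤ c.dom)
    (h : W' ≤ W) (D : X.SheafDerivation i) (f : superFunctions 𝕜 p q (c.img W))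
    (f' : superFunctions 𝕜 p q (c.img W'))
    (hf : ∀ y : c.img W', f'.1 y = f.1 ⟨y, c.img_mono h y.2⟩) (y : c.img W') :
    (c.localDerivation W' (h.trans hW) D f').1 y =
      (c.localDerivation W hW D f).1 ⟨y, c.img_mono h y.2⟩ := by
  have e : (c.coord W' (h.trans hW)).symm f' = X.res h ((c.coord W hW).symm f) := by
    refine (c.coord W' (h.trans hW)).injective ?_
    rw [AlgEquiv.apply_symm_apply]
    refine Subtype.ext (funext fun z => ?_)
    rw [coord_res c hW h, AlgEquiv.apply_symm_apply, hf]
  rw [localDerivation_apply, e, D.map_res]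
  exact c.coord_res hW h _ y

end LocalDerivation

end SuperChart

theorem superFunctions.coordFn_part {𝕜 : Type} [RCLike 𝕜] {p q : ℕ}
    {V : Opens (EuclideanSpace ℝ (Fin p))} (j : Fin p ⊕ Fin q) (y : V) :
    (coordFn 𝕜 V j).1 y ∈ Grassmann.part q (coordParity j) := by
  rcases j with k | l
  · change algebraMap 𝕜 (Grassmann 𝕜 q) ((y.1 k : ℝ) : 𝕜) ∈ Grassmann.part q 0
    rw [Algebra.algebraMap_eq_smul_one]
    exact Submodule.smul_mem _ _ (SetLike.GradedOne.one_mem (A := CliffordAlgebra.evenOdd _))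
  · exact Grassmann.ι_mem_part _

theorem Matrix.eq_sum_of_mul_eq_one {R ι : Type} [Ring R] [Fintype ι] [DecidableEq ι]
    (a m : Matrix ι ι R) (h : a * m = 1) (d e : ι → R) (hd : ∀ j, d j = ∑ l, m j l * e l) (k : ι) :
    e k = ∑ j, a k j * d j := by
  have h1 : d = m.mulVec e := funext hd
  have h2 : a.mulVec d = e := by rw [h1, Matrix.mulVec_mulVec, h, Matrix.one_mulVec]
  exact (congrFun h2 k).symm

/-- An open cube in `ℝ^p`. -/
def cube {p : ℕ} (u : EuclideanSpace ℝ (Fin p)) (r : ℝ) : Opens (EuclideanSpace ℝ (Fin p)) :=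
  ⟨EuclideanSpace.equiv (Fin p) ℝ ⁻¹' Metric.ball (EuclideanSpace.equiv (Fin p) ℝ u) r,
    Metric.isOpen_ball.preimage (EuclideanSpace.equiv (Fin p) ℝ).continuous⟩

theorem mem_cube {p : ℕ} {u y : EuclideanSpace ℝ (Fin p)} {r : ℝ} (hr : 0 < r) :
    y ∈ cube u r ↔ ∀ k, |y k - u k| < r := by
  change EuclideanSpace.equiv (Fin p) ℝ y ∈ Metric.ball _ _ ↔ _
  rw [Metric.mem_ball, dist_pi_lt_iff hr]
  rfl

theorem convex_cube {p : ℕ} (u : EuclideanSpace ℝ (Fin p)) (r : ℝ) :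
    Convex ℝ (cube u r : Set (EuclideanSpace ℝ (Fin p))) :=
  (convex_ball _ r).is_linear_preimage (EuclideanSpace.equiv (Fin p) ℝ).toLinearMap.isLinear

theorem exists_cube_subset {p : ℕ} {u : EuclideanSpace ℝ (Fin p)}
    {s : Set (EuclideanSpace ℝ (Fin p))} (hs : s ∈ nhds u) :
    ∃ r > 0, (cube u r : Set (EuclideanSpace ℝ (Fin p))) ⊆ s := by
  rw [(EuclideanSpace.equiv (Fin p) ℝ).toHomeomorph.isInducing.nhds_eq_comap,
    (Metric.nhds_basis_ball.comap _).mem_iff] at hs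
  exact hs

namespace LieSupergroup

variable {𝕜 : Type} [RCLike 𝕜] (G : LieSupergroup 𝕜)

/-- Near the neutral element, the partial derivatives by the coordinates of a chart are linear
combinations of right-invariant vector fields. -/
theorem exists_frame : ∃ (p q : ℕ) (c : SuperChart G.space.toSuperSpace p q) (r : ℝ)
    (W : Opens G.space.carrier) (hW : W ≤ c.dom), 0 < r ∧ G.unit ∈ W ∧
      c.img W = cube (c.base G.unit) r ∧
      ∃ (D : ∀ j : Fin p ⊕ Fin q, G.space.SheafDerivation (coordParity j))
        (a : Matrix (Fin p ⊕ Fin q) (Fin p ⊕ Fin q) (superFunctions 𝕜 p q (c.img W))),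
        (∀ j, G.IsRightInvariant (coordParity j) ((D j).toFun ⊤)) ∧
        ∀ k f, coordPartial k f = ∑ j, a k j * c.localDerivation W hW (D j) f := by
  obtain ⟨p, q, c, hx⟩ := G.space.exists_chart G.unit
  -- Fields whose values at the neutral element are the coordinate derivatives.
  choose D hD hDe using fun j => G.exists_rightInvariant (c.coordTangent hx j)
  let z : ∀ W : Opens G.space.carrier, Fin p ⊕ Fin q → superFunctions 𝕜 p q (c.img W) :=
    fun W => coordFn 𝕜 (c.img W)
  have hu : c.base G.unit ∈ c.img c.dom := SuperChart.base_mem_img hx hx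
  have h1 : ∀ j k, Grassmann.body 𝕜 q ((c.localDerivation c.dom le_rfl (D j) (z c.dom k)).1
      ⟨c.base G.unit, hu⟩) = (1 : Matrix (Fin p ⊕ Fin q) (Fin p ⊕ Fin q) 𝕜) j k := by
    intro j k
    have h2 := hDe j c.dom hx ((c.coord c.dom le_rfl).symm (z c.dom k))
    rw [c.evalAt_eq hx, c.pointValue_eq_coord _ _ le_rfl, c.coordTangent_der hx j c.dom le_rfl,
      AlgEquiv.apply_symm_apply] at h2
    refine h2.trans ?_
    rw [coordPartial_coordFn, Matrix.one_apply]
    split_ifs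
    · exact map_one (Grassmann.body 𝕜 q)
    · exact map_zero (Grassmann.body 𝕜 q)
  -- The body of the matrix of the fields `D j` in the coordinate frame; it is the identity matrix
  -- at the neutral element, hence invertible nearby.
  let A : EuclideanSpace ℝ (Fin p) → Matrix (Fin p ⊕ Fin q) (Fin p ⊕ Fin q) 𝕜 := fun y =>
    Matrix.of fun j k => extendZero (fun y => Grassmann.body 𝕜 q
      ((c.localDerivation c.dom le_rfl (D j) (z c.dom k)).1 y)) y
  have hA : ∀ y (hy : y ∈ c.img c.dom), A y = Matrix.of fun j k => Grassmann.body 𝕜 q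
      ((c.localDerivation c.dom le_rfl (D j) (z c.dom k)).1 ⟨y, hy⟩) := fun y hy => by
    ext j k
    exact extendZero_apply (V := c.img c.dom) (fun y => Grassmann.body 𝕜 q
      ((c.localDerivation c.dom le_rfl (D j) (z c.dom k)).1 y)) ⟨y, hy⟩
  have hdet : ContinuousAt (fun y => (A y).det) (c.base G.unit) :=
    (contDiffOn_det (s := c.img c.dom) fun j k => contDiffOn_body
      (c.localDerivation c.dom le_rfl (D j) (z c.dom k))).continuousOn.continuousAt
      ((c.img c.dom).isOpen.mem_nhds hu)
  have hdet0 : (A (c.base G.unit)).det ≠ 0 := by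
    have : A (c.base G.unit) = 1 := by
      rw [hA _ hu]
      ext j k
      exact h1 j k
    rw [this, Matrix.det_one]
    exact one_ne_zero
  -- A cube is convex, as needed for the chain rule, and a product of intervals, as needed for
  -- integrating along the axes.
  obtain ⟨r, hr, hcube⟩ := exists_cube_subset
    (Filter.inter_mem ((c.img c.dom).isOpen.mem_nhds hu) (hdet.eventually_ne hdet0))
  let W : Opens G.space.carrier := ⟨c.base.source ∩ c.base ⁻¹' (cube (c.base G.unit) r),
    c.base.isOpen_inter_preimage (cube (c.base G.unit) r).isOpen⟩
  have hW : W ≤ c.dom := fun x hx => hx.1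
  have himg : c.img W = cube (c.base G.unit) r := by
    ext y
    constructor
    · rintro ⟨h, h', h''⟩
      rwa [mem_preimage, c.base.right_inv h] at h''
    · intro hy
      have ht : y ∈ c.base.target := (hcube hy).1.1
      refine ⟨ht, c.base.map_target ht, ?_⟩
      rw [mem_preimage, c.base.right_inv ht]
      exact hy
  have hconv : Convex ℝ (c.img W : Set (EuclideanSpace ℝ (Fin p))) := by
    rw [himg]
    exact convex_cube _ _
  have hunit := isUnit_matrix_of_body
    (Matrix.of fun j k => c.localDerivation W hW (D j) (z W k)) (fun y => by
      have hy : y.1 ∈ cube (c.base G.unit) r := himg ▸ y.2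
      have h3 := (hcube hy).2
      have h4 : A y = Matrix.of fun j k => Grassmann.body 𝕜 q
          ((c.localDerivation W hW (D j) (z W k)).1 y) := by
        rw [hA y (c.img_mono hW y.2)]
        ext j k
        refine congrArg (Grassmann.body 𝕜 q) (c.localDerivation_res le_rfl hW (D j) (z c.dom k)
          (z W k) (fun y => ?_) y).symm
        rcases k with k | l <;> rfl
      rw [mem_ofPred_eq, h4] at h3
      exact h3)
  obtain ⟨⟨m, a, h5, h6⟩, h7⟩ := hunit
  simp only at h7
  subst h7
  refine ⟨p, q, c, r, W, hW, hr, ⟨hx, ?_⟩, himg, D, a, hD, fun k f => ?_⟩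
  · rw [mem_preimage]
    refine (mem_cube hr).2 fun k => ?_
    rwa [sub_self, abs_zero]
  -- The chain rule expresses the fields by the partial derivatives; the inverse matrix `a` solves
  -- for the latter.
  · have h8 : ∀ j, c.localDerivation W hW (D j) f =
        ∑ l, c.localDerivation W hW (D j) (z W l) * coordPartial l f := fun j =>
      derivation_eq_sum hconv _ (c.localDerivation_mul W hW (D j))
        (fun l y => c.localDerivation_part W hW (D j) (coordFn_part l) y) f
    exact Matrix.eq_sum_of_mul_eq_one a _ h6 _ _ h8 k

end LieSupergroup

/-! ## Test functions in a cube with integral zero -/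

section Poincare

variable {𝕜 : Type} [RCLike 𝕜] {p : ℕ}

/-- The integral over (a part of) a line parallel to a coordinate axis. -/
def lineIntegral (s : Set ℝ) (k : Fin p) (g : EuclideanSpace ℝ (Fin p) → 𝕜)
    (x : EuclideanSpace ℝ (Fin p)) : 𝕜 :=
  ∫ t in s, g (x + t • EuclideanSpace.single k 1)

theorem isometry_add_smul_single (x : EuclideanSpace ℝ (Fin p)) (k : Fin p) :
    Isometry fun t : ℝ => x + t • EuclideanSpace.single k (1 : ℝ) := by
  refine Isometry.of_dist_eq fun a b => ?_
  rw [dist_add_left, dist_eq_norm, ← sub_smul, norm_smul]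
  simp [Real.dist_eq]

/-- The line integral is the convolution of `g` with the constant `1` for the image of the measure
on the line under `t ↦ -t e_k`. That image is locally finite since the map preserves norms. -/
theorem contDiff_lineIntegral (s : Set ℝ) (k : Fin p) {g : EuclideanSpace ℝ (Fin p) → 𝕜}
    (hg : ContDiff ℝ ∞ g) (hc : HasCompactSupport g) : ContDiff ℝ ∞ (lineIntegral s k g) := by
  let e : ℝ → EuclideanSpace ℝ (Fin p) := fun t => -(t • EuclideanSpace.single k (1 : ℝ))
  have he : Continuous e := (continuous_id.smul continuous_const).neg
  let μ : Measure (EuclideanSpace ℝ (Fin p)) := (volume.restrict s).map e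
  have hμ : IsLocallyFiniteMeasure μ := by
    refine ⟨fun x => ⟨Metric.ball x 1, Metric.ball_mem_nhds x one_pos, ?_⟩⟩
    rw [Measure.map_apply he.measurable measurableSet_ball]
    refine lt_of_le_of_lt (Measure.restrict_apply_le _ _) (lt_of_le_of_lt
      (measure_mono (t := Icc (-(1 + ‖x‖)) (1 + ‖x‖)) fun t ht => ?_) measure_Icc_lt_top)
    rw [mem_preimage, mem_ball_iff_norm] at ht
    have h1 : ‖e t‖ = |t| := by
      simp [e, norm_smul]
    have h2 := norm_sub_norm_le (e t) x
    rw [mem_Icc, ← abs_le, ← h1]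
    linarith
  have h := hc.contDiff_convolution_right (𝕜 := ℝ) (n := ⊤) (μ := μ)
    (ContinuousLinearMap.lsmul ℝ ℝ : ℝ →L[ℝ] 𝕜 →L[ℝ] 𝕜) (locallyIntegrable_const (1 : ℝ)) hg
  have e1 : lineIntegral s k g =
      convolution (fun _ => (1 : ℝ)) g (ContinuousLinearMap.lsmul ℝ ℝ) μ := by
    funext x
    rw [convolution, integral_map he.aemeasurable (by
      have hm : Continuous fun t => g (x - t) :=
        hg.continuous.comp (continuous_const.sub continuous_id)
      simpa using hm.aestronglyMeasurable)]
    simp [lineIntegral, e]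
  rw [e1]
  exact h

/-- Moving `x` by `h` along the axis moves the upper limit of integration from `0` to `h`, so this
is the fundamental theorem of calculus. -/
theorem fderiv_lineIntegral (k : Fin p) {g : EuclideanSpace ℝ (Fin p) → 𝕜}
    (hg : ContDiff ℝ ∞ g) (hc : HasCompactSupport g) (x : EuclideanSpace ℝ (Fin p)) :
    fderiv ℝ (lineIntegral (Iic 0) k g) x (EuclideanSpace.single k 1) = g x := by
  have hline := (isometry_add_smul_single x k).isClosedEmbedding
  let G : ℝ → 𝕜 := fun t => g (x + t • EuclideanSpace.single k 1)
  have hG : Continuous G := hg.continuous.comp hline.continuous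
  have hGi : Integrable G := hG.integrable_of_hasCompactSupport (hc.comp_isClosedEmbedding hline)
  have h1 : HasDerivAt (fun h : ℝ => lineIntegral (Iic 0) k g
      (x + h • EuclideanSpace.single k 1))
      (fderiv ℝ (lineIntegral (Iic 0) k g) x (EuclideanSpace.single k 1)) 0 := by
    have h2 : HasDerivAt (fun h : ℝ => x + h • EuclideanSpace.single k (1 : ℝ))
        (EuclideanSpace.single k 1) 0 := by
      simpa using ((hasDerivAt_id (0 : ℝ)).smul_const
        (EuclideanSpace.single k (1 : ℝ))).const_add x
    have h3 := ((contDiff_lineIntegral (Iic 0) k hg hc).differentiable (by simp)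
      (x + (0 : ℝ) • EuclideanSpace.single k (1 : ℝ))).hasFDerivAt
    have h4 := h3.comp_hasDerivAt (0 : ℝ) h2
    rw [zero_smul, add_zero] at h4
    exact h4
  have h2 : HasDerivAt (fun h : ℝ => (∫ t in Iic 0, G t) + ∫ t in (0)..h, G t) (G 0) 0 :=
    (intervalIntegral.integral_hasDerivAt_right (hG.intervalIntegrable _ _)
      (hG.stronglyMeasurableAtFilter _ _) hG.continuousAt).const_add _
  have e : (fun h : ℝ => lineIntegral (Iic 0) k g (x + h • EuclideanSpace.single k 1)) =
      fun h : ℝ => (∫ t in Iic 0, G t) + ∫ t in (0)..h, G t := by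
    funext h
    rw [← intervalIntegral.integral_Iic_sub_Iic hGi.integrableOn hGi.integrableOn,
      add_sub_cancel, ← (measurePreserving_add_left volume h).setIntegral_preimage_emb
        (measurableEmbedding_addLeft h)]
    have : (fun t => h + t) ⁻¹' Iic h = Iic 0 := by ext; simp
    rw [this, lineIntegral]
    simp only [G, add_smul, add_assoc]
  rw [e] at h1
  rw [h1.unique h2]
  simp [G]

theorem lineIntegral_univ_add (k : Fin p) (g : EuclideanSpace ℝ (Fin p) → 𝕜)
    (x : EuclideanSpace ℝ (Fin p)) (h : ℝ) :
    lineIntegral univ k g (x + h • EuclideanSpace.single k 1) = lineIntegral univ k g x := by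
  rw [lineIntegral, lineIntegral, Measure.restrict_univ,
    ← integral_add_left_eq_self (fun t => g (x + t • EuclideanSpace.single k 1)) h]
  simp only [add_smul, add_assoc]

/-- A test function in the cube with centre `u` and side `2r`. -/
structure IsCubeTest (u : EuclideanSpace ℝ (Fin p)) (r : ℝ) (φ : EuclideanSpace ℝ (Fin p) → 𝕜) :
    Prop where
  smooth : ContDiff ℝ ∞ φ
  supp : ∃ r' < r, ∀ x, φ x ≠ 0 → ∀ k, |x k - u k| ≤ r'

variable {u : EuclideanSpace ℝ (Fin p)} {r : ℝ}

theorem isCompact_closedCube (u : EuclideanSpace ℝ (Fin p)) (r : ℝ) :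
    IsCompact {x : EuclideanSpace ℝ (Fin p) | ∀ k, |x k - u k| ≤ r} := by
  have h : {x : EuclideanSpace ℝ (Fin p) | ∀ k, |x k - u k| ≤ r} =
      (EuclideanSpace.equiv (Fin p) ℝ).toHomeomorph ⁻¹'
        (Set.pi univ fun k => Icc (u k - r) (u k + r)) := by
    ext x
    simp only [mem_ofPred_eq, mem_preimage, Set.mem_pi, mem_univ, true_imp_iff, mem_Icc]
    refine forall_congr' fun k => ?_
    rw [abs_le]
    change _ ↔ u k - r ≤ x k ∧ x k ≤ u k + r
    constructor <;> rintro ⟨h1, h2⟩ <;> constructor <;> linarith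
  rw [h, Homeomorph.isCompact_preimage]
  exact isCompact_univ_pi fun k => isCompact_Icc

theorem IsCubeTest.hasCompactSupport {φ : EuclideanSpace ℝ (Fin p) → 𝕜} (h : IsCubeTest u r φ) :
    HasCompactSupport φ := by
  obtain ⟨r', _, hr'⟩ := h.supp
  refine HasCompactSupport.intro (isCompact_closedCube u r') fun x hx => ?_
  by_contra hne
  exact hx (hr' x hne)

theorem IsCubeTest.integrable {φ : EuclideanSpace ℝ (Fin p) → 𝕜} (h : IsCubeTest u r φ) :
    Integrable φ :=
  h.smooth.continuous.integrable_of_hasCompactSupport h.hasCompactSupport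

theorem IsCubeTest.sub {φ ψ : EuclideanSpace ℝ (Fin p) → 𝕜} (h : IsCubeTest u r φ)
    (h' : IsCubeTest u r ψ) : IsCubeTest u r fun x => φ x - ψ x := by
  obtain ⟨r₁, h₁, hr₁⟩ := h.supp
  obtain ⟨r₂, h₂, hr₂⟩ := h'.supp
  refine ⟨h.smooth.sub h'.smooth, max r₁ r₂, max_lt h₁ h₂, fun x hx k => ?_⟩
  by_cases hφ : φ x = 0
  · have hψ : ψ x ≠ 0 := fun h0 => hx (by rw [hφ, h0, sub_zero])
    exact (hr₂ x hψ k).trans (le_max_right _ _)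
  · exact (hr₁ x hφ k).trans (le_max_left _ _)

/-- Integration by parts against the constant function `1`. -/
theorem IsCubeTest.integral_fderiv {φ : EuclideanSpace ℝ (Fin p) → 𝕜} (h : IsCubeTest u r φ)
    (v : EuclideanSpace ℝ (Fin p)) : ∫ x, fderiv ℝ φ x v = 0 := by
  have hd : Integrable fun x => fderiv ℝ φ x v :=
    ((h.smooth.continuous_fderiv (by simp)).clm_apply
      continuous_const).integrable_of_hasCompactSupport
      ((h.hasCompactSupport.fderiv (𝕜 := ℝ)).comp_left
        (g := fun L : EuclideanSpace ℝ (Fin p) →L[ℝ] 𝕜 => L v) rfl)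
  have := integral_smul_fderiv_eq_neg_fderiv_smul_of_integrable (𝕜 := ℝ)
    (μ := (volume : Measure (EuclideanSpace ℝ (Fin p)))) (f := fun _ => (1 : ℝ)) (g := φ) (v := v)
    (by simp) (by simpa using hd) (by simpa using h.integrable)
    (fun x _ => differentiableAt_const _) (fun x _ => h.smooth.differentiable (by simp) x)
  simpa using this

/-- A bump function with integral one near a coordinate of the centre of the cube. -/
def cubeBump (u : EuclideanSpace ℝ (Fin p)) {r : ℝ} (hr : 0 < r) (k : Fin p) : ℝ → ℝ :=
  (⟨r / 4, r / 2, by linarith, by linarith⟩ : ContDiffBump (u k)).normed volume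

theorem cubeBump_supp (hr : 0 < r) {k : Fin p} {t : ℝ} (h : cubeBump u hr k t ≠ 0) :
    |t - u k| ≤ r / 2 := by
  have h1 : t ∈ Function.support (cubeBump u hr k) := h
  rw [cubeBump, ContDiffBump.support_normed_eq, Metric.mem_ball, Real.dist_eq] at h1
  exact h1.le

/-- Integration along the `k`-th axis, followed by multiplication by a bump function. -/
def cubeAverage (u : EuclideanSpace ℝ (Fin p)) {r : ℝ} (hr : 0 < r) (k : Fin p)
    (φ : EuclideanSpace ℝ (Fin p) → 𝕜) (x : EuclideanSpace ℝ (Fin p)) : 𝕜 :=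
  cubeBump u hr k (x k) • lineIntegral univ k φ x

theorem add_smul_single_apply_of_ne (x : EuclideanSpace ℝ (Fin p)) (t : ℝ) {j k : Fin p}
    (h : j ≠ k) : (x + t • EuclideanSpace.single k (1 : ℝ)) j = x j := by
  simp [h]

theorem add_smul_single_apply_self (x : EuclideanSpace ℝ (Fin p)) (t : ℝ) (k : Fin p) :
    (x + t • EuclideanSpace.single k (1 : ℝ)) k = x k + t := by
  simp

theorem IsCubeTest.cubeAverage {φ : EuclideanSpace ℝ (Fin p) → 𝕜} (h : IsCubeTest u r φ)
    (hr : 0 < r) (k : Fin p) : IsCubeTest u r (cubeAverage u hr k φ) := by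
  obtain ⟨r', hr', hs⟩ := h.supp
  refine ⟨?_, max r' (r / 2), max_lt hr' (by linarith), fun x hx j => ?_⟩
  · change ContDiff ℝ ∞ fun x => cubeBump u hr k (x k) • lineIntegral univ k φ x
    have h2 := contDiff_lineIntegral univ k h.smooth h.hasCompactSupport
    refine ContDiff.smul (f := fun x : EuclideanSpace ℝ (Fin p) => cubeBump u hr k (x k)) ?_ h2
    exact (ContDiffBump.contDiff_normed _).comp (EuclideanSpace.proj k :
      EuclideanSpace ℝ (Fin p) →L[ℝ] ℝ).contDiff
  · obtain ⟨h1, h2⟩ := smul_ne_zero_iff.1 hx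
    by_cases hj : j = k
    · subst hj
      exact (cubeBump_supp hr h1).trans (le_max_right _ _)
    · obtain ⟨t, ht⟩ : ∃ t : ℝ, φ (x + t • EuclideanSpace.single k 1) ≠ 0 := by
        by_contra hcon
        push Not at hcon
        refine h2 ?_
        simp [lineIntegral, hcon]
      have h3 := hs _ ht j
      rw [add_smul_single_apply_of_ne x t hj] at h3
      exact h3.trans (le_max_left _ _)

/-- The bump function has integral one. Hence `φ` minus its average integrates to zero along every
line in direction `k` and has a primitive in that direction. -/
theorem lineIntegral_cubeAverage (φ : EuclideanSpace ℝ (Fin p) → 𝕜) (hr : 0 < r) (k : Fin p)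
    (x : EuclideanSpace ℝ (Fin p)) :
    lineIntegral univ k (cubeAverage u hr k φ) x = lineIntegral univ k φ x := by
  have h1 : ∀ t : ℝ, cubeAverage u hr k φ (x + t • EuclideanSpace.single k 1) =
      cubeBump u hr k (x k + t) • lineIntegral univ k φ x := fun t => by
    rw [cubeAverage, lineIntegral_univ_add, add_smul_single_apply_self]
  have h2 : ∫ t, cubeBump u hr k (x k + t) = 1 := by
    rw [integral_add_left_eq_self (cubeBump u hr k) (x k)]
    exact ContDiffBump.integral_normed _
  conv_lhs => rw [lineIntegral, Measure.restrict_univ]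
  simp only [h1]
  rw [integral_smul_const, h2, one_smul]

/-- A test function with vanishing integrals along the `k`-th axis is the `k`-th partial derivative
of a test function. -/
theorem IsCubeTest.exists_fderiv_eq {θ : EuclideanSpace ℝ (Fin p) → 𝕜} (h : IsCubeTest u r θ)
    (k : Fin p) (h0 : ∀ x, lineIntegral univ k θ x = 0) :
    ∃ η, IsCubeTest u r η ∧ ∀ x, fderiv ℝ η x (EuclideanSpace.single k 1) = θ x := by
  obtain ⟨r', hr', hs⟩ := h.supp
  refine ⟨lineIntegral (Iic 0) k θ, ⟨contDiff_lineIntegral _ k h.smooth h.hasCompactSupport,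
    r', hr', fun x hx j => ?_⟩, fderiv_lineIntegral k h.smooth h.hasCompactSupport⟩
  have hex : ∀ s : Set ℝ, MeasurableSet s → lineIntegral s k θ x ≠ 0 →
      ∃ t ∈ s, θ (x + t • EuclideanSpace.single k 1) ≠ 0 := by
    intro s hsm hne
    by_contra hcon
    push Not at hcon
    exact hne (setIntegral_eq_zero_of_forall_eq_zero hcon)
  obtain ⟨t, ht, hne⟩ := hex _ measurableSet_Iic hx
  by_cases hj : j = k
  · subst hj
    have h1 := hs _ hne j
    rw [add_smul_single_apply_self] at h1
    -- The integral over the whole line vanishes, so the integrand cannot live on one side of `x`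
    -- only. Thus `x` lies between two points of the support of `θ`, which keeps the primitive
    -- inside the same closed cube.
    have h2 : ∃ t : ℝ, 0 < t ∧ θ (x + t • EuclideanSpace.single j 1) ≠ 0 := by
      by_contra hcon
      push Not at hcon
      refine hx ((h0 x).symm.trans ?_).symm
      rw [lineIntegral, Measure.restrict_univ]
      exact (setIntegral_eq_integral_of_forall_compl_eq_zero
        fun t ht => hcon t (not_le.1 ht)).symm
    obtain ⟨t', ht', hne'⟩ := h2
    have h3 := hs _ hne' j
    rw [add_smul_single_apply_self] at h3
    have ht0 : t ≤ 0 := ht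
    rw [abs_le] at h1 h3 ⊢
    constructor <;> linarith [h1.1, h3.2]
  · have h1 := hs _ hne j
    rwa [add_smul_single_apply_of_ne x t hj] at h1

/-- The product of the bump functions for the coordinates in `s`. -/
def cubeBumpProd (u : EuclideanSpace ℝ (Fin p)) {r : ℝ} (hr : 0 < r) (s : Finset (Fin p))
    (x : EuclideanSpace ℝ (Fin p)) : ℝ := ∏ j ∈ s, cubeBump u hr j (x j)

/-- Averaging over one axis after the other changes the function only by partial derivatives, hence
within `S`. Once the axes in `s` are done, `ψ` is the product of their bump functions with a
function of the other coordinates; the last clause says this without dividing by bump functions. -/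
theorem exists_cubeTest_prod (hr : 0 < r) (S : Submodule 𝕜 (EuclideanSpace ℝ (Fin p) → 𝕜))
    (hS : ∀ k φ, IsCubeTest u r φ → (fun x => fderiv ℝ φ x (EuclideanSpace.single k 1)) ∈ S)
    {φ : EuclideanSpace ℝ (Fin p) → 𝕜} (hφ : IsCubeTest u r φ) (s : Finset (Fin p)) :
    ∃ ψ, IsCubeTest u r ψ ∧ φ - ψ ∈ S ∧ ∫ x, ψ x = ∫ x, φ x ∧
      ∀ x y, (∀ k ∉ s, x k = y k) →
        cubeBumpProd u hr s y • ψ x = cubeBumpProd u hr s x • ψ y := by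
  induction s using Finset.induction_on with
  | empty =>
    refine ⟨φ, hφ, by rw [sub_self]; exact S.zero_mem, rfl, fun x y hxy => ?_⟩
    have : x = y := by
      ext k
      exact hxy k (by simp)
    rw [this]
  | insert k s hk ih =>
    obtain ⟨ψ, hψ, hS', hint, hprod⟩ := ih
    have hav := hψ.cubeAverage hr k
    obtain ⟨η, hη, hηd⟩ := (hψ.sub hav).exists_fderiv_eq k fun x => by
      have hi : ∀ g : EuclideanSpace ℝ (Fin p) → 𝕜, IsCubeTest u r g →
          Integrable fun t : ℝ => g (x + t • EuclideanSpace.single k 1) := fun g hg => by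
        have hline := isometry_add_smul_single x k
        exact (hg.smooth.continuous.comp hline.continuous).integrable_of_hasCompactSupport
          (hg.hasCompactSupport.comp_isClosedEmbedding hline.isClosedEmbedding)
      have e := lineIntegral_cubeAverage (u := u) ψ hr k x
      rw [lineIntegral, Measure.restrict_univ] at e ⊢
      rw [integral_sub (hi _ hψ) (hi _ hav), e, lineIntegral, Measure.restrict_univ, sub_self]
    refine ⟨cubeAverage u hr k ψ, hav, ?_, ?_, fun x y hxy => ?_⟩
    · have e : φ - cubeAverage u hr k ψ =
          (φ - ψ) + fun x => fderiv ℝ η x (EuclideanSpace.single k 1) := by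
        funext x
        simp only [Pi.sub_apply, Pi.add_apply, hηd]
        ring
      rw [e]
      exact S.add_mem hS' (hS k η hη)
    · have e := hη.integral_fderiv (EuclideanSpace.single k 1)
      simp only [hηd] at e
      rw [integral_sub hψ.integrable hav.integrable, sub_eq_zero] at e
      rw [← e, hint]
    · have e1 : ∀ z, cubeBumpProd u hr (insert k s) z =
          cubeBump u hr k (z k) * cubeBumpProd u hr s z := fun z => Finset.prod_insert hk
      -- The proportionality is integrated along the `k`-th axis, after shifting `y` along it so
      -- that the `k`-th coordinates agree; the shift does not affect the line integral.
      have e2 : cubeBumpProd u hr s y • lineIntegral univ k ψ x =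
          cubeBumpProd u hr s x • lineIntegral univ k ψ y := by
        rw [← lineIntegral_univ_add k ψ y (x k - y k), lineIntegral, lineIntegral,
          ← integral_smul, ← integral_smul]
        refine integral_congr_ae (Filter.Eventually.of_forall fun t => ?_)
        have hP : ∀ z z' : EuclideanSpace ℝ (Fin p), (∀ j ∈ s, z j = z' j) →
            cubeBumpProd u hr s z = cubeBumpProd u hr s z' := fun z z' hz =>
          Finset.prod_congr rfl fun j hj => by rw [hz j hj]
        have hne : ∀ j ∈ s, j ≠ k := fun j hj hjk => hk (hjk ▸ hj)
        have h3 := hprod (x + t • EuclideanSpace.single k 1)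
          (y + (x k - y k) • EuclideanSpace.single k 1 + t • EuclideanSpace.single k 1)
          fun j hj => by
            by_cases hjk : j = k
            · subst hjk
              simp only [add_smul_single_apply_self]
              ring
            · simp only [add_smul_single_apply_of_ne _ _ hjk]
              exact hxy j (by simp [hjk, hj])
        rw [hP (y + (x k - y k) • EuclideanSpace.single k 1 + t • EuclideanSpace.single k 1) y
          fun j hj => by simp only [add_smul_single_apply_of_ne _ _ (hne j hj)],
          hP (x + t • EuclideanSpace.single k 1) x
          fun j hj => by simp only [add_smul_single_apply_of_ne _ _ (hne j hj)]] at h3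
        exact h3
      rw [e1, e1, _root_.cubeAverage, _root_.cubeAverage, smul_smul, smul_smul,
        mul_assoc, mul_comm (cubeBumpProd u hr s y), ← mul_assoc, mul_assoc _ _ (cubeBump u hr k _),
        mul_comm _ (cubeBump u hr k _)]
      rw [← mul_assoc, mul_smul, e2, smul_smul]
      congr 1
      ring

/-- A space of functions that contains the partial derivatives of the test functions in a cube
contains all test functions with integral zero. -/
theorem IsCubeTest.mem_of_integral_eq_zero (hr : 0 < r)
    (S : Submodule 𝕜 (EuclideanSpace ℝ (Fin p) → 𝕜))
    (hS : ∀ k φ, IsCubeTest u r φ → (fun x => fderiv ℝ φ x (EuclideanSpace.single k 1)) ∈ S)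
    {φ : EuclideanSpace ℝ (Fin p) → 𝕜} (hφ : IsCubeTest u r φ) (h0 : ∫ x, φ x = 0) : φ ∈ S := by
  obtain ⟨ψ, hψ, hS', hint, hprod⟩ := exists_cubeTest_prod hr S hS hφ Finset.univ
  have hP : IsCubeTest (𝕜 := ℝ) u r (cubeBumpProd u hr Finset.univ) := by
    refine ⟨contDiff_prod fun j _ => (ContDiffBump.contDiff_normed _).comp (EuclideanSpace.proj j :
      EuclideanSpace ℝ (Fin p) →L[ℝ] ℝ).contDiff, r / 2, by linarith, fun x hx k => ?_⟩
    exact cubeBump_supp hr (Finset.prod_ne_zero_iff.1 hx k (Finset.mem_univ k))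
  have hpos : 0 < ∫ x, cubeBumpProd u hr Finset.univ x := by
    refine hP.smooth.continuous.integral_pos_of_hasCompactSupport_nonneg_nonzero
      hP.hasCompactSupport (fun x => Finset.prod_nonneg fun j _ => ContDiffBump.nonneg_normed _ _)
      (x := u) (Finset.prod_ne_zero_iff.2 fun j _ => ?_)
    have : u j ∈ Function.support (cubeBump u hr j) := by
      rw [cubeBump, ContDiffBump.support_normed_eq]
      exact Metric.mem_ball_self (by change 0 < r / 2; linarith)
    exact this
  have hzero : ψ = 0 := by
    funext x
    -- With all axes averaged, `ψ` is proportional to the product of all bump functions. Integrating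
    -- over `y` gives a positive multiple of `ψ x` on the left and a multiple of the integral of
    -- `φ`, which is zero, on the right.
    have h1 : ∫ y, cubeBumpProd u hr Finset.univ y • ψ x =
        ∫ y, cubeBumpProd u hr Finset.univ x • ψ y :=
      integral_congr_ae (Filter.Eventually.of_forall fun y => hprod x y (by simp))
    rw [integral_smul_const, integral_smul, hint, h0, smul_zero] at h1
    exact (smul_eq_zero.1 h1).resolve_left hpos.ne'
  rwa [hzero, sub_zero] at hS'

end Poincare

/-! ## The Berezin integral of compactly supported superfunctions -/

namespace Grassmann

variable {𝕜 : Type} [RCLike 𝕜] {q : ℕ}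

theorem monomialBasis_mem (I : Finset (Fin q)) :
    monomialBasis 𝕜 q I ∈ ⋀[𝕜]^I.card (Fin q → 𝕜) := by
  have h := ExteriorAlgebra.basis_eq_coe_basis (Pi.basisFun 𝕜 (Fin q))
    (⟨I, rfl⟩ : Set.powersetCard (Fin q) I.card)
  rw [monomialBasis]
  exact h ▸ Subtype.property _

theorem coeff_univ_of_mem {n : ℕ} (hn : n < q) {a : Grassmann 𝕜 q}
    (ha : a ∈ ⋀[𝕜]^n (Fin q → 𝕜)) : coeff Finset.univ a = 0 := by
  have h := ((Pi.basisFun 𝕜 (Fin q)).exteriorPower n).sum_repr ⟨a, ha⟩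
  have h' := congrArg Subtype.val h
  simp only [AddSubmonoidClass.coe_finsetSum, Submodule.coe_smul] at h'
  rw [← h', map_sum]
  refine Finset.sum_eq_zero fun s _ => ?_
  rw [map_smul, ← ExteriorAlgebra.basis_eq_coe_basis]
  refine (congrArg _ (coeff_monomialBasis (𝕜 := 𝕜) Finset.univ s.1)).trans ?_
  rw [if_neg, smul_zero]
  intro hs
  have := s.2
  rw [Set.powersetCard.mem_iff] at this
  rw [hs, Finset.card_univ, Fintype.card_fin] at this
  omega

theorem oddPartial_mem (l : Fin q) (n : ℕ) {a : Grassmann 𝕜 q}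
    (ha : a ∈ ⋀[𝕜]^(n + 1) (Fin q → 𝕜)) : oddPartial l a ∈ ⋀[𝕜]^n (Fin q → 𝕜) := by
  induction n generalizing a with
  | zero =>
    rw [zero_add, ExteriorAlgebra.exteriorPower, pow_one] at ha
    obtain ⟨m, rfl⟩ := ha
    rw [oddPartial_ι, ExteriorAlgebra.exteriorPower, pow_zero]
    exact Submodule.algebraMap_mem _
  | succ n ih =>
    rw [ExteriorAlgebra.exteriorPower, pow_succ'] at ha
    induction ha using Submodule.mul_induction_on' with
    | mem_mul_mem x hx y hy =>
      obtain ⟨m, rfl⟩ := hx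
      have h : oddPartial l (ExteriorAlgebra.ι 𝕜 m * y) =
        m l • y - ExteriorAlgebra.ι 𝕜 m * oddPartial l y := CliffordAlgebra.contractLeft_ι_mul _ _ _
      rw [h]
      refine Submodule.sub_mem _ (Submodule.smul_mem _ _ hy) ?_
      rw [ExteriorAlgebra.exteriorPower, pow_succ']
      exact Submodule.mul_mem_mul (LinearMap.mem_range_self _ _) (ih hy)
    | add x _ y _ hx hy =>
      rw [map_add]
      exact Submodule.add_mem _ hx hy

/-- An odd derivative lowers the degree, so nothing of top degree is left. -/
theorem coeff_univ_oddPartial (l : Fin q) (a : Grassmann 𝕜 q) :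
    coeff Finset.univ (oddPartial l a) = 0 := by
  have h := sum_coeff_mul ((coeff Finset.univ).comp (oddPartial l)) a
  simp only [LinearMap.comp_apply] at h
  rw [h]
  refine Finset.sum_eq_zero fun I _ => ?_
  have hI := monomialBasis_mem (𝕜 := 𝕜) I
  have hc : I.card ≤ q := by simpa using I.card_le_univ
  rcases hn : I.card with _ | n
  · rw [hn, ExteriorAlgebra.exteriorPower, pow_zero] at hI
    obtain ⟨r, hr⟩ := Submodule.mem_one.1 hI
    rw [← hr, oddPartial_algebraMap, map_zero, mul_zero]
  · rw [hn] at hI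
    rw [coeff_univ_of_mem (by omega) (oddPartial_mem l n hI), mul_zero]

theorem oddPartial_prod_eq_zero (l : Fin q) (L : List (Fin q → 𝕜)) (hL : ∀ m ∈ L, m l = 0) :
    oddPartial l (L.map (ExteriorAlgebra.ι 𝕜)).prod = 0 := by
  induction L with
  | nil =>
    rw [List.map_nil, List.prod_nil, ← map_one (algebraMap 𝕜 (Grassmann 𝕜 q)),
      oddPartial_algebraMap]
  | cons m L ih =>
    rw [List.map_cons, List.prod_cons, oddPartial_mul, oddPartial_ι, hL m (by simp), map_zero,
      zero_mul, ih fun m hm => hL m (by simp [hm]), mul_zero, add_zero]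

theorem oddPartial_monomialBasis {l : Fin q} {I : Finset (Fin q)} (hl : l ∉ I) :
    oddPartial l (monomialBasis 𝕜 q I) = 0 := by
  let s : Set.powersetCard (Fin q) I.card := ⟨I, rfl⟩
  have hs : monomialBasis 𝕜 q I = (List.ofFn fun i => ExteriorAlgebra.ι 𝕜
      (Pi.basisFun 𝕜 (Fin q) (Set.powersetCard.ofFinEmbEquiv.symm s i))).prod :=
    (ExteriorAlgebra.basis_apply_powersetCard (Pi.basisFun 𝕜 (Fin q)) s).trans
      (ExteriorAlgebra.ιMulti_apply _)
  have e : (List.ofFn fun i => ExteriorAlgebra.ι 𝕜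
      (Pi.basisFun 𝕜 (Fin q) (Set.powersetCard.ofFinEmbEquiv.symm s i))) =
      (List.ofFn fun i => Pi.basisFun 𝕜 (Fin q) (Set.powersetCard.ofFinEmbEquiv.symm s i)).map
        (ExteriorAlgebra.ι 𝕜) := by
    rw [List.map_ofFn]
    rfl
  rw [hs, e]
  refine oddPartial_prod_eq_zero l _ fun m hm => ?_
  obtain ⟨i, rfl⟩ := List.mem_ofFn.1 hm
  rw [Pi.basisFun_apply, Pi.single_apply, if_neg]
  intro h
  exact hl (h ▸ (Set.powersetCard.mem_range_ofFinEmbEquiv_symm_iff_mem s _).1 (mem_range_self i))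

/-- The pairing of complementary monomials. -/
theorem exists_coeff_univ_mul (I : Finset (Fin q)) : ∃ ε : 𝕜, ε ≠ 0 ∧ ∀ a : Grassmann 𝕜 q,
    coeff Finset.univ (a * monomialBasis 𝕜 q Iᶜ) = ε * coeff I a := by
  -- Disjoint monomials multiply, up to the sign of a shuffle, to the monomial of the union.
  have hd : ∀ J : Finset (Fin q), Disjoint J Iᶜ → ∃ ε : 𝕜, ε ≠ 0 ∧
      monomialBasis 𝕜 q J * monomialBasis 𝕜 q Iᶜ = ε • monomialBasis 𝕜 q (J ∪ Iᶜ) := by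
    intro J h
    let s : Set.powersetCard (Fin q) J.card := ⟨J, rfl⟩
    let t : Set.powersetCard (Fin q) Iᶜ.card := ⟨Iᶜ, rfl⟩
    have hst : Disjoint s.val t.val := h
    have h1 := ExteriorAlgebra.basis_mul_of_disjoint (Pi.basisFun 𝕜 (Fin q)) s t hst
    refine ⟨((Equiv.Perm.sign (Set.powersetCard.permOfDisjoint hst) : ℤˣ) : ℤ), ?_, ?_⟩
    · rcases Int.units_eq_one_or (Equiv.Perm.sign (Set.powersetCard.permOfDisjoint hst)) with e | e <;>
        rw [e] <;> simp
    · rw [Int.cast_smul_eq_zsmul]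
      refine h1.trans ?_
      rw [Units.smul_def, Set.powersetCard.coe_disjUnion, Finset.disjUnion_eq_union]
      rfl
  -- If `J ≠ I`, then either `J` meets the complement of `I` and the product is zero, or it misses
  -- an element of `I` and the product is not of top degree.
  have hz : ∀ J : Finset (Fin q), J ≠ I →
      coeff Finset.univ (monomialBasis 𝕜 q J * monomialBasis 𝕜 q Iᶜ) = 0 := by
    intro J hJ
    by_cases h : Disjoint J Iᶜ
    · obtain ⟨ε, -, he⟩ := hd J h
      rw [he, map_smul, coeff_monomialBasis, if_neg, smul_zero]
      intro hu
      refine hJ (Finset.Subset.antisymm ?_ fun x hx => ?_)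
      · rwa [← le_compl_iff_disjoint_right, compl_compl] at h
      · have := Finset.mem_univ x
        rw [← hu, Finset.mem_union] at this
        exact this.resolve_right (by simpa using hx)
    · refine (congrArg _ (ExteriorAlgebra.basis_mul_of_not_disjoint (Pi.basisFun 𝕜 (Fin q))
        (⟨J, rfl⟩ : Set.powersetCard (Fin q) J.card)
        (⟨Iᶜ, rfl⟩ : Set.powersetCard (Fin q) Iᶜ.card) h)).trans (map_zero _)
  obtain ⟨ε, hε, he⟩ := hd I disjoint_compl_right
  refine ⟨ε, hε, fun a => ?_⟩
  have h := sum_coeff_mul ((coeff Finset.univ).comp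
    (LinearMap.mulRight 𝕜 (monomialBasis 𝕜 q Iᶜ))) a
  simp only [LinearMap.comp_apply, LinearMap.mulRight_apply] at h
  rw [h, Finset.sum_eq_single I (fun J _ hJ => by rw [hz J hJ, mul_zero]) (by simp), he, map_smul,
    coeff_monomialBasis, if_pos (by simp), smul_eq_mul, mul_one, mul_comm]

end Grassmann

namespace superFunctions

variable {𝕜 : Type} [RCLike 𝕜] {p q : ℕ} {V : Opens (EuclideanSpace ℝ (Fin p))}

variable (𝕜 q V) in
/-- The superfunctions with compact support. -/
def compact : Submodule 𝕜 (superFunctions 𝕜 p q V) where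
  carrier := {f | ∃ K : Set (EuclideanSpace ℝ (Fin p)), IsCompact K ∧ K ⊆ V ∧
    ∀ y : V, y.1 ∉ K → f.1 y = 0}
  zero_mem' := ⟨∅, isCompact_empty, empty_subset _, fun _ _ => rfl⟩
  add_mem' := by
    rintro f g ⟨K, hK, hKV, hf⟩ ⟨L, hL, hLV, hg⟩
    refine ⟨K ∪ L, hK.union hL, union_subset hKV hLV, fun y hy => ?_⟩
    rw [mem_union, not_or] at hy
    change f.1 y + g.1 y = 0
    rw [hf y hy.1, hg y hy.2, add_zero]
  smul_mem' := by
    rintro a f ⟨K, hK, hKV, hf⟩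
    refine ⟨K, hK, hKV, fun y hy => ?_⟩
    change a • f.1 y = 0
    rw [hf y hy, smul_zero]

theorem mul_mem_compact (g : superFunctions 𝕜 p q V) {f : superFunctions 𝕜 p q V}
    (hf : f ∈ compact 𝕜 q V) : g * f ∈ compact 𝕜 q V := by
  obtain ⟨K, hK, hKV, hf⟩ := hf
  refine ⟨K, hK, hKV, fun y hy => ?_⟩
  change g.1 y * f.1 y = 0
  rw [hf y hy, mul_zero]

/-- The Berezin integral, in coordinates. -/
def berezin (f : superFunctions 𝕜 p q V) : 𝕜 :=
  ∫ y, extendZero (fun y => Grassmann.coeff Finset.univ (f.1 y)) y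

theorem extendZero_of_notMem {g : V → 𝕜} {y : EuclideanSpace ℝ (Fin p)} (hy : y ∉ V) :
    extendZero g y = 0 := by
  refine Function.extend_apply' _ _ _ ?_
  rintro ⟨z, rfl⟩
  exact hy z.2

theorem exists_extendZero_eq_zero {f : superFunctions 𝕜 p q V} (hf : f ∈ compact 𝕜 q V) :
    ∃ K : Set (EuclideanSpace ℝ (Fin p)), IsCompact K ∧ K ⊆ V ∧
      ∀ I, ∀ y ∉ K, extendZero (fun y => Grassmann.coeff I (f.1 y)) y = 0 := by
  obtain ⟨K, hK, hKV, hf⟩ := hf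
  refine ⟨K, hK, hKV, fun I y hy => ?_⟩
  by_cases hyV : y ∈ V
  · refine (extendZero_apply (V := V) _ ⟨y, hyV⟩).trans ?_
    rw [hf ⟨y, hyV⟩ hy, map_zero]
  · exact extendZero_of_notMem hyV

theorem contDiff_extendZero {f : superFunctions 𝕜 p q V} (hf : f ∈ compact 𝕜 q V)
    (I : Finset (Fin q)) : ContDiff ℝ ∞ (extendZero fun y => Grassmann.coeff I (f.1 y)) := by
  obtain ⟨K, hK, hKV, h⟩ := exists_extendZero_eq_zero hf
  refine contDiff_iff_contDiffAt.2 fun y => ?_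
  by_cases hy : y ∈ V
  · exact (f.2 I).contDiffAt (V.isOpen.mem_nhds hy)
  · refine (contDiffAt_const (c := (0 : 𝕜))).congr_of_eventuallyEq ?_
    filter_upwards [hK.isClosed.isOpen_compl.mem_nhds fun hyK => hy (hKV hyK)] with z hz
    exact h I z hz

variable {u : EuclideanSpace ℝ (Fin p)} {r : ℝ}

theorem exists_closedCube (hr : 0 < r) {K : Set (EuclideanSpace ℝ (Fin p))} (hK : IsCompact K)
    (hKV : K ⊆ cube u r) : ∃ r' < r, ∀ x ∈ K, ∀ k, |x k - u k| ≤ r' := by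
  rcases K.eq_empty_or_nonempty with rfl | hne
  · exact ⟨0, hr, fun x hx => hx.elim⟩
  · have hc : Continuous fun x : EuclideanSpace ℝ (Fin p) =>
        dist (EuclideanSpace.equiv (Fin p) ℝ x) (EuclideanSpace.equiv (Fin p) ℝ u) :=
      (EuclideanSpace.equiv (Fin p) ℝ).continuous.dist continuous_const
    obtain ⟨x, hx, hmax⟩ := hK.exists_isMaxOn hne hc.continuousOn
    exact ⟨_, hKV hx, fun y hy k => (dist_le_pi_dist (EuclideanSpace.equiv (Fin p) ℝ y)
      (EuclideanSpace.equiv (Fin p) ℝ u) k).trans (hmax hy)⟩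

theorem isCubeTest_extendZero (hr : 0 < r) (hV : V = cube u r) {f : superFunctions 𝕜 p q V}
    (hf : f ∈ compact 𝕜 q V) (I : Finset (Fin q)) :
    IsCubeTest u r (extendZero fun y => Grassmann.coeff I (f.1 y)) := by
  obtain ⟨K, hK, hKV, h⟩ := exists_extendZero_eq_zero hf
  obtain ⟨r', hr', hr''⟩ := exists_closedCube hr hK (hV ▸ hKV)
  exact ⟨contDiff_extendZero hf I, r', hr', fun x hx => hr'' x (by_contra fun hxK => hx (h I x hxK))⟩

/-- For an even coordinate the top coefficient is a derivative of a test function; for an odd one it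
vanishes pointwise. -/
theorem berezin_coordPartial (hr : 0 < r) (hV : V = cube u r) (j : Fin p ⊕ Fin q)
    {f : superFunctions 𝕜 p q V} (hf : f ∈ compact 𝕜 q V) : berezin (coordPartial j f) = 0 := by
  rcases j with k | l
  · rw [← (isCubeTest_extendZero hr hV hf Finset.univ).integral_fderiv (EuclideanSpace.single k 1)]
    refine integral_congr_ae (Filter.Eventually.of_forall fun y => ?_)
    by_cases hy : y ∈ V
    · refine (extendZero_apply (V := V) _ ⟨y, hy⟩).trans ?_
      exact coeff_evenDeriv k f ⟨y, hy⟩ Finset.univ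
    · obtain ⟨K, hK, hKV, h⟩ := exists_extendZero_eq_zero hf
      have e : (extendZero fun y => Grassmann.coeff Finset.univ (f.1 y)) =ᶠ[nhds y] fun _ => 0 := by
        filter_upwards [hK.isClosed.isOpen_compl.mem_nhds fun hyK => hy (hKV hyK)] with z hz
        exact h _ z hz
      simp only [extendZero_of_notMem hy]
      rw [e.fderiv_eq]
      simp
  · rw [berezin]
    refine (integral_congr_ae (Filter.Eventually.of_forall fun y => ?_)).trans (integral_zero' _ _)
    by_cases hy : y ∈ V
    · refine (extendZero_apply (V := V) _ ⟨y, hy⟩).trans ?_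
      exact Grassmann.coeff_univ_oddPartial l (f.1 ⟨y, hy⟩)
    · exact extendZero_of_notMem hy

theorem scalarSuperfunction_mul_mem_compact (φ : EuclideanSpace ℝ (Fin p) → 𝕜)
    (hφ : ContDiffOn ℝ ∞ (extendZero fun y : V => φ y) V) {K : Set (EuclideanSpace ℝ (Fin p))}
    (hK : IsCompact K) (hKV : K ⊆ V) (h0 : ∀ y ∉ K, φ y = 0) (g : superFunctions 𝕜 p q V) :
    scalarSuperfunction q (fun y : V => φ y) hφ * g ∈ compact 𝕜 q V := by
  refine ⟨K, hK, hKV, fun y hy => ?_⟩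
  change algebraMap 𝕜 (Grassmann 𝕜 q) (φ y) * g.1 y = 0
  rw [h0 y hy, map_zero, zero_mul]

theorem contDiffOn_extendZero {φ : EuclideanSpace ℝ (Fin p) → 𝕜} (hφ : ContDiff ℝ ∞ φ) :
    ContDiffOn ℝ ∞ (extendZero fun y : V => φ y) V :=
  hφ.contDiffOn.congr fun y hy => extendZero_apply (V := V) _ ⟨y, hy⟩

/-- The Berezin integral vanishes only on sums of partial derivatives. -/
theorem mem_span_coordPartial (hr : 0 < r) (hV : V = cube u r) {f : superFunctions 𝕜 p q V}
    (hf : f ∈ compact 𝕜 q V) (h0 : berezin f = 0) :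
    f ∈ ⨆ j : Fin p ⊕ Fin q, (compact 𝕜 q V).map (coordPartial j) := by
  set T := ⨆ j : Fin p ⊕ Fin q, (compact 𝕜 q V).map (coordPartial (𝕜 := 𝕜) (V := V) j) with hT
  have hmem : ∀ j g, g ∈ compact 𝕜 q V → coordPartial j g ∈ T := fun j g hg =>
    Submodule.mem_iSup_of_mem j (Submodule.mem_map_of_mem hg)
  rw [sum_scalar_mul_const f]
  refine Submodule.sum_mem _ fun I _ => ?_
  by_cases hI : I = Finset.univ
  · subst hI
    -- The functions whose product with the top monomial is a sum of derivatives. It contains all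
    -- partial derivatives of test functions, hence every test function with integral zero.
    let S : Submodule 𝕜 (EuclideanSpace ℝ (Fin p) → 𝕜) :=
      { carrier := {φ | ∃ g ∈ T, ∀ y : V, g.1 y = φ y • Grassmann.monomialBasis 𝕜 q Finset.univ}
        zero_mem' := ⟨0, T.zero_mem, fun y => (zero_smul 𝕜 _).symm⟩
        add_mem' := by
          rintro φ ψ ⟨g, hg, hg'⟩ ⟨h, hh, hh'⟩
          refine ⟨g + h, T.add_mem hg hh, fun y => ?_⟩
          rw [Pi.add_apply, add_smul, ← hg', ← hh']
          rfl
        smul_mem' := by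
          rintro a φ ⟨g, hg, hg'⟩
          refine ⟨a • g, T.smul_mem a hg, fun y => ?_⟩
          rw [Pi.smul_apply, smul_assoc, ← hg']
          rfl }
    have hS : ∀ k φ, IsCubeTest u r φ →
        (fun x => fderiv ℝ φ x (EuclideanSpace.single k 1)) ∈ S := by
      intro k φ hφ
      obtain ⟨r', hr', hs⟩ := hφ.supp
      let g := scalarSuperfunction q (fun y : V => φ y) (contDiffOn_extendZero hφ.smooth) *
        const 𝕜 V (Grassmann.monomialBasis 𝕜 q Finset.univ)
      refine ⟨coordPartial (Sum.inl k) g, hmem _ _ (scalarSuperfunction_mul_mem_compact φ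
        (contDiffOn_extendZero hφ.smooth) (isCompact_closedCube u r') (fun x hx => ?_)
        (fun x hx => by_contra fun hne => hx (hs x hne)) _), fun y => ?_⟩
      · rw [hV]
        exact (mem_cube hr).2 fun k => (hx k).trans_lt hr'
      · exact evenDeriv_of_coeff_eq k g y φ (hφ.smooth.differentiable (by simp) y) _
          fun z => (Algebra.smul_def (φ z) (Grassmann.monomialBasis 𝕜 q Finset.univ)).symm
    obtain ⟨g, hg, hg'⟩ := (isCubeTest_extendZero hr hV hf Finset.univ).mem_of_integral_eq_zero
      hr S hS h0
    convert hg using 1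
    refine Subtype.ext (funext fun y => ?_)
    rw [hg', extendZero_apply, Algebra.smul_def]
    rfl
  · obtain ⟨l, hl⟩ : ∃ l, l ∉ I := by
      by_contra hcon
      push Not at hcon
      exact hI (Finset.eq_univ_iff_forall.2 hcon)
    obtain ⟨K, hK, hKV, h⟩ := hf
    have hc : scalarSuperfunction q (fun y => Grassmann.coeff I (f.1 y)) (f.2 I) *
        const 𝕜 V (Grassmann.monomialBasis 𝕜 q I) ∈ compact 𝕜 q V := by
      refine ⟨K, hK, hKV, fun y hy => ?_⟩
      change algebraMap 𝕜 (Grassmann 𝕜 q) (Grassmann.coeff I (f.1 y)) * _ = 0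
      rw [h y hy, map_zero, map_zero, zero_mul]
    -- A term that lacks `ξ_l` is itself a derivative, `f_I ξ_I = ∂_l (ξ_l f_I ξ_I)`, since `∂_l`
    -- kills `f_I ξ_I`.
    convert hmem (Sum.inr l) _ (mul_mem_compact (coordFn 𝕜 V (Sum.inr l)) hc) using 1
    rw [coordPartial_mul, coordPartial_coordFn, if_pos rfl, one_mul]
    refine (add_eq_left.2 ?_).symm
    have e : coordPartial (Sum.inr l) (scalarSuperfunction q (fun y => Grassmann.coeff I (f.1 y))
        (f.2 I) * const 𝕜 V (Grassmann.monomialBasis 𝕜 q I)) = 0 := by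
      refine Subtype.ext (funext fun y => ?_)
      change Grassmann.oddPartial l (algebraMap 𝕜 (Grassmann 𝕜 q) (Grassmann.coeff I (f.1 y)) *
        Grassmann.monomialBasis 𝕜 q I) = 0
      rw [← Algebra.smul_def, map_smul, Grassmann.oddPartial_monomialBasis hl, smul_zero]
    rw [e, mul_zero]

/-- The Berezin integral is non-degenerate. -/
theorem eq_zero_of_berezin_mul_eq_zero (g : superFunctions 𝕜 p q V)
    (h : ∀ f ∈ compact 𝕜 q V, berezin (g * f) = 0) : g = 0 := by
  refine Subtype.ext (funext fun y => Grassmann.ext_coeff fun I => ?_)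
  obtain ⟨ε, hε, he⟩ := Grassmann.exists_coeff_univ_mul (𝕜 := 𝕜) I
  have hc := (g.2 I).continuousOn
  have hae := V.isOpen.ae_eq_zero_of_integral_contDiff_smul_eq_zero (μ := volume)
    (hc.locallyIntegrableOn V.isOpen.measurableSet) fun φ hφ hφc hφV => by
      have hφ' : ContDiff ℝ ∞ fun x => ((φ x : ℝ) : 𝕜) :=
        (RCLike.ofRealCLM (K := 𝕜)).contDiff.comp hφ
      -- Testing with `φ` times the complementary monomial isolates the coefficient of `ξ_I` up to
      -- the factor `ε`; the fundamental lemma of the calculus of variations applies to it.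
      have h1 := h _ (scalarSuperfunction_mul_mem_compact (fun x => ((φ x : ℝ) : 𝕜))
        (contDiffOn_extendZero hφ') hφc hφV
        (fun x hx => by rw [image_eq_zero_of_notMem_tsupport hx, RCLike.ofReal_zero])
        (const 𝕜 V (Grassmann.monomialBasis 𝕜 q Iᶜ)))
      refine (mul_eq_zero.1 ((integral_const_mul ε _).symm.trans (Eq.trans ?_ h1))).resolve_left hε
      refine integral_congr_ae (Filter.Eventually.of_forall fun y => ?_)
      by_cases hy : y ∈ V
      · have e : ∀ g : V → 𝕜, extendZero g y = g ⟨y, hy⟩ := fun g => extendZero_apply g ⟨y, hy⟩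
        simp only [e]
        change _ = Grassmann.coeff Finset.univ (g.1 ⟨y, hy⟩ *
          (algebraMap 𝕜 (Grassmann 𝕜 q) ((φ y : ℝ) : 𝕜) * Grassmann.monomialBasis 𝕜 q Iᶜ))
        rw [← Algebra.smul_def, mul_smul_comm ((φ y : ℝ) : 𝕜), map_smul, he, RCLike.real_smul_eq_coe_mul,
          smul_eq_mul]
        ring
      · simp only [extendZero_of_notMem hy, smul_zero, mul_zero]
  have h2 : EqOn (extendZero fun y => Grassmann.coeff I (g.1 y)) (fun _ => 0) V :=
    Measure.eqOn_open_of_ae_eq ((ae_restrict_iff' V.isOpen.measurableSet).2 hae) V.isOpen hc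
      continuousOn_const
  have h3 := h2 y.2
  rw [extendZero_apply] at h3
  exact h3.trans (map_zero (Grassmann.coeff I)).symm

end superFunctions

/-- A functional on the compactly supported superfunctions that is annihilated by a frame of
superderivations is determined up to a factor. -/
theorem superFunctions.exists_eq_mul_of_frame {𝕜 : Type} [RCLike 𝕜] {p q : ℕ}
    {V : Opens (EuclideanSpace ℝ (Fin p))} {u : EuclideanSpace ℝ (Fin p)} {r : ℝ} (hr : 0 < r)
    (hV : V = cube u r) {ι : Type} [Fintype ι] (d : ι → ZMod 2)
    (D : ι → superFunctions 𝕜 p q V →ₗ[𝕜] superFunctions 𝕜 p q V)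
    (hD : ∀ j f g, D j (f * g) = D j f * g + parityPow (d j) f * D j g)
    (a : Fin p ⊕ Fin q → ι → superFunctions 𝕜 p q V)
    (ha : ∀ k f, coordPartial k f = ∑ j, a k j * D j f)
    (hc : ∀ j, ∀ f ∈ compact 𝕜 q V, D j f ∈ compact 𝕜 q V)
    {h : superFunctions 𝕜 p q V} (hh : IsUnit h) (l₀ l : superFunctions 𝕜 p q V →ₗ[𝕜] 𝕜)
    (hl₀ : ∀ f ∈ compact 𝕜 q V, l₀ f = berezin (h * f))
    (hD₀ : ∀ j, ∀ f ∈ compact 𝕜 q V, l₀ (D j f) = 0)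
    (hD₁ : ∀ j, ∀ f ∈ compact 𝕜 q V, l (D j f) = 0) :
    ∃ c : 𝕜, ∀ f ∈ compact 𝕜 q V, l f = c * l₀ f := by
  obtain ⟨⟨h, g, hg, hg'⟩, rfl⟩ := hh
  simp only at hl₀
  -- The zeroth-order term that arises when the frame fields are integrated by parts; no functional
  -- enters its definition.
  let b : Fin p ⊕ Fin q → superFunctions 𝕜 p q V := fun k =>
    ∑ j, D j (parityPow (d j) (g * a k j))
  have e2 : ∀ i : ZMod 2, i + i = 0 := by decide
  have key : ∀ (L : superFunctions 𝕜 p q V →ₗ[𝕜] 𝕜)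
      (hL : ∀ j, ∀ f ∈ compact 𝕜 q V, L (D j f) = 0) (k), ∀ f ∈ compact 𝕜 q V,
      L (g * coordPartial k f) = -L (b k * f) := by
    intro L hL k f hf
    -- `∂_k` is expanded in the frame and each coefficient is moved inside `D j` by the Leibniz
    -- rule; the parity twist inserted beforehand cancels the one from that rule.
    have e : g * coordPartial k f =
        (∑ j, D j (parityPow (d j) (g * a k j) * f)) - b k * f := by
      rw [ha, Finset.mul_sum, Finset.sum_mul, ← Finset.sum_sub_distrib]
      refine Finset.sum_congr rfl fun j _ => ?_
      rw [hD, parityPow_parityPow, e2, parityPow_zero, add_sub_cancel_left, mul_assoc]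
    rw [e, map_sub, map_sum, Finset.sum_eq_zero fun j _ => hL j _ (mul_mem_compact _ hf), zero_sub]
  have hb : ∀ k, b k = 0 := by
    intro k
    -- For `l₀` the factor `g` cancels `h`, and the Berezin integral of a derivative vanishes. So `h
    -- * b k` pairs to zero with every test function.
    have h1 : h * b k = 0 := by
      refine eq_zero_of_berezin_mul_eq_zero _ fun f hf => ?_
      have h2 := key l₀ hD₀ k f hf
      have hp : coordPartial k f ∈ compact 𝕜 q V := by
        rw [ha]
        exact Submodule.sum_mem _ fun j _ => mul_mem_compact _ (hc j f hf)
      rw [hl₀ _ (mul_mem_compact _ hp), hl₀ _ (mul_mem_compact _ hf), ← mul_assoc, hg, one_mul,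
        berezin_coordPartial hr hV k hf] at h2
      rw [mul_assoc, ← neg_eq_zero, ← h2]
    rw [← one_mul (b k), ← hg', mul_assoc, h1, mul_zero]
  have hker : ∀ f ∈ compact 𝕜 q V, l₀ f = 0 → l f = 0 := by
    intro f hf h0
    -- `h * f` is a sum of derivatives, and multiplication by `g` recovers `f`; with `b = 0` the
    -- functional `l` kills each `g * coordPartial k f`.
    have h1 := mem_span_coordPartial hr hV (mul_mem_compact h hf) ((hl₀ f hf).symm.trans h0)
    have h2 : (⨆ j : Fin p ⊕ Fin q, (compact 𝕜 q V).map (coordPartial (𝕜 := 𝕜) (V := V) j)) ≤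
        LinearMap.ker (l.comp (LinearMap.mulLeft 𝕜 g)) := by
      refine iSup_le fun k => Submodule.map_le_iff_le_comap.2 fun f hf => ?_
      change l (g * coordPartial k f) = 0
      rw [key l hD₁ k f hf, hb, zero_mul, map_zero, neg_zero]
    have h3 : l (g * (h * f)) = 0 := h2 h1
    rwa [← mul_assoc, hg', one_mul] at h3
  -- The factor is the quotient of the values on any superfunction not killed by `l₀`; if there is
  -- none, both functionals vanish on compact supports.
  by_cases hex : ∃ f ∈ compact 𝕜 q V, l₀ f ≠ 0
  · obtain ⟨f₀, hf₀, hne⟩ := hex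
    refine ⟨l f₀ / l₀ f₀, fun f hf => ?_⟩
    have h1 := hker (f - (l₀ f / l₀ f₀) • f₀) (Submodule.sub_mem _ hf (Submodule.smul_mem _ _ hf₀))
      (by rw [map_sub, map_smul, smul_eq_mul, div_mul_cancel₀ _ hne, sub_self])
    rw [map_sub, map_smul, smul_eq_mul, sub_eq_zero] at h1
    rw [h1]
    ring
  · push Not at hex
    exact ⟨0, fun f hf => by rw [hker f hf (hex f hf), zero_mul]⟩

/-! ### Supports and gluing of global sections -/

namespace SuperSpace

variable {𝕜 : Type} [RCLike 𝕜] {X : SuperSpace 𝕜}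

theorem eq_of_locally_eq {s t : X.sec ⊤}
    (h : ∀ x, ∃ U : Opens X.carrier, x ∈ U ∧ X.res (le_top : U ≤ ⊤) s = X.res le_top t) :
    s = t := by
  choose U hU hst using h
  have e : (⊤ : Opens X.carrier) ≤ ⨆ x, U x := fun x _ => Opens.mem_iSup.2 ⟨x, hU x⟩
  have h1 := X.sheaf_ext U (X.res le_top s) (X.res le_top t) fun x => by
    rw [X.res_res, X.res_res, hst]
  have h2 := congrArg (X.res e) h1
  rwa [X.res_res, X.res_res, X.res_refl, X.res_refl] at h2

theorem notMem_supp {s : X.sec ⊤} {x : X.carrier} :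
    x ∉ X.supp s ↔ ∃ U : Opens X.carrier, x ∈ U ∧ X.res (le_top : U ≤ ⊤) s = 0 := by
  simp only [supp, mem_ofPred_eq, not_forall, not_not, exists_prop]

theorem supp_subset_of_res_eq_zero {s : X.sec ⊤} {U : Opens X.carrier}
    (h : X.res (le_top : U ≤ ⊤) s = 0) : X.supp s ⊆ (U : Set X.carrier)ᶜ :=
  fun _ hx hU => hx U hU h

theorem eq_of_res_eq {s t : X.sec ⊤} {W : Opens X.carrier} (hs : X.supp s ⊆ W)
    (ht : X.supp t ⊆ W) (h : X.res (le_top : W ≤ ⊤) s = X.res le_top t) : s = t := by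
  refine eq_of_locally_eq fun x => ?_
  by_cases hx : x ∈ W
  · exact ⟨W, hx, h⟩
  · obtain ⟨U, hU, hsU⟩ := notMem_supp.1 fun h => hx (hs h)
    obtain ⟨U', hU', htU⟩ := notMem_supp.1 fun h => hx (ht h)
    refine ⟨U ⊓ U', ⟨hU, hU'⟩, ?_⟩
    rw [← X.res_res inf_le_left (le_top : U ≤ ⊤), ← X.res_res inf_le_right (le_top : U' ≤ ⊤), hsU,
      htU, map_zero, map_zero]

/-- The section over `W` is glued with zero on the complement of `C`; on the overlap both vanish by
`h`. -/
theorem exists_extension (W : Opens X.carrier) (t : X.sec W) {C : Set X.carrier} (hC : IsClosed C)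
    (hCW : C ⊆ W) (h : X.res (inf_le_left : W ⊓ ⟨Cᶜ, hC.isOpen_compl⟩ ≤ W) t = 0) :
    ∃ s : X.sec ⊤, X.res le_top s = t ∧ X.supp s ⊆ C := by
  let U : Bool → Opens X.carrier := fun b => cond b W ⟨Cᶜ, hC.isOpen_compl⟩
  let s : ∀ b, X.sec (U b) := fun b => match b with
    | true => t
    | false => 0
  have e : (⊤ : Opens X.carrier) ≤ ⨆ b, U b := fun x _ => Opens.mem_iSup.2 <| by
    by_cases hx : x ∈ C
    · exact ⟨true, hCW hx⟩
    · exact ⟨false, hx⟩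
  have h' : X.res (inf_le_right : (⟨Cᶜ, hC.isOpen_compl⟩ ⊓ W : Opens X.carrier) ≤ W) t = 0 := by
    rw [← X.res_res (le_of_eq (inf_comm _ _)) (inf_le_left : W ⊓ ⟨Cᶜ, hC.isOpen_compl⟩ ≤ W), h, map_zero]
  obtain ⟨f, hf⟩ := X.sheaf_glue U s fun i j => by
    rcases i with _ | _ <;> rcases j with _ | _
    · exact (map_zero _).trans (map_zero _).symm
    · exact (map_zero _).trans h'.symm
    · exact h.trans (map_zero _).symm
    · rfl
  refine ⟨X.res e f, ?_, ?_⟩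
  · rw [X.res_res]
    exact hf true
  · have h0 : X.res (le_top : U false ≤ ⊤) (X.res e f) = 0 := by
      rw [X.res_res]
      exact hf false
    exact (supp_subset_of_res_eq_zero h0).trans (compl_compl C).le

variable (X) in
/-- The compactly supported sections with support in an open set. -/
def compactSectionsIn (W : Opens X.carrier) : Submodule 𝕜 X.compactSections where
  carrier := {φ | X.supp φ.1 ⊆ W}
  zero_mem' := fun x hx => (hx ⊤ trivial (map_zero _)).elim
  add_mem' := by
    intro φ ψ hφ hψ x hx
    by_contra hxW
    obtain ⟨U, hU, hsU⟩ := notMem_supp.1 fun h => hxW (hφ h)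
    obtain ⟨U', hU', htU⟩ := notMem_supp.1 fun h => hxW (hψ h)
    refine hx (U ⊓ U') ⟨hU, hU'⟩ ?_
    change X.res _ (φ.1 + ψ.1) = 0
    rw [map_add, ← X.res_res inf_le_left (le_top : U ≤ ⊤),
      ← X.res_res inf_le_right (le_top : U' ≤ ⊤), hsU, htU, map_zero, map_zero, add_zero]
  smul_mem' := by
    intro a φ hφ x hx
    refine hφ fun U hU h0 => hx U hU ?_
    change X.res _ (a • φ.1) = 0
    rw [map_smul, h0, smul_zero]

end SuperSpace

/-! ### Compactly supported sections in coordinates -/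

namespace SuperChart

variable {𝕜 : Type} [RCLike 𝕜] {X : SuperSpace 𝕜} {p q : ℕ}

theorem coord_eq_zero (c : SuperChart X p q) (W : Opens X.carrier) (hW : W ≤ c.dom) (φ : X.sec ⊤)
    (y : c.img W) (hy : c.base.symm y ∉ X.supp φ) :
    (c.coord W hW (X.res le_top φ)).1 y = 0 := by
  obtain ⟨U, hU, h0⟩ := SuperSpace.notMem_supp.1 hy
  have h1 := c.coord_res hW (inf_le_left : W ⊓ U ≤ W) (X.res le_top φ) ⟨y, y.2.1, y.2.2, hU⟩
  rw [X.res_res, ← X.res_res inf_le_right (le_top : U ≤ ⊤), h0, map_zero, map_zero] at h1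
  exact h1.symm

theorem coord_mem_compact (c : SuperChart X p q) (W : Opens X.carrier) (hW : W ≤ c.dom)
    {φ : X.sec ⊤} (hc : IsCompact (X.supp φ)) (hφ : X.supp φ ⊆ W) :
    c.coord W hW (X.res le_top φ) ∈ compact 𝕜 q (c.img W) := by
  refine ⟨c.base '' X.supp φ, hc.image_of_continuousOn (c.base.continuousOn.mono (hφ.trans hW)),
    ?_, fun y hy => ?_⟩
  · rintro _ ⟨x, hx, rfl⟩
    exact base_mem_img (hW (hφ hx)) (hφ hx)
  · exact c.coord_eq_zero W hW φ y fun hx => hy ⟨_, hx, c.base.right_inv y.2.1⟩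

/-- The coordinate expressions of compactly supported sections. -/
def compactCoord (c : SuperChart X p q) (W : Opens X.carrier) (hW : W ≤ c.dom) :
    X.compactSectionsIn W →ₗ[𝕜] compact 𝕜 q (c.img W) where
  toFun φ := ⟨c.coord W hW (X.res le_top φ.1.1), c.coord_mem_compact W hW φ.1.2 φ.2⟩
  map_add' φ ψ := Subtype.ext (by
    change c.coord W hW (X.res le_top (φ.1.1 + ψ.1.1)) = _
    rw [map_add, map_add]
    rfl)
  map_smul' a φ := Subtype.ext (by
    change c.coord W hW (X.res le_top (a • φ.1.1)) = _
    rw [map_smul, map_smul]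
    rfl)

/-- Surjectivity is extension by zero. The compact set of the chart has a compact image in the
space, and the Hausdorff property makes that image closed, so that its complement is available for
gluing. -/
theorem compactCoord_bijective [T2Space X.carrier] (c : SuperChart X p q) (W : Opens X.carrier)
    (hW : W ≤ c.dom) : Function.Bijective (c.compactCoord W hW) := by
  refine ⟨fun φ ψ h => ?_, fun ⟨f, hf⟩ => ?_⟩
  · refine Subtype.ext (Subtype.ext (SuperSpace.eq_of_res_eq φ.2 ψ.2 ?_))
    exact (c.coord W hW).injective (congrArg Subtype.val h)
  · obtain ⟨K, hK, hKV, h0⟩ := hf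
    have hC : IsCompact (c.base.symm '' K) := hK.image_of_continuousOn
      (c.base.symm.continuousOn.mono fun y hy => (hKV hy).1)
    have hCW : c.base.symm '' K ⊆ W := by
      rintro _ ⟨y, hy, rfl⟩
      exact (hKV hy).2
    obtain ⟨s, hs, hsC⟩ := SuperSpace.exists_extension W ((c.coord W hW).symm f) hC.isClosed hCW (by
      refine (c.coord _ (inf_le_left.trans hW)).injective (Subtype.ext (funext fun y => ?_))
      rw [c.coord_res hW inf_le_left, AlgEquiv.apply_symm_apply, map_zero]
      exact h0 _ fun hy => y.2.2.2 ⟨_, hy, rfl⟩)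
    refine ⟨⟨⟨s, hC.of_isClosed_subset (X.isClosed_supp s) hsC⟩, hsC.trans hCW⟩, Subtype.ext ?_⟩
    change c.coord W hW (X.res le_top s) = f
    rw [hs, AlgEquiv.apply_symm_apply]

/-- A functional on compactly supported sections in coordinates. -/
theorem exists_functional [T2Space X.carrier] (c : SuperChart X p q) (W : Opens X.carrier)
    (hW : W ≤ c.dom) (l : X.compactSections →ₗ[𝕜] 𝕜) :
    ∃ l' : superFunctions 𝕜 p q (c.img W) →ₗ[𝕜] 𝕜, ∀ φ : X.compactSections,
      X.supp φ.1 ⊆ W → l φ = l' (c.coord W hW (X.res le_top φ.1)) := by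
  let e := LinearEquiv.ofBijective (c.compactCoord W hW) (c.compactCoord_bijective W hW)
  -- An arbitrary linear extension; only its values on compactly supported superfunctions matter.
  obtain ⟨l', hl'⟩ := LinearMap.exists_extend
    ((l ∘ₗ (X.compactSectionsIn W).subtype) ∘ₗ e.symm.toLinearMap)
  refine ⟨l', fun φ hφ => ?_⟩
  have h := LinearMap.congr_fun hl' (e ⟨φ, hφ⟩)
  simp only [LinearMap.comp_apply, LinearEquiv.coe_coe, LinearEquiv.symm_apply_apply] at h
  exact h.symm

theorem exists_section [T2Space X.carrier] (c : SuperChart X p q) (W : Opens X.carrier)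
    (hW : W ≤ c.dom) {f : superFunctions 𝕜 p q (c.img W)} (hf : f ∈ compact 𝕜 q (c.img W)) :
    ∃ φ : X.compactSections, X.supp φ.1 ⊆ W ∧ c.coord W hW (X.res le_top φ.1) = f := by
  obtain ⟨φ, hφ⟩ := (c.compactCoord_bijective W hW).2 ⟨f, hf⟩
  exact ⟨φ.1, φ.2, congrArg Subtype.val hφ⟩

end SuperChart

theorem SuperSpace.SheafDerivation.supp_subset {𝕜 : Type} [RCLike 𝕜] {X : SuperSpace 𝕜}
    {i : ZMod 2} (D : X.SheafDerivation i) (φ : X.sec ⊤) :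
    X.supp (D.toFun ⊤ φ) ⊆ X.supp φ := fun x hx U hU h0 => hx U hU (by
  rw [← D.map_res, h0, map_zero])

/-! ### Localization of functionals by bump functions -/

namespace SuperSpace

variable {𝕜 : Type} [RCLike 𝕜] {X Y : SuperSpace 𝕜}

theorem supp_gpull_subset (f : Hom X Y) (φ : Y.sec ⊤) :
    X.supp (f.gpull φ) ⊆ f.base ⁻¹' Y.supp φ := by
  intro x hx
  by_contra hn
  obtain ⟨U, hU, h0⟩ := notMem_supp.1 hn
  refine hx ⟨f.base ⁻¹' U, U.isOpen.preimage f.continuous_base⟩ hU ?_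
  refine (f.pull_res ⊤ ⊤ (fun _ _ => trivial) _ U (fun _ hx => hx) le_top le_top φ).symm.trans ?_
  rw [h0, map_zero]

theorem res_gpull_eq_one (f : Hom X Y) {φ : Y.sec ⊤} {U : Opens Y.carrier}
    (h : Y.res (le_top : U ≤ ⊤) φ = 1) :
    X.res (le_top : ⟨f.base ⁻¹' U, U.isOpen.preimage f.continuous_base⟩ ≤ ⊤) (f.gpull φ) = 1 := by
  refine (f.pull_res ⊤ ⊤ (fun _ _ => trivial) _ U (fun _ hx => hx) le_top le_top φ).symm.trans ?_
  rw [h, map_one]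

theorem supp_mul_subset_left (φ ψ : X.sec ⊤) : X.supp (φ * ψ) ⊆ X.supp φ := fun x hx U hU h0 =>
  hx U hU (by rw [map_mul, h0, zero_mul])

theorem supp_mul_subset_right (φ ψ : X.sec ⊤) : X.supp (φ * ψ) ⊆ X.supp ψ := fun x hx U hU h0 =>
  hx U hU (by rw [map_mul, h0, mul_zero])

/-- A functional on compactly supported sections that vanishes locally is zero. -/
theorem eq_zero_of_locally_eq_zero (l : X.compactSections →ₗ[𝕜] 𝕜)
    (h : ∀ x, ∃ (U : Opens X.carrier) (χ : X.sec ⊤), x ∈ U ∧ X.res (le_top : U ≤ ⊤) χ = 1 ∧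
      ∀ φ : X.compactSections, X.supp φ.1 ⊆ X.supp χ → l φ = 0) : l = 0 := by
  classical
  choose U χ hU hχ hl using h
  -- This replaces a partition of unity. In `φ = φ χ + φ (1 - χ)` the first part is killed, and the
  -- support of the second avoids the set where `χ = 1`, so one set of the cover can be dropped.
  have key : ∀ (s : Finset X.carrier) (φ : X.compactSections),
      X.supp φ.1 ⊆ ⋃ x ∈ s, (U x : Set X.carrier) → l φ = 0 := by
    intro s
    induction s using Finset.induction_on with
    | empty =>
      intro φ hφ
      have e : φ = 0 := Subtype.ext <| eq_of_locally_eq fun x => by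
        obtain ⟨V, hV, h0⟩ := notMem_supp.1 fun hx : x ∈ X.supp φ.1 => by simpa using hφ hx
        exact ⟨V, hV, h0.trans (map_zero _).symm⟩
      rw [e, map_zero]
    | insert x s hx ih =>
      intro φ hφ
      have hc : ∀ ψ : X.sec ⊤, IsCompact (X.supp (φ.1 * ψ)) := fun ψ =>
        IsCompact.of_isClosed_subset φ.2 (X.isClosed_supp _) (supp_mul_subset_left _ _)
      have e : φ = ⟨φ.1 * χ x, hc _⟩ + ⟨φ.1 * (1 - χ x), hc _⟩ := Subtype.ext <| by
        change φ.1 = φ.1 * χ x + φ.1 * (1 - χ x)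
        rw [← mul_add, add_sub_cancel, mul_one]
      rw [e, map_add, hl x _ (supp_mul_subset_right _ _), zero_add]
      refine ih _ fun y hy => ?_
      have h1 := hφ (supp_mul_subset_left _ _ hy)
      rw [Finset.set_biUnion_insert] at h1
      refine h1.resolve_left fun hyU => hy (U x) hyU ?_
      change X.res _ (φ.1 * (1 - χ x)) = 0
      rw [map_mul, map_sub, hχ, map_one, sub_self, mul_zero]
  refine LinearMap.ext fun φ => ?_
  obtain ⟨s, -, hs⟩ := IsCompact.elim_nhds_subcover φ.2 (fun x => (U x : Set X.carrier))
    fun x _ => (U x).isOpen.mem_nhds (hU x)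
  exact key s φ hs

/-- A bump function in a chart. -/
theorem _root_.SuperChart.exists_bump [T2Space X.carrier] {p q : ℕ} (c : SuperChart X p q)
    (W : Opens X.carrier) (hW : W ≤ c.dom) {x : X.carrier} (hx : x ∈ W) :
    ∃ (U : Opens X.carrier) (χ : X.sec ⊤), x ∈ U ∧ X.res (le_top : U ≤ ⊤) χ = 1 ∧
      X.supp χ ⊆ W := by
  have hu : c.base x ∈ c.img W := SuperChart.base_mem_img (hW hx) hx
  obtain ⟨ε, hε, hball⟩ := Metric.isOpen_iff.1 (c.img W).isOpen _ hu
  let b : ContDiffBump (c.base x) := ⟨ε / 4, ε / 2, by linarith, by linarith⟩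
  have hb : ContDiff ℝ ∞ fun y => ((b y : ℝ) : 𝕜) :=
    (RCLike.ofRealCLM (K := 𝕜)).contDiff.comp b.contDiff
  have hbs : Metric.closedBall (c.base x) (ε / 2) ⊆ c.img W :=
    (Metric.closedBall_subset_ball (by linarith)).trans hball
  obtain ⟨χ, hχ, hχ'⟩ := c.exists_section W hW (scalarSuperfunction_mul_mem_compact (q := q)
    (fun y => ((b y : ℝ) : 𝕜)) (contDiffOn_extendZero hb) (isCompact_closedBall _ _) hbs
    (fun y hy => by
      rw [b.zero_of_le_dist (by simpa using (not_le.1 hy).le), RCLike.ofReal_zero]) 1)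
  let U : Opens X.carrier := W ⊓ ⟨c.base.source ∩ c.base ⁻¹' Metric.ball (c.base x) (ε / 4),
    c.base.isOpen_inter_preimage Metric.isOpen_ball⟩
  refine ⟨U, χ.1, ⟨hx, hW hx, Metric.mem_ball_self (by linarith)⟩, ?_, hχ⟩
  refine (c.coord U (inf_le_left.trans hW)).injective (Subtype.ext (funext fun y => ?_))
  rw [map_one, ← X.res_res (inf_le_left : U ≤ W) le_top, c.coord_res hW inf_le_left, hχ', mul_one]
  have hy : y.1 ∈ Metric.ball (c.base x) (ε / 4) := by
    have h := y.2.2.2.2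
    rwa [mem_preimage, c.base.right_inv y.2.1] at h
  change algebraMap 𝕜 (Grassmann 𝕜 q) ((b y : ℝ) : 𝕜) = 1
  rw [b.one_of_mem_closedBall (Metric.ball_subset_closedBall hy), RCLike.ofReal_one, map_one]

end SuperSpace

/-! ### Berezin integrals over open subsets of a chart -/

theorem extendZero_eq_of_le {𝕜 : Type} [RCLike 𝕜] {p : ℕ} {V V' : Opens (EuclideanSpace ℝ (Fin p))}
    (h : V ≤ V') {g : V' → 𝕜} {g' : V → 𝕜} (hg : ∀ y : V, g ⟨y, h y.2⟩ = g' y)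
    (h0 : ∀ y : V', y.1 ∉ V → g y = 0) : extendZero g = extendZero g' := by
  funext y
  by_cases hy : y ∈ V
  · exact (extendZero_apply g ⟨y, h hy⟩).trans
      ((hg ⟨y, hy⟩).trans (extendZero_apply g' ⟨y, hy⟩).symm)
  · rw [extendZero_of_notMem hy]
    by_cases hy' : y ∈ V'
    · exact (extendZero_apply g ⟨y, hy'⟩).trans (h0 ⟨y, hy'⟩ hy)
    · exact extendZero_of_notMem hy'

/-- The coefficient of a Berezinian density over an open subset of the domain of a chart. -/
def BerezinianDensity.coeffOn {𝕜 : Type} [RCLike 𝕜] {X : SuperSpace 𝕜} (w : BerezinianDensity X)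
    {p q : ℕ} (c : SuperChart X p q) (W : Opens X.carrier) (hW : W ≤ c.dom) :
    superFunctions 𝕜 p q (c.img W) :=
  (affineSuperspace 𝕜 p q).res (c.img_mono hW) (w.coeff c)

theorem BerezinianDensity.IsBerezinIntegral.eq_berezin {𝕜 : Type} [RCLike 𝕜] {X : SuperSpace 𝕜}
    {w : BerezinianDensity X} {l : X.compactSections →ₗ[𝕜] 𝕜} (hl : w.IsBerezinIntegral l) {p q : ℕ}
    (c : SuperChart X p q) (W : Opens X.carrier) (hW : W ≤ c.dom) (φ : X.compactSections)
    (hφ : X.supp φ.1 ⊆ W) :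
    l φ = berezin (w.coeffOn c W hW * c.coord W hW (X.res le_top φ.1)) := by
  refine (hl c φ (hφ.trans hW)).trans (congrArg (fun g => ∫ y, g y)
    (extendZero_eq_of_le (c.img_mono hW) (fun y => ?_) fun y hy => ?_))
  · have h1 := c.coord_res le_rfl hW (X.res le_top φ.1) y
    rw [X.res_res] at h1
    exact congrArg (fun z => Grassmann.coeff Finset.univ
      ((w.coeff c).1 ⟨y, c.img_mono hW y.2⟩ * z)) h1.symm
  · have h1 := c.coord_eq_zero c.dom le_rfl φ.1 y fun hs => hy ⟨y.2.1, hφ hs⟩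
    refine (congrArg (fun z => Grassmann.coeff Finset.univ ((w.coeff c).1 y * z)) h1).trans ?_
    simp only [mul_zero, map_zero]

/-! ### Invariant superdistributions near the neutral element and their translates -/

namespace LieSupergroup

variable {𝕜 : Type} [RCLike 𝕜] (G : LieSupergroup 𝕜)

/-- Invariant superdistributions are multiples of the invariant Berezinian density near the neutral
element. -/
theorem exists_eq_mul_near_unit {Dg μ : G.Superdistribution} (hDg : Dg.IsInvariantBerezinian)
    (hμ : μ.IsInvariant) : ∃ (p q : ℕ) (c : SuperChart G.space.toSuperSpace p q)
      (W : Opens G.space.carrier), W ≤ c.dom ∧ G.unit ∈ W ∧ ∃ a : 𝕜,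
      ∀ φ : G.space.compactSections, G.space.supp φ.1 ⊆ W →
        μ.toLinearMap φ = a * Dg.toLinearMap φ := by
  have := G.t2Space
  obtain ⟨hinv, w, hw, hI⟩ := hDg
  obtain ⟨p, q, c, r, W, hW, hr, hx, himg, D, a, hD, ha⟩ := G.exists_frame
  -- A superfunction with nowhere vanishing body is invertible; this is where `|Dg|` being nowhere
  -- zero enters.
  have hh : IsUnit (w.coeffOn c W hW) := isUnit_of_body _ fun y => hw c ⟨y, c.img_mono hW y.2⟩
  have hsec : ∀ j, ∀ f ∈ compact 𝕜 q (c.img W), ∃ φ ψ : G.space.compactSections,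
      G.space.supp ψ.1 ⊆ W ∧ ψ.1 = (D j).toFun ⊤ φ.1 ∧
        c.coord W hW (G.space.res le_top ψ.1) = c.localDerivation W hW (D j) f := by
    intro j f hf
    obtain ⟨φ, hφ, rfl⟩ := c.exists_section W hW hf
    refine ⟨φ, ⟨(D j).toFun ⊤ φ.1, IsCompact.of_isClosed_subset φ.2 (G.space.isClosed_supp _)
      ((D j).supp_subset _)⟩, ((D j).supp_subset _).trans hφ, rfl, ?_⟩
    rw [SuperChart.localDerivation_apply, AlgEquiv.symm_apply_apply, (D j).map_res]
  -- Infinitesimal invariance concerns global vector fields, but a superderivation does not enlarge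
  -- supports, so it can be tested on sections supported in `W`.
  have hkill : ∀ (ν : G.Superdistribution) (_ : ν.IsInvariant)
      (l : superFunctions 𝕜 p q (c.img W) →ₗ[𝕜] 𝕜) (_ : ∀ φ : G.space.compactSections,
        G.space.supp φ.1 ⊆ W → ν.toLinearMap φ = l (c.coord W hW (G.space.res le_top φ.1)))
      (j), ∀ f ∈ compact 𝕜 q (c.img W), l (c.localDerivation W hW (D j) f) = 0 := by
    intro ν hν l hl j f hf
    obtain ⟨φ, ψ, hψ, hφψ, e⟩ := hsec j f hf
    rw [← e, ← hl ψ hψ]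
    exact hν.infinitesimal _ _ (hD j) φ ψ hφψ
  obtain ⟨l₀, hl₀⟩ := c.exists_functional W hW Dg.toLinearMap
  obtain ⟨l, hl⟩ := c.exists_functional W hW μ.toLinearMap
  have hber : ∀ f ∈ compact 𝕜 q (c.img W), l₀ f = berezin (w.coeffOn c W hW * f) := by
    intro f hf
    obtain ⟨φ, hφ, rfl⟩ := c.exists_section W hW hf
    rw [← hl₀ φ hφ]
    exact BerezinianDensity.IsBerezinIntegral.eq_berezin hI c W hW φ hφ
  obtain ⟨b, hb⟩ := exists_eq_mul_of_frame hr himg coordParity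
    (fun j => c.localDerivation W hW (D j)) (fun j => c.localDerivation_mul W hW (D j)) a ha
    (fun j f hf => by
      obtain ⟨φ, ψ, hψ, -, e⟩ := hsec j f hf
      rw [← e]
      exact c.coord_mem_compact W hW ψ.2 hψ)
    hh l₀ l hber (hkill Dg hinv l₀ hl₀) (hkill μ hμ l hl)
  exact ⟨p, q, c, W, hW, hx, b, fun φ hφ => by
    rw [hl φ hφ, hl₀ φ hφ, hb _ (c.coord_mem_compact W hW φ.2 hφ)]⟩

/-- The left translation by a point of `G₀`. -/
def translation (x : G.space.carrier) : G.space ⟶ G.space :=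
  G.leftTranslation (Supermanifold.pointHom G.pt G.space x)

theorem translation_eq (x : G.space.carrier) :
    G.translation x = G.pmul (Supermanifold.pointHom G.space G.space x) (𝟙 G.space) := by
  change G.pmul (G.isTerminal.from G.space ≫ Supermanifold.pointHom G.pt G.space x) _ = _
  rw [from_comp]
  rfl

/-- The inverse of a point of `G₀`. -/
def pointInv (x : G.space.carrier) : G.space.carrier := SuperSpace.Hom.base G.inv x

theorem translation_comp_pointInv (x : G.space.carrier) :
    G.translation x ≫ G.translation (G.pointInv x) = 𝟙 _ := by
  rw [translation_eq G (G.pointInv x), comp_pmul, Supermanifold.comp_pointHom, Category.comp_id,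
    translation_eq, ← pmul_assoc, pointInv, ← Supermanifold.pointHom_comp, inv_pmul, unit_pmul]

theorem base_translation_pointInv_translation (x y : G.space.carrier) :
    SuperSpace.Hom.base (G.translation (G.pointInv x))
      (SuperSpace.Hom.base (G.translation x) y) = y :=
  congrArg (fun f : G.space ⟶ G.space => SuperSpace.Hom.base f y) (G.translation_comp_pointInv x)

theorem base_translation_unit (x : G.space.carrier) :
    SuperSpace.Hom.base (G.translation x) G.unit = x := by
  have h : Supermanifold.pointHom G.space G.space G.unit ≫ G.translation x =
      Supermanifold.pointHom G.space G.space x := by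
    rw [translation_eq, comp_pmul, Supermanifold.comp_pointHom, Category.comp_id, pmul_unit]
  exact congrArg (fun f : G.space ⟶ G.space => SuperSpace.Hom.base f x) h

/-- A translation-invariant functional that vanishes near the neutral element is zero. -/
theorem eq_zero_of_translate (l : G.space.compactSections →ₗ[𝕜] 𝕜)
    (hl : ∀ (g : G.pt ⟶ G.space) (φ ψ : G.space.compactSections),
      ψ.1 = SuperSpace.Hom.gpull (G.leftTranslation g) φ.1 → l ψ = l φ)
    {p q : ℕ} (c : SuperChart G.space.toSuperSpace p q) (W : Opens G.space.carrier)
    (hW : W ≤ c.dom) (hx : G.unit ∈ W)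
    (h0 : ∀ φ : G.space.compactSections, G.space.supp φ.1 ⊆ W → l φ = 0) : l = 0 := by
  have := G.t2Space
  obtain ⟨U, χ, hU, hχ, hχW⟩ := c.exists_bump W hW hx
  refine SuperSpace.eq_zero_of_locally_eq_zero l fun x => ?_
  let t : SuperSpace.Hom G.space.toSuperSpace G.space.toSuperSpace := G.translation x
  let t' : SuperSpace.Hom G.space.toSuperSpace G.space.toSuperSpace :=
    G.translation (G.pointInv x)
  have ht't : ∀ y, t'.base (t.base y) = y := G.base_translation_pointInv_translation x
  -- Around `x` the bump function is the one at the neutral element, pulled back along translation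
  -- by the inverse of `x`.
  refine ⟨⟨t'.base ⁻¹' U, U.isOpen.preimage t'.continuous_base⟩, t'.gpull χ, ?_,
    SuperSpace.res_gpull_eq_one t' hχ, fun φ hφ => ?_⟩
  · change t'.base x ∈ U
    rw [← G.base_translation_unit x]
    exact (ht't G.unit).symm ▸ hU
  · have h1 : G.space.supp (t.gpull φ.1) ⊆ t'.base '' G.space.supp φ.1 := fun y hy =>
      ⟨t.base y, SuperSpace.supp_gpull_subset t φ.1 hy, ht't y⟩
    have h2 : IsCompact (G.space.supp (t.gpull φ.1)) :=
      (IsCompact.image φ.2 t'.continuous_base).of_isClosed_subset (G.space.isClosed_supp _) h1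
    -- Translation by `x` moves `φ` to a section supported in `W`, without changing the value of
    -- `l`.
    rw [← hl _ φ ⟨t.gpull φ.1, h2⟩ rfl]
    refine h0 _ (h1.trans ?_)
    rintro _ ⟨y, hy, rfl⟩
    exact hχW (SuperSpace.supp_gpull_subset t' χ (hφ hy))

end LieSupergroup

end

theorem mainTheorem4 (𝕜 : Type) [RCLike 𝕜] (G : LieSupergroup 𝕜)
    [SigmaCompactSpace G.space.carrier]
    (Dg : G.Superdistribution) (hDg : Dg.IsInvariantBerezinian)
    (μ : G.Superdistribution) (hμ : μ.IsInvariant) :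
    ∃ c : 𝕜, μ.toLinearMap = c • Dg.toLinearMap := by
  obtain ⟨p, q, c, W, hW, hx, a, ha⟩ := G.exists_eq_mul_near_unit hDg hμ
  -- The factor found near the neutral element is the global one: the difference is
  -- translation-invariant and vanishes on sections supported in `W`.
  refine ⟨a, sub_eq_zero.1 (G.eq_zero_of_translate (μ.toLinearMap - a • Dg.toLinearMap)
    (fun g φ ψ h => ?_) c W hW hx fun φ hφ => ?_)⟩
  · simp only [LinearMap.sub_apply, LinearMap.smul_apply]
    rw [hμ.translate g φ ψ h, hDg.1.translate g φ ψ h]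
  · simp only [LinearMap.sub_apply, LinearMap.smul_apply]
    rw [ha φ hφ, smul_eq_mul, sub_self]
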